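/- Let $0<\alpha\le 1$, let $\lambda,\rho\in\mathbb C$ with $\rho=\kappa\lambda$, $\kappa\in\mathbb C$, $\kappa\neq-1$, and consider the scalar test equation ${}^C_0D_t^\alpha u=\lambda u+\rho u$, $u(0)=u_0$. **The methods.** Let $t_k=kh$, $h>0$, and $$\mathcal A_{k,j}=\int_0^1(1-\theta)^{\alpha-1}(k-j+\theta)^{1-\alpha}\,d\theta,\qquad \mathcal B_{k,j}=\int_0^1(1-\theta)^{\alpha-1}(k-j+\theta)^{2-\alpha}\,d\theta .$$ For $p\in\{0,1\}$ define the coefficients $\gamma^{(p)}_{k,j}$ $(0\le j\le k)$ by $$\sum_{j=0}^k\gamma^{(0)}_{k,j}u_j=\sum_{j=0}^{k-1}(u_{j+1}-u_j)(\mathcal A_{k,j}-\mathcal A_{k,j+1}),$$ $$\sum_{j=0}^k\gamma^{(1)}_{k,j}u_j=\sum_{j=0}^k\gamma^{(0)}_{k,j}u_j+\sum_{j=1}^{k-1}(u_{j+1}-2u_j+u_{j-1})\Big[-\tfrac{\mathcal A_{k,j}+\mathcal A_{k,j+1}}2+\tfrac{\mathcal B_{k,j}-\mathcal B_{k,j+1}}{2-\alpha}\Big].$$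 For $k\ge l+2$ the number $\gamma^{(p)}_{k,k-l}$ does not depend on $k$; denote it by $\gamma^{(p)}_l$, and put $\gamma^{(p)}(\xi)=\sum_{l\ge0}\gamma^{(p)}_l\xi^l$. Let $\beta^{(0)}_0=\frac1{\Gamma(\alpha+1)}$, $\beta^{(1)}_0=\frac1{\Gamma(\alpha+2)}$, $\beta^{(1)}_1=\frac{\alpha}{\Gamma(\alpha+2)}$, and $E_k^0f_k=f_k$, $E_k^1f_k=2f_k-f_{k-1}$. Fix correction powers $0<\sigma_1<\sigma_2<\cdots$ and $0<\delta_1<\delta_2<\cdots$, and numbers $m_u,\tilde m_u,m_f,\tilde m_f\ge0$ of correction terms. The method IMEX($p$) for ${}^C_0D^\alpha_tu=\lambda u+f(t,u)$, with $f_k=f(t_k,u_k)$, is $$\begin{aligned}\frac{u_{k+1}-u_k}{h^\alpha}={}&\lambda\Big[\sum_{j=0}^p\beta^{(p)}_ju_{k+1-j}+\sum_{j=1}^{m_u}W^{(\alpha,\sigma,p)}_{k,j}(u_j-u_0)\Big]+\sum_{j=0}^p\beta^{(p)}_jf_{k+1-j}+\sum_{j=1}^{m_f}W^{(\alpha,\delta,p)}_{k,j}(f_j-f_0)\\&-\frac1{h^\alpha}\Big[\frac1{\Gamma(\alpha)\Gamma(2-\alpha)}\sum_{j=0}^k\gamma^{(p)}_{k,j}u_j+\sum_{j=1}^{\tilde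 m_u}\tilde W^{(\alpha,\sigma,p)}_{k,j}(u_j-u_0)\Big]\\&+\beta^{(p)}_0\Big[-f_{k+1}+E^p_kf_k+\sum_{j=1}^{\tilde m_f}W^{(\delta,p)}_{k,j}(f_j-f_0)\Big],\end{aligned}$$ for $k\ge M:=\max\{m_u,\tilde m_u,m_f,\tilde m_f,p\}$, with starting values $u_0,\dots,u_M$. For each $k$ the correction weights are the unique solutions of $$\sum_{j=1}^{m}W^{(\alpha,s,p)}_{k,j}j^{s_r}=\frac1{\Gamma(\alpha)}\int_k^{k+1}(k+1-v)^{\alpha-1}v^{s_r}dv-\sum_{j=0}^p\beta^{(p)}_j(k+1-j)^{s_r}\quad(1\le r\le m;\ s=\sigma,\,m=m_u,\text{ or }s=\delta,\,m=m_f),$$ $$\sum_{j=1}^{\tilde m_u}\tilde W^{(\alpha,\sigma,p)}_{k,j}j^{\sigma_r}=k^{\sigma_r}-\frac{\Gamma(\sigma_r+1)(k+1)^{\sigma_r}}{\Gamma(\alpha)\Gamma(\sigma_r-\alpha+1)}\int_0^{\frac k{k+1}}v^{\sigma_r-\alpha}(1-v)^{\alpha-1}dv-\frac1{\Gamma(\alpha)\Gamma(2-\alpha)}\sum_{j=0}^k\gamma^{(p)}_{k,j}j^{\sigma_r}\quad(1\le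 r\le\tilde m_u),$$ $$\sum_{j=1}^{\tilde m_f}W^{(\delta,p)}_{k,j}j^{\delta_r}=\begin{cases}(k+1)^{\delta_r}-k^{\delta_r},&p=0\\(k+1)^{\delta_r}-2k^{\delta_r}+(k-1)^{\delta_r},&p=1\end{cases}\quad(1\le r\le\tilde m_f).$$ **Stability region.** $\hat h\in\mathbb C$ belongs to the stability region $S_p$ of IMEX($p$) if, whenever $\hat h=\lambda h^\alpha$ with $h>0$, the method with $f(t,u)=\rho u$, $\rho=\kappa\lambda$, determines for all starting values $u_0,\dots,u_M\in\mathbb C$ a unique sequence $(u_k)$, and all these sequences satisfy $u_k\to0$ as $k\to\infty$. **Theorem.** For $p=0,1$, $\sum_l|\gamma_l^{(p)}|<\infty$. If $\sigma_{m_u},\delta_{m_f},\delta_{\tilde m_f}<1$ and $\sigma_{\tilde m_u}<\alpha+1$ (a condition being void if the corresponding number of terms is $0$), then $$S_0=\mathbb C\setminus\Big\{\hat h:\ \hat h=\frac{\Gamma(\alpha+1)}{1+\kappa\xi}\Big(1-\xi+\frac{\gamma^{(0)}(\xi)\,\xi}{\Gamma(\alpha)\Gamma(2-\alpha)}\Big),\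 |\xi|\le1,\ 1+\kappa\xi\ne0\Big\}.$$ If $\sigma_{m_u},\delta_{m_f},\delta_{\tilde m_f}<2$ and $\sigma_{\tilde m_u}<\alpha+2$, then $$S_1=\mathbb C\setminus\Big\{\hat h:\ \hat h=\frac{\Gamma(\alpha+2)}{(1+\kappa)(\alpha\xi+1)-\kappa(\xi-1)^2}\Big(1-\xi+\frac{\gamma^{(1)}(\xi)\,\xi}{\Gamma(\alpha)\Gamma(2-\alpha)}\Big),\ |\xi|\le1,\ (1+\kappa)(\alpha\xi+1)-\kappa(\xi-1)^2\ne0\Big\}.$$ -/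

import Mathlib

open Filter Topology
open scoped Matrix

noncomputable section

namespace IMEX

/-- The left-sided Riemann-Liouville fractional integral `(ₐI_t^α u)(t)`. -/
def rlIntegral (α a : ℝ) (u : ℝ → ℝ) (t : ℝ) : ℝ :=
  1 / Real.Gamma α * ∫ v in a..t, (t - v) ^ (α - 1) * u v

/-- The incomplete beta function `B(z; a, b)`. -/
def incompleteBeta (z a b : ℝ) : ℝ :=
  ∫ v in (0 : ℝ)..z, v ^ (a - 1) * (1 - v) ^ (b - 1)

/-- The fractional Adams-Moulton coefficients `β_j^{(p)}`, `0 ≤ j ≤ p`, `p = 0, 1`. -/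
def beta (α : ℝ) (p : Fin 2) (j : ℕ) : ℝ :=
  if p = 0 then 1 / Real.Gamma (α + 1)
  else if j = 0 then 1 / Real.Gamma (α + 2)
  else α / Real.Gamma (α + 2)

/-- `A_{k,j} / h`, where `A_{k,j} = ∫_{t_k}^{t_{k+1}} (t_{k+1}-v)^{α-1} (v-t_j)^{1-α} dv` on the
grid `t_k = k h`; this quotient does not depend on `h`. -/
def calA (α : ℝ) (k j : ℕ) : ℝ :=
  ∫ θ in (0 : ℝ)..1, (1 - θ) ^ (α - 1) * ((k : ℝ) - j + θ) ^ (1 - α)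

/-- `B_{k,j} / h²`, where `B_{k,j} = ∫_{t_k}^{t_{k+1}} (t_{k+1}-v)^{α-1} (v-t_j)^{2-α} dv` on the
grid `t_k = k h`; this quotient does not depend on `h`. -/
def calB (α : ℝ) (k j : ℕ) : ℝ :=
  ∫ θ in (0 : ℝ)..1, (1 - θ) ^ (α - 1) * ((k : ℝ) - j + θ) ^ (2 - α)

/-- The discretization coefficients `γ_{k,j}^{(0)}`, `0 ≤ j ≤ k`, of the history load. -/
def gamma0 (α : ℝ) (k j : ℕ) : ℝ :=
  if k = 0 then 0
  else if j = 0 then calA α k 1 - calA α k 0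
  else if j + 1 ≤ k then calA α k (j - 1) - 2 * calA α k j + calA α k (j + 1)
  else calA α k (k - 1) - calA α k k

/-- The discretization coefficients `γ_{k,j}^{(1)}`, `0 ≤ j ≤ k`, of the history load. -/
def gamma1 (α : ℝ) (k j : ℕ) : ℝ :=
  if k = 0 then 0
  else if k = 1 then
    if j = 0 then calA α 1 1 - calA α 1 0 else calA α 1 0 - calA α 1 1
  else if k = 2 then
    if j = 0 then
      (-2 * calA α 2 0 + calA α 2 1 - calA α 2 2) / 2 + (calB α 2 1 - calB α 2 2) / (2 - α)
    else if j = 1 then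
      (calA α 2 0 - calA α 2 1 + 2 * calA α 2 2)
        - (2 * calB α 2 1 - 2 * calB α 2 2) / (2 - α)
    else
      (calA α 2 1 - 3 * calA α 2 2) / 2 + (calB α 2 1 - calB α 2 2) / (2 - α)
  else if j = 0 then
    (-2 * calA α k 0 + calA α k 1 - calA α k 2) / 2 + (calB α k 1 - calB α k 2) / (2 - α)
  else if j = 1 then
    (2 * calA α k 0 - 2 * calA α k 1 + 3 * calA α k 2 - calA α k 3) / 2
      + (-2 * calB α k 1 + 3 * calB α k 2 - calB α k 3) / (2 - α)
  else if j + 2 ≤ k then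
    (calA α k (j - 1) - 3 * calA α k j + 3 * calA α k (j + 1) - calA α k (j + 2)) / 2
      + (calB α k (j - 1) - 3 * calB α k j + 3 * calB α k (j + 1) - calB α k (j + 2)) / (2 - α)
  else if j + 1 = k then
    (calA α k (k - 2) - 3 * calA α k (k - 1) + 4 * calA α k k) / 2
      + (calB α k (k - 2) - 3 * calB α k (k - 1) + 2 * calB α k k) / (2 - α)
  else
    (calA α k (k - 1) - 3 * calA α k k) / 2 + (calB α k (k - 1) - calB α k k) / (2 - α)

/-- `γ_{k,j}^{(p)}` for `p = 0, 1`. -/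
def gammaCoeff (α : ℝ) (p : Fin 2) (k j : ℕ) : ℝ :=
  if p = 0 then gamma0 α k j else gamma1 α k j

/-- The convolution weights `γ_l^{(p)}` of the history load: the common value of
`γ_{k,k-l}^{(p)}` for all `k ≥ l + 2` (see `gammaCoeff_eq_gammaConv`). -/
def gammaConv (α : ℝ) (p : Fin 2) (l : ℕ) : ℝ := gammaCoeff α p (l + 2) 2

theorem calA_congr (α : ℝ) {k j k' j' : ℕ} (h : k + j' = k' + j) :
    calA α k j = calA α k' j' := by
  have h' : (k : ℝ) - j = (k' : ℝ) - j' := by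
    have : (k : ℝ) + j' = k' + j := by exact_mod_cast h
    linarith
  simp only [calA, h']

theorem calB_congr (α : ℝ) {k j k' j' : ℕ} (h : k + j' = k' + j) :
    calB α k j = calB α k' j' := by
  have h' : (k : ℝ) - j = (k' : ℝ) - j' := by
    have : (k : ℝ) + j' = k' + j := by exact_mod_cast h
    linarith
  simp only [calB, h']

/-- Away from the first two columns, `γ_{k,j}^{(p)}` depends on `k - j` only. -/
theorem gammaCoeff_eq_gammaConv (α : ℝ) (p : Fin 2) (k l : ℕ) (h : l + 2 ≤ k) :
    gammaCoeff α p k (k - l) = gammaConv α p l := by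
  fin_cases p
  · obtain rfl | hl := Nat.eq_zero_or_pos l
    · simp only [gammaCoeff, gammaConv, gamma0, Fin.zero_eta, if_true]
      rw [if_neg (by omega), if_neg (by omega), if_neg (by omega), if_neg (by omega),
        if_neg (by omega), if_neg (by omega)]
      congr 1 <;> exact calA_congr α (by omega)
    · simp only [gammaCoeff, gammaConv, gamma0, Fin.zero_eta, if_true]
      rw [if_neg (by omega), if_neg (by omega), if_pos (by omega), if_neg (by omega),
        if_neg (by omega), if_pos (by omega)]
      rw [calA_congr α (show k + (2 - 1) = (l + 2) + (k - l - 1) by omega),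
        calA_congr α (show k + 2 = (l + 2) + (k - l) by omega),
        calA_congr α (show k + (2 + 1) = (l + 2) + (k - l + 1) by omega)]
  · have h10 : (1 : Fin 2) ≠ 0 := by decide
    simp only [gammaCoeff, gammaConv, gamma1, Fin.mk_one, h10, if_false]
    have eA : ∀ i i', k + i' = (l + 2) + i → calA α k i = calA α (l + 2) i' :=
      fun i i' hi => calA_congr α hi
    have eB : ∀ i i', k + i' = (l + 2) + i → calB α k i = calB α (l + 2) i' :=
      fun i i' hi => calB_congr α hi
    obtain rfl | hl := Nat.eq_zero_or_pos l
    · obtain rfl | hk := Nat.eq_or_lt_of_le h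
      · simp
      · rw [if_neg (by omega), if_neg (by omega), if_neg (by omega), if_neg (by omega),
          if_neg (by omega), if_neg (by omega), if_neg (by omega)]
        rw [eA (k - 1) 1 (by omega), eA k 2 (by omega), eB (k - 1) 1 (by omega),
          eB k 2 (by omega)]
        simp
    · rw [if_neg (show ¬ k = 0 by omega), if_neg (show ¬ k = 1 by omega),
        if_neg (show ¬ k = 2 by omega), if_neg (show ¬ k - l = 0 by omega),
        if_neg (show ¬ k - l = 1 by omega),
        if_neg (show ¬ l + 2 = 0 by omega), if_neg (show ¬ l + 2 = 1 by omega),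
        if_neg (show ¬ l + 2 = 2 by omega), if_neg (show ¬ 2 = 0 by omega),
        if_neg (show ¬ 2 = 1 by omega)]
      by_cases hl1 : l = 1
      · subst hl1
        rw [if_neg (by omega), if_pos (by omega), if_neg (by omega), if_pos (by omega),
          eA (k - 2) 1 (by omega), eA (k - 1) 2 (by omega), eA k 3 (by omega),
          eB (k - 2) 1 (by omega), eB (k - 1) 2 (by omega), eB k 3 (by omega)]
      · rw [if_pos (by omega), if_pos (by omega),
          eA (k - l - 1) 1 (by omega), eA (k - l) 2 (by omega), eA (k - l + 1) 3 (by omega),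
          eA (k - l + 2) 4 (by omega),
          eB (k - l - 1) 1 (by omega), eB (k - l) 2 (by omega), eB (k - l + 1) 3 (by omega),
          eB (k - l + 2) 4 (by omega)]

/-- The generating function `γ^{(p)}(ξ) = ∑_{l ≥ 0} γ_l^{(p)} ξ^l`. -/
def gammaGen (α : ℝ) (p : Fin 2) (ξ : ℂ) : ℂ := ∑' l : ℕ, (gammaConv α p l : ℂ) * ξ ^ l

/-- The coefficient matrix `(j^{s_r})_{r,j = 1..m}` of the linear systems for the correction
weights; `s r` stands for the power with index `r + 1`. -/
def powMatrix (s : ℕ → ℝ) (m : ℕ) : Matrix (Fin m) (Fin m) ℝ :=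
  fun r j => ((j : ℝ) + 1) ^ s r

/-- Defect of the fractional Adams-Moulton rule on `t^s` in the step from `k` to `k + 1`. -/
def defectAM (α : ℝ) (p : Fin 2) (k : ℕ) (s : ℝ) : ℝ :=
  rlIntegral α k (fun v => v ^ s) (k + 1)
    - ∑ j ∈ Finset.range ((p : ℕ) + 1), beta α p j * ((k : ℝ) + 1 - j) ^ s

/-- Defect of the discretized history load on `t^s` in the step from `k` to `k + 1`. -/
def defectHist (α : ℝ) (p : Fin 2) (k : ℕ) (s : ℝ) : ℝ :=
  (k : ℝ) ^ s
    - Real.Gamma (s + 1) / (Real.Gamma α * Real.Gamma (s - α + 1)) * ((k : ℝ) + 1) ^ s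
        * incompleteBeta ((k : ℝ) / (k + 1)) (s - α + 1) α
    - 1 / (Real.Gamma α * Real.Gamma (2 - α))
        * ∑ j ∈ Finset.range (k + 1), gammaCoeff α p k j * (j : ℝ) ^ s

/-- Defect of the extrapolation on `t^s` in the step from `k` to `k + 1`. -/
def defectExtra (p : Fin 2) (k : ℕ) (s : ℝ) : ℝ :=
  if p = 0 then ((k : ℝ) + 1) ^ s - (k : ℝ) ^ s
  else ((k : ℝ) + 1) ^ s - 2 * (k : ℝ) ^ s + ((k : ℝ) - 1) ^ s

/-- The solution `(w_1, ..., w_m)` of `∑_{j=1}^m w_j j^{s_r} = defect (s_r)`, `1 ≤ r ≤ m`;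
`weights s m defect j` is `w_{j+1}`. -/
def weights (s : ℕ → ℝ) (m : ℕ) (defect : ℝ → ℝ) : Fin m → ℝ :=
  (powMatrix s m)⁻¹ *ᵥ fun r => defect (s r)

/-- A linear combination of `n` distinct real powers which vanishes at `n` points `> 0` is
trivial. -/
theorem pow_sum_trivial (n : ℕ) : ∀ (s c x : Fin n → ℝ), Function.Injective s → StrictMono x →
    (∀ i, 0 < x i) → (∀ i, ∑ r, c r * x i ^ s r = 0) → ∀ r, c r = 0 := by
  induction n with
  | zero => exact fun _ _ _ _ _ _ _ r => r.elim0
  | succ n ih =>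
    intro s c x hs hx hx0 hzero
    let g : ℝ → ℝ := fun t => c 0 + ∑ r : Fin n, c r.succ * t ^ (s r.succ - s 0)
    let g' : ℝ → ℝ := fun t =>
      ∑ r : Fin n, c r.succ * ((s r.succ - s 0) * t ^ (s r.succ - s 0 - 1))
    have hg : ∀ t, 0 < t → HasDerivAt g (g' t) t := by
      intro t ht
      refine HasDerivAt.const_add _ (HasDerivAt.fun_sum fun r _ => ?_)
      exact (Real.hasDerivAt_rpow_const (Or.inl ht.ne')).const_mul _
    have hgz : ∀ i, g (x i) = 0 := by
      intro i
      have h1 := hzero i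
      have h2 : x i ^ s 0 * g (x i) = ∑ r, c r * x i ^ s r := by
        rw [Fin.sum_univ_succ]
        simp only [g, mul_add, Finset.mul_sum]
        congr 1
        · ring
        · refine Finset.sum_congr rfl fun r _ => ?_
          rw [Real.rpow_sub (hx0 i)]
          field_simp [(Real.rpow_pos_of_pos (hx0 i) (s 0)).ne']
      rw [h1] at h2
      exact (mul_eq_zero.mp h2).resolve_left (Real.rpow_pos_of_pos (hx0 i) _).ne'
    have hroll : ∀ i : Fin n, ∃ y ∈ Set.Ioo (x i.castSucc) (x i.succ), g' y = 0 := by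
      intro i
      refine exists_hasDerivAt_eq_zero (hx (Fin.castSucc_lt_succ)) ?_
        ((hgz _).trans (hgz _).symm) fun t ht => hg t ((hx0 _).trans ht.1)
      exact fun t ht => (hg t ((hx0 _).trans_le ht.1)).continuousAt.continuousWithinAt
    choose y hy hy0 using hroll
    have hymono : StrictMono y := by
      intro i j hij
      have h1 : x i.succ ≤ x j.castSucc := hx.monotone (by
        rw [Fin.le_def]; simpa using hij)
      exact (hy i).2.trans_le (h1.trans (hy j).1.le)
    have hc := ih (fun r => s r.succ - s 0 - 1) (fun r => c r.succ * (s r.succ - s 0)) y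
      (fun a b hab => Fin.succ_injective _ (hs (by simpa using hab))) hymono
      (fun i => (hx0 _).trans (hy i).1)
      (fun i => by rw [← hy0 i]; exact Finset.sum_congr rfl fun r _ => by ring)
    have hc' : ∀ r : Fin n, c r.succ = 0 := fun r =>
      (mul_eq_zero.mp (hc r)).resolve_right
        (sub_ne_zero.mpr fun h => Fin.succ_ne_zero r (hs h))
    intro r
    refine Fin.cases ?_ hc' r
    simpa [g, hc'] using hgz 0

theorem powMatrix_isUnit_det (s : ℕ → ℝ) (hs : StrictMono s) (m : ℕ) :
    IsUnit (powMatrix s m).det := by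
  rw [isUnit_iff_ne_zero, ← Matrix.det_transpose]
  intro hdet
  obtain ⟨v, hv, hv0⟩ := Matrix.exists_mulVec_eq_zero_iff.mpr hdet
  refine hv (funext fun r => pow_sum_trivial m (fun r => s r) v (fun j => (j : ℝ) + 1)
    (fun a b hab => Fin.ext (hs.injective hab)) (fun a b hab => ?_) (fun i => by positivity)
    (fun i => ?_) r)
  · have : (a : ℕ) < b := hab
    simpa using this
  · have := congrFun hv0 i
    simp only [Matrix.mulVec, dotProduct, Matrix.transpose_apply, powMatrix,
      Pi.zero_apply] at this
    rw [← this]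
    exact Finset.sum_congr rfl fun r _ => mul_comm _ _

/-- The weights are the unique solution of their linear system. -/
theorem weights_iff (s : ℕ → ℝ) (hs : StrictMono s) (m : ℕ) (defect : ℝ → ℝ) (w : Fin m → ℝ) :
    w = weights s m defect ↔
      ∀ r : Fin m, ∑ j : Fin m, w j * ((j : ℝ) + 1) ^ s r = defect (s r) := by
  have hu := powMatrix_isUnit_det s hs m
  have key : (∀ r : Fin m, ∑ j : Fin m, w j * ((j : ℝ) + 1) ^ s r = defect (s r)) ↔
      powMatrix s m *ᵥ w = fun r : Fin m => defect (s r) := by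
    rw [funext_iff]
    refine forall_congr' fun r => ?_
    simp only [Matrix.mulVec, dotProduct, powMatrix, mul_comm]
  rw [key, weights]
  constructor
  · rintro rfl
    rw [Matrix.mulVec_mulVec, Matrix.mul_nonsing_inv _ hu, Matrix.one_mulVec]
  · intro h
    rw [← h, Matrix.mulVec_mulVec, Matrix.nonsing_inv_mul _ hu, Matrix.one_mulVec]

/-- Correction powers and numbers of correction terms: `σ r`, `δ r` are the powers `σ_{r+1}`,
`δ_{r+1}`, and `mU`, `mU'`, `mF`, `mF'` are `m_u`, `m̃_u`, `m_f`, `m̃_f`. -/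
structure Corrections where
  σ : ℕ → ℝ
  δ : ℕ → ℝ
  σ_pos : ∀ r, 0 < σ r
  σ_mono : StrictMono σ
  δ_pos : ∀ r, 0 < δ r
  δ_mono : StrictMono δ
  mU : ℕ
  mU' : ℕ
  mF : ℕ
  mF' : ℕ

/-- The sum `∑_{j=1}^m w_j (v_j - v_0)`. -/
def corr {m : ℕ} (w : Fin m → ℝ) (v : ℕ → ℂ) : ℂ :=
  ∑ j : Fin m, (w j : ℂ) * (v (j + 1) - v 0)

/-- The corrected fractional Adams-Moulton rule `I_{h,m}^{α,s,p} v_{k+1}`. -/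
def corrAM (α : ℝ) (p : Fin 2) (s : ℕ → ℝ) (m : ℕ) (k : ℕ) (v : ℕ → ℂ) : ℂ :=
  ∑ j ∈ Finset.range ((p : ℕ) + 1), (beta α p j : ℂ) * v (k + 1 - j)
    + corr (weights s m (defectAM α p k)) v

/-- The corrected discrete history load `H_m^{α,s,p} v_{k+1}`. -/
def corrHist (α : ℝ) (p : Fin 2) (s : ℕ → ℝ) (m : ℕ) (k : ℕ) (v : ℕ → ℂ) : ℂ :=
  1 / ((Real.Gamma α * Real.Gamma (2 - α) : ℝ) : ℂ)
      * ∑ j ∈ Finset.range (k + 1), (gammaCoeff α p k j : ℂ) * v j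
    + corr (weights s m (defectHist α p k)) v

/-- The extrapolation `E_k^p v_k`. -/
def extrapolate (p : Fin 2) (k : ℕ) (v : ℕ → ℂ) : ℂ :=
  if p = 0 then v k else 2 * v k - v (k - 1)

/-- Index of the last starting value: `u_0, ..., u_M` with `M = max{m_u, m̃_u, m_f, m̃_f}` are
needed for the correction terms, and `u_1` is needed for the extrapolation if `p = 1`. -/
def lastStart (D : Corrections) (p : Fin 2) : ℕ :=
  max (max (max D.mU D.mU') (max D.mF D.mF')) (p : ℕ)

/-- `u` is generated by the method IMEX(`p`) with step size `h` (from its starting values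
`u_0, ..., u_{lastStart}`), for the problem `D^α u = lam u + f(t, u)`. -/
def IsIMEXSequence (α : ℝ) (p : Fin 2) (D : Corrections) (h : ℝ) (lam : ℂ) (f : ℝ → ℂ → ℂ)
    (u : ℕ → ℂ) : Prop :=
  let F : ℕ → ℂ := fun k => f (k * h) (u k)
  ∀ k : ℕ, lastStart D p ≤ k →
    (u (k + 1) - u k) / ((h ^ α : ℝ) : ℂ) =
      lam * corrAM α p D.σ D.mU k u
        + corrAM α p D.δ D.mF k F
        - 1 / ((h ^ α : ℝ) : ℂ) * corrHist α p D.σ D.mU' k u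
        + (beta α p 0 : ℂ) * (-F (k + 1) + extrapolate p k F
            + corr (weights D.δ D.mF' (defectExtra p k)) F)

/-- Linear stability for the test equation `D^α u = lam u + rho u`: the method determines a
unique sequence from any starting values, and every sequence it generates tends to zero. -/
def IsStable (α : ℝ) (p : Fin 2) (D : Corrections) (h : ℝ) (lam rho : ℂ) : Prop :=
  (∀ s : Fin (lastStart D p + 1) → ℂ,
    ∃! u : ℕ → ℂ, (∀ j : Fin (lastStart D p + 1), u (j : ℕ) = s j) ∧
      IsIMEXSequence α p D h lam (fun _ v => rho * v) u) ∧
  ∀ u : ℕ → ℂ, IsIMEXSequence α p D h lam (fun _ v => rho * v) u → Tendsto u atTop (𝓝 0)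

/-- The stability region of IMEX(`p`) in terms of `ĥ = lam h^α`, where `rho = κ lam`. -/
def stabilityRegion (α : ℝ) (p : Fin 2) (D : Corrections) (κ : ℂ) : Set ℂ :=
  {z | ∀ (h : ℝ) (lam : ℂ), 0 < h → lam * ((h ^ α : ℝ) : ℂ) = z →
    IsStable α p D h lam (κ * lam)}

/-- The bounds `σ_{m_u}, δ_{m_f}, δ_{m̃_f} < p + 1` and `σ_{m̃_u} < α + p + 1`. -/
def PowersBounded (α : ℝ) (p : Fin 2) (D : Corrections) : Prop :=
  (∀ r < D.mU, D.σ r < (p : ℕ) + 1) ∧ (∀ r < D.mF, D.δ r < (p : ℕ) + 1) ∧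
  (∀ r < D.mF', D.δ r < (p : ℕ) + 1) ∧ (∀ r < D.mU', D.σ r < α + (p : ℕ) + 1)

end IMEX

end

/-! Multiplied by h^α, the scheme becomes a convolution recurrence `conv a u (k + 1) = R k u` with
`a = recCoeff` and `R = recStart` (`isIMEXSequence_iff`). The right-hand side sees only the starting
values: it collects the correction terms and the deviation of the first p + 1 history columns from
convolution form. The generating function of a is P(ξ) - z Q(ξ), where P is `symbolZero` and Q is
the polynomial with coefficients `imexCoeff`. The core statement is `mem_stabilityRegion_iff`: z is
stable exactly when P - zQ has no zero in the closed unit disc.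

If there is no zero, a Wiener lemma (`exists_conv_eq`, by Gelfand theory for the algebra generated
by the shift on null sequences) makes convolution with a surjective on null sequences, and a 0 ≠ 0
makes solutions unique. Since R k u → 0, every solution is a null sequence. That R k u → 0 rests on
the decay of the defects of the three discretizations on powers (`tendsto_defectAM`,
`tendsto_defectExtra`, `tendsto_defectHist`).

If ξ is a zero, start from the constant 1. On constants the history load and the corrections vanish,
but the source λ(1 + κ) does not, so u - 1 answers a step input of height b ≠ 0 when z ≠ 0. Decay of
u would force b ξ^(M+1) (1 - ξ) = 0 (`not_stable_of_zero`). The point ξ = 1 is excluded because P(1)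
= 0 and Q(1) ≠ 0; for z = 0 the constant itself is a solution that does not decay.

Passing to the quotient form requires that P and Q have no common zero in the disc. This follows
from `eq_one_of_symbolZero_eq_zero`: P vanishes there only at 1. Its proof reads P(ξ) = 0 as ∑ w_n
ξ^(n+1) = 1 with nonnegative weights of total mass 1, and the signs of γ_l are what has to be
proved. The weights γ_l are integrals of a decreasing kernel K = `histKernel` with K(0) = 1 and K' =
-C x^(-α)/(1 + x), C > 0. For p = 0 monotonicity suffices; for p = 1 the sign comes from comparison
with log((1 + x)/x) (`stencil_pos`). The case α = 1, where the history disappears, is treated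
separately. -/

open Filter Topology
open scoped Matrix

noncomputable section

namespace IMEX

/-! ### Convolution on null sequences and a Wiener lemma. -/

section

/-- The Cauchy product of two sequences. -/
def conv (a u : ℕ → ℂ) (n : ℕ) : ℂ := ∑ p ∈ Finset.HasAntidiagonal.antidiagonal n, a p.1 * u p.2

theorem conv_eq_coeff (a u : ℕ → ℂ) (n : ℕ) :
    conv a u n = PowerSeries.coeff n (PowerSeries.mk a * PowerSeries.mk u) := by
  simp [conv, PowerSeries.coeff_mul]

theorem conv_eq_sum_range (a u : ℕ → ℂ) (n : ℕ) :
    conv a u n = ∑ l ∈ Finset.range (n + 1), a l * u (n - l) :=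
  Finset.Nat.sum_antidiagonal_eq_sum_range_succ (fun i j => a i * u j) n

theorem conv_eq_sum_range' (a u : ℕ → ℂ) (n : ℕ) :
    conv a u n = ∑ j ∈ Finset.range (n + 1), a (n - j) * u j := by
  rw [conv_eq_sum_range, ← Finset.sum_range_reflect]
  refine Finset.sum_congr rfl fun j hj => ?_
  have := Finset.mem_range.mp hj
  rw [show n + 1 - 1 - j = n - j by omega, show n - (n - j) = j by omega]

theorem conv_sub (a u v : ℕ → ℂ) (n : ℕ) :
    conv a (fun k => u k - v k) n = conv a u n - conv a v n := by
  simp [conv, mul_sub, Finset.sum_sub_distrib]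

/-- Convolution of a summable sequence with a null sequence is a null sequence. -/
theorem tendsto_conv_zero {E : Type*} [NormedRing E] [CompleteSpace E] {a r : ℕ → E}
    (ha : Summable fun n => ‖a n‖)
    (hr : Tendsto r atTop (𝓝 0)) :
    Tendsto (fun n => ∑ l ∈ Finset.range (n + 1), a l * r (n - l)) atTop (𝓝 0) := by
  obtain ⟨C, hC⟩ : ∃ C, ∀ n, ‖r n‖ ≤ C := by
    obtain ⟨C, hC⟩ := hr.norm.bddAbove_range
    exact ⟨C, fun n => hC ⟨n, rfl⟩⟩
  -- The finite sum is extended by zero to all l, so that dominated convergence for series applies.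
  have key := tendsto_tsum_of_dominated_convergence (𝓕 := atTop)
    (f := fun n l => if l ≤ n then a l * r (n - l) else 0) (g := fun _ => (0 : E))
    (bound := fun l => ‖a l‖ * C) (ha.mul_right C) (fun l => ?_) (Eventually.of_forall fun n l => ?_)
  · rw [tsum_zero] at key
    refine key.congr fun n => ?_
    rw [tsum_eq_sum (s := Finset.range (n + 1))]
    · refine Finset.sum_congr rfl fun l hl => if_pos ?_
      have := Finset.mem_range.mp hl
      omega
    · intro l hl
      exact if_neg fun h => hl (Finset.mem_range.mpr (by omega))
  · have h1 : Tendsto (fun n => a l * r (n - l)) atTop (𝓝 0) := by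
      simpa using (hr.comp (tendsto_sub_atTop_nat l)).const_mul (a l)
    refine h1.congr' ?_
    filter_upwards [eventually_ge_atTop l] with n hn using (if_pos hn).symm
  · split_ifs
    · exact (norm_mul_le _ _).trans (mul_le_mul_of_nonneg_left (hC _) (norm_nonneg _))
    · simpa using mul_nonneg (norm_nonneg (a l)) ((norm_nonneg _).trans (hC 0))

open scoped ZeroAtInfty

/-- A null sequence as an element of `C₀(ℕ, ℂ)`. -/
def nullSeq (f : ℕ → ℂ) (hf : Tendsto f atTop (𝓝 0)) : C₀(ℕ, ℂ) where
  toFun := f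
  continuous_toFun := continuous_of_discreteTopology
  zero_at_infty' := by rwa [Filter.cocompact_eq_cofinite, Nat.cofinite_eq_atTop]

theorem tendsto_of_zeroAtInfty (f : C₀(ℕ, ℂ)) : Tendsto f atTop (𝓝 0) := by
  have := f.zero_at_infty'
  rwa [Filter.cocompact_eq_cofinite, Nat.cofinite_eq_atTop] at this

theorem norm_apply_le_zeroAtInfty (f : C₀(ℕ, ℂ)) (n : ℕ) : ‖f n‖ ≤ ‖f‖ :=
  f.toBCF.norm_coe_le_norm n

/-- The right shift on null sequences. -/
def shiftFun (f : C₀(ℕ, ℂ)) : C₀(ℕ, ℂ) :=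
  nullSeq (fun n => if n = 0 then 0 else f (n - 1)) (by
    refine ((tendsto_of_zeroAtInfty f).comp (tendsto_sub_atTop_nat 1)).congr' ?_
    filter_upwards [eventually_gt_atTop 0] with n hn using (if_neg hn.ne').symm)

theorem shiftFun_apply (f : C₀(ℕ, ℂ)) (n : ℕ) :
    shiftFun f n = if n = 0 then 0 else f (n - 1) := rfl

theorem norm_shiftFun_le (f : C₀(ℕ, ℂ)) : ‖shiftFun f‖ ≤ ‖f‖ := by
  have h : ‖(shiftFun f).toBCF‖ ≤ ‖f‖ := by
    refine (BoundedContinuousFunction.norm_le (norm_nonneg f)).mpr fun n => ?_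
    change ‖shiftFun f n‖ ≤ ‖f‖
    rw [shiftFun_apply]
    split_ifs
    · simp
    · exact norm_apply_le_zeroAtInfty f (n - 1)
  exact h

/-- The right shift as a bounded operator on null sequences. -/
def shift : C₀(ℕ, ℂ) →L[ℂ] C₀(ℕ, ℂ) :=
  LinearMap.mkContinuous
    { toFun := shiftFun
      map_add' := fun f g => by
        ext n
        by_cases h : n = 0 <;> simp [shiftFun_apply, h]
      map_smul' := fun c f => by
        ext n
        by_cases h : n = 0 <;> simp [shiftFun_apply, h] } 1
    (fun f => by simpa using norm_shiftFun_le f)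

theorem shift_apply (f : C₀(ℕ, ℂ)) (n : ℕ) : shift f n = if n = 0 then 0 else f (n - 1) := rfl

theorem norm_shift_le : ‖shift‖ ≤ 1 := LinearMap.mkContinuous_norm_le _ zero_le_one _

theorem shift_pow_apply (l : ℕ) (f : C₀(ℕ, ℂ)) (n : ℕ) :
    (shift ^ l) f n = if l ≤ n then f (n - l) else 0 := by
  induction l generalizing n with
  | zero => simp
  | succ l ih =>
    rw [pow_succ', mul_apply_eq_comp, shift_apply]
    by_cases hn : n = 0
    · simp [hn]
    · rw [if_neg hn, ih]
      by_cases h : l + 1 ≤ n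
      · rw [if_pos (by omega), if_pos h, Nat.sub_sub, Nat.add_comm]
      · rw [if_neg (by omega), if_neg h]

theorem norm_pow_le_one_of_norm_le_one {R : Type*} [NormedRing R] (h1 : ‖(1 : R)‖ ≤ 1) {S : R}
    (hS : ‖S‖ ≤ 1) (l : ℕ) : ‖S ^ l‖ ≤ 1 := by
  induction l with
  | zero => simpa using h1
  | succ l ih =>
    rw [pow_succ]
    exact (norm_mul_le _ _).trans (mul_le_one₀ ih (norm_nonneg _) hS)

theorem summable_smul_pow {R : Type*} [NormedRing R] [NormedAlgebra ℂ R] [CompleteSpace R]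
    (h1 : ‖(1 : R)‖ ≤ 1) {S : R} (hS : ‖S‖ ≤ 1) {a : ℕ → ℂ} (ha : Summable fun n => ‖a n‖) :
    Summable fun l => a l • S ^ l := by
  refine Summable.of_norm_bounded ha fun l => ?_
  rw [norm_smul]
  exact mul_le_of_le_one_right (norm_nonneg _) (norm_pow_le_one_of_norm_le_one h1 hS l)

/-- Gelfand theory needs commutativity, which the operator algebra lacks but the closed subalgebra
generated by one element has. -/
instance elementalNormedCommRing {R : Type*} [NormedRing R] [NormedAlgebra ℂ R] (S : R) :
    NormedCommRing (Algebra.elemental ℂ S) :=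
  { (inferInstance : NormedRing (Algebra.elemental ℂ S)) with
    mul_comm := fun a b => mul_comm a b }

/-- A power series with summable coefficients and no zero in the closed unit disc is invertible
at every contraction. -/
theorem exists_tsum_smul_pow_mul_eq_one {R : Type*} [NormedRing R] [NormedAlgebra ℂ R]
    [CompleteSpace R] (h1 : ‖(1 : R)‖ ≤ 1) {S : R} (hS : ‖S‖ ≤ 1) {a : ℕ → ℂ}
    (ha : Summable fun n => ‖a n‖) (h0 : ∀ ξ : ℂ, ‖ξ‖ ≤ 1 → ∑' l, a l * ξ ^ l ≠ 0) :
    ∃ b : R, (∑' l, a l • S ^ l) * b = 1 := by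
  let B := Algebra.elemental ℂ S
  let S' : B := ⟨S, Algebra.elemental.self_mem ℂ S⟩
  have hsum : Summable fun l => a l • S' ^ l := summable_smul_pow (R := B) h1 hS ha
  have hunit : IsUnit (∑' l, a l • S' ^ l) := by
    -- A non-unit of a commutative complex Banach algebra is annihilated by a character f.
    -- Continuity of f turns this into a zero of the power series at f S', a point of modulus at
    -- most ‖S‖ ≤ 1.
    by_contra hcon
    obtain ⟨f, hf⟩ := WeakDual.CharacterSpace.exists_apply_eq_zero hcon
    have h2 := hsum.hasSum.map f (map_continuous f)
    have h3 : (f ∘ fun l => a l • S' ^ l) = fun l => a l * (f S') ^ l := by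
      funext l
      simp
    rw [h3, hf] at h2
    refine h0 (f S') ?_ h2.tsum_eq
    refine (spectrum.norm_le_norm_mul_of_mem (AlgHom.apply_mem_spectrum
      (WeakDual.CharacterSpace.toAlgHom f) S')).trans ?_
    exact mul_le_one₀ hS (norm_nonneg _) h1
  obtain ⟨b, hb⟩ := hunit.exists_right_inv
  have hval : ((∑' l, a l • S' ^ l : B) : R) = ∑' l, a l • S ^ l :=
    ((hsum.hasSum.map (Subalgebra.val B) continuous_subtype_val).tsum_eq).symm
  refine ⟨b, ?_⟩
  rw [← hval, ← Subalgebra.coe_mul, hb]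
  rfl

/-- Evaluation at f and n is a continuous additive map on operators, so the operator series can be
evaluated term by term; only l ≤ n survives. -/
theorem tsum_shift_apply {a : ℕ → ℂ} (ha : Summable fun n => ‖a n‖) (f : C₀(ℕ, ℂ)) (n : ℕ) :
    (∑' l, a l • shift ^ l : C₀(ℕ, ℂ) →L[ℂ] C₀(ℕ, ℂ)) f n = conv a f n := by
  have hs : Summable fun l => a l • shift ^ l :=
    summable_smul_pow (R := C₀(ℕ, ℂ) →L[ℂ] C₀(ℕ, ℂ)) ContinuousLinearMap.norm_id_le norm_shift_le ha
  let ev : (C₀(ℕ, ℂ) →L[ℂ] C₀(ℕ, ℂ)) →+ ℂ :=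
    { toFun := fun T => T f n, map_zero' := rfl, map_add' := fun _ _ => rfl }
  have hev : Continuous ev := by
    refine AddMonoidHomClass.continuous_of_bound ev ‖f‖ fun T => ?_
    exact (norm_apply_le_zeroAtInfty _ n).trans ((T.le_opNorm f).trans (mul_comm _ _).le)
  have h1 := hs.hasSum.map ev hev
  have h2 : (ev ∘ fun l => a l • shift ^ l) = fun l => if l ≤ n then a l * f (n - l) else 0 := by
    funext l
    change a l * (shift ^ l) f n = _
    rw [shift_pow_apply]
    split_ifs <;> simp
  rw [h2] at h1
  refine h1.unique ?_
  rw [conv_eq_sum_range]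
  have h3 := hasSum_sum_of_ne_finset_zero (s := Finset.range (n + 1)) (L := .unconditional ℕ)
    (f := fun l => if l ≤ n then a l * f (n - l) else 0) (fun l hl =>
      if_neg fun h => hl (Finset.mem_range.mpr (by omega)))
  convert h3 using 1
  refine Finset.sum_congr rfl fun l hl => (if_pos ?_).symm
  have := Finset.mem_range.mp hl
  omega

/-- A Wiener lemma: convolution with a summable sequence whose generating function has no zero
in the closed unit disc is surjective on null sequences. -/
theorem exists_conv_eq {a : ℕ → ℂ} (ha : Summable fun n => ‖a n‖)
    (h0 : ∀ ξ : ℂ, ‖ξ‖ ≤ 1 → ∑' l, a l * ξ ^ l ≠ 0) {g : ℕ → ℂ} (hg : Tendsto g atTop (𝓝 0)) :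
    ∃ w : ℕ → ℂ, Tendsto w atTop (𝓝 0) ∧ ∀ n, conv a w n = g n := by
  obtain ⟨b, hb⟩ := exists_tsum_smul_pow_mul_eq_one (R := C₀(ℕ, ℂ) →L[ℂ] C₀(ℕ, ℂ))
    ContinuousLinearMap.norm_id_le norm_shift_le ha h0
  refine ⟨b (nullSeq g hg), tendsto_of_zeroAtInfty _, fun n => ?_⟩
  rw [← tsum_shift_apply ha]
  change ((∑' l, a l • shift ^ l) * b) (nullSeq g hg) n = _
  rw [hb]
  rfl

end

/-! ### Convolution recurrences: solvability, decay, and an instability criterion. -/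

section

theorem conv_congr {a u v : ℕ → ℂ} {n : ℕ} (h : ∀ j ≤ n, u j = v j) : conv a u n = conv a v n := by
  rw [conv_eq_sum_range', conv_eq_sum_range']
  refine Finset.sum_congr rfl fun j hj => ?_
  rw [h j (by have := Finset.mem_range.mp hj; omega)]

/-- The system is lower triangular with diagonal entry a 0. -/
theorem eq_of_conv_eq {a u v : ℕ → ℂ} (ha : a 0 ≠ 0) {N : ℕ}
    (h : ∀ n ≤ N, conv a u n = conv a v n) : ∀ n ≤ N, u n = v n := by
  intro n
  induction n using Nat.strong_induction_on with
  | _ n ih =>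
    intro hn
    have h1 := h n hn
    rw [conv_eq_sum_range', conv_eq_sum_range', Finset.sum_range_succ, Finset.sum_range_succ,
      Finset.sum_congr rfl fun j hj => by
        rw [ih j (Finset.mem_range.mp hj) ((Finset.mem_range.mp hj).le.trans hn)]] at h1
    simpa [ha] using h1

theorem exists_conv_eq_of_ne_zero {a : ℕ → ℂ} (ha : a 0 ≠ 0) (g : ℕ → ℂ) :
    ∃ u : ℕ → ℂ, ∀ n, conv a u n = g n := by
  refine ⟨fun n => PowerSeries.coeff n ((PowerSeries.mk a)⁻¹ * PowerSeries.mk g), fun n => ?_⟩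
  rw [conv_eq_coeff]
  have : (PowerSeries.mk fun n => PowerSeries.coeff n ((PowerSeries.mk a)⁻¹ * PowerSeries.mk g)) =
      (PowerSeries.mk a)⁻¹ * PowerSeries.mk g := by
    ext n
    simp
  rw [this, ← mul_assoc, PowerSeries.mul_inv_cancel _ (by simpa using ha), one_mul]
  simp

/-- The sequence `u` solves the convolution recurrence with right-hand side `R` from index
`M + 1` on. -/
def IsConvSolution (a : ℕ → ℂ) (M : ℕ) (R : ℕ → (ℕ → ℂ) → ℂ) (u : ℕ → ℂ) : Prop :=
  ∀ k, M ≤ k → conv a u (k + 1) = R k u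

/-- The right-hand side `R` depends on the first `M + 1` terms only. -/
def DependsOnStart (M : ℕ) (R : ℕ → (ℕ → ℂ) → ℂ) : Prop :=
  ∀ k u v, (∀ j ≤ M, u j = v j) → R k u = R k v

theorem existsUnique_convSolution {a : ℕ → ℂ} (ha : a 0 ≠ 0) {M : ℕ} {R : ℕ → (ℕ → ℂ) → ℂ}
    (hR : DependsOnStart M R) (s : Fin (M + 1) → ℂ) :
    ∃! u : ℕ → ℂ, (∀ j : Fin (M + 1), u (j : ℕ) = s j) ∧ IsConvSolution a M R u := by
  let s' : ℕ → ℂ := fun n => if h : n < M + 1 then s ⟨n, h⟩ else 0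
  have hs' : ∀ u : ℕ → ℂ, (∀ j : Fin (M + 1), u (j : ℕ) = s j) ↔ ∀ j ≤ M, u j = s' j := by
    intro u
    constructor
    · intro h j hj
      have := h ⟨j, Nat.lt_succ_of_le hj⟩
      have h2 : s' j = s ⟨j, Nat.lt_succ_of_le hj⟩ := dif_pos (Nat.lt_succ_of_le hj)
      exact this.trans h2.symm
    · intro h j
      rw [h j (Nat.le_of_lt_succ j.2)]
      exact dif_pos j.2
  -- The right-hand side up to index M is chosen so that forward substitution reproduces the
  -- starting values.
  obtain ⟨u, hu⟩ := exists_conv_eq_of_ne_zero ha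
    fun n => if n ≤ M then conv a s' n else R (n - 1) s'
  have hus : ∀ j ≤ M, u j = s' j := eq_of_conv_eq ha fun n hn => by rw [hu, if_pos hn]
  refine ⟨u, ⟨(hs' u).mpr hus, fun k hk => ?_⟩, ?_⟩
  · rw [hu, if_neg (by omega), Nat.add_sub_cancel]
    exact hR k _ _ fun j hj => (hus j hj).symm
  · rintro v ⟨hv, hv'⟩
    rw [hs'] at hv
    funext n
    refine eq_of_conv_eq ha (N := n) (fun m _ => ?_) n le_rfl
    rw [hu]
    split_ifs with hm
    · exact conv_congr fun j hj => hv j (hj.trans hm)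
    · have := hv' (m - 1) (by omega)
      rw [show m - 1 + 1 = m by omega] at this
      rw [this]
      exact hR _ _ _ hv

/-- The Wiener lemma supplies a null sequence with the same convolution; the value of the symbol at
ξ = 0 is a 0 ≠ 0, so u must be that sequence. -/
theorem tendsto_zero_of_isConvSolution {a : ℕ → ℂ} (ha : Summable fun n => ‖a n‖)
    (h0 : ∀ ξ : ℂ, ‖ξ‖ ≤ 1 → ∑' l, a l * ξ ^ l ≠ 0) {M : ℕ} {R : ℕ → (ℕ → ℂ) → ℂ}
    (hR0 : ∀ u, Tendsto (fun k => R k u) atTop (𝓝 0)) {u : ℕ → ℂ}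
    (hu : IsConvSolution a M R u) : Tendsto u atTop (𝓝 0) := by
  have ha0 : a 0 ≠ 0 := by
    have h := h0 0 (by simp)
    rw [tsum_eq_single 0 (fun l hl => by simp [hl])] at h
    simpa using h
  have hg : Tendsto (conv a u) atTop (𝓝 0) := by
    rw [← tendsto_add_atTop_iff_nat 1]
    refine (hR0 u).congr' ?_
    filter_upwards [eventually_ge_atTop M] with k hk using (hu k hk).symm
  obtain ⟨w, hw, hw'⟩ := exists_conv_eq ha h0 hg
  have : u = w := funext fun n => eq_of_conv_eq ha0 (fun m _ => (hw' m).symm) n le_rfl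
  rwa [this]

/-- The backward difference of a sequence. -/
def bdiff (u : ℕ → ℂ) (n : ℕ) : ℂ := if n = 0 then u 0 else u n - u (n - 1)

theorem mk_bdiff (u : ℕ → ℂ) :
    PowerSeries.mk (bdiff u) = (1 - PowerSeries.X) * PowerSeries.mk u := by
  ext n
  rw [sub_mul, one_mul, map_sub]
  cases n with
  | zero => simp [bdiff]
  | succ n => simp [bdiff, PowerSeries.coeff_succ_X_mul]

theorem conv_bdiff_right (a u : ℕ → ℂ) (n : ℕ) : conv a (bdiff u) n = bdiff (conv a u) n := by
  have : PowerSeries.mk (bdiff (conv a u)) = PowerSeries.mk a * PowerSeries.mk (bdiff u) := by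
    have h : PowerSeries.mk (conv a u) = PowerSeries.mk a * PowerSeries.mk u := by
      ext n
      rw [PowerSeries.coeff_mk, conv_eq_coeff]
    rw [mk_bdiff, mk_bdiff, h]
    ring
  rw [conv_eq_coeff, ← this, PowerSeries.coeff_mk]

theorem conv_comm (a u : ℕ → ℂ) (n : ℕ) : conv a u n = conv u a n := by
  rw [conv_eq_coeff, conv_eq_coeff, mul_comm]

/-- The tails of a sequence with a summable first moment are summable. -/
theorem summable_tails {b : ℕ → ℝ} (hb : ∀ n, 0 ≤ b n)
    (h : Summable fun n : ℕ => ((n : ℝ) + 1) * b n) :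
    Summable b ∧ Summable fun m : ℕ => ∑' l, b (m + l) := by
  have hsum : Summable b := by
    refine Summable.of_nonneg_of_le hb (fun n => ?_) h
    nlinarith [hb n, (Nat.cast_nonneg n : (0 : ℝ) ≤ n)]
  refine ⟨hsum, ?_⟩
  -- Along the antidiagonal m + l = n the value b n occurs n + 1 times, which is the first moment.
  have h2 : Summable fun q : ℕ × ℕ => b (q.1 + q.2) := by
    rw [← Finset.HasAntidiagonal.sigmaAntidiagonalEquivProd.summable_iff, summable_sigma_of_nonneg]
    · refine ⟨fun n => (hasSum_fintype _).summable, ?_⟩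
      refine h.congr fun n => ?_
      rw [tsum_fintype]
      have : ∀ x : Finset.HasAntidiagonal.antidiagonal n,
          ((fun q : ℕ × ℕ => b (q.1 + q.2)) ∘
            Finset.HasAntidiagonal.sigmaAntidiagonalEquivProd) ⟨n, x⟩ = b n := by
        intro x
        exact congrArg b (Finset.HasAntidiagonal.mem_antidiagonal.mp x.2)
      rw [Finset.sum_congr rfl fun x _ => this x]
      simp
    · exact fun _ => hb _
  exact h2.prod

/-- If `d` is a null sequence, `a` has a summable first moment and its generating function
vanishes at `ξ`, then the partial sums at `ξ` of the Cauchy product tend to zero. -/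
theorem tendsto_partial_sums_conv {a d : ℕ → ℂ}
    (ha : Summable fun n : ℕ => ((n : ℝ) + 1) * ‖a n‖)
    (hd : Tendsto d atTop (𝓝 0)) {ξ : ℂ} (hξ : ‖ξ‖ ≤ 1) (h0 : ∑' l, a l * ξ ^ l = 0) :
    Tendsto (fun N => ∑ n ∈ Finset.range (N + 1), conv a d n * ξ ^ n) atTop (𝓝 0) := by
  obtain ⟨hs, ht⟩ := summable_tails (fun n => norm_nonneg (a n)) ha
  have hle : ∀ l, ‖a l * ξ ^ l‖ ≤ ‖a l‖ := fun l => by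
    rw [norm_mul, norm_pow]
    exact mul_le_of_le_one_right (norm_nonneg _) (pow_le_one₀ (norm_nonneg _) hξ)
  have hsa : Summable fun l => a l * ξ ^ l := Summable.of_norm_bounded hs hle
  -- Since the full series at ξ is zero, each partial sum is minus a tail; the first moment makes
  -- these tails summable.
  have htail : ∀ m, ‖∑ l ∈ Finset.range (m + 1), a l * ξ ^ l‖ ≤ ∑' l, ‖a (m + l)‖ := by
    intro m
    have h1 := hsa.sum_add_tsum_nat_add (m + 1)
    rw [h0] at h1
    rw [eq_neg_of_add_eq_zero_left h1, norm_neg]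
    have hs1 : Summable fun l => ‖a (m + l)‖ := by
      simpa only [add_comm] using (summable_nat_add_iff m).mpr hs
    have hs2 : Summable fun l => ‖a (l + (m + 1))‖ := (summable_nat_add_iff (m + 1)).mpr hs
    refine (tsum_of_norm_bounded hs2.hasSum fun l => hle _).trans ?_
    rw [hs1.tsum_eq_zero_add]
    have : ∀ l, ‖a (l + (m + 1))‖ = ‖a (m + (l + 1))‖ := fun l => by
      rw [show l + (m + 1) = m + (l + 1) by ring]
    simp only [this]
    linarith [norm_nonneg (a (m + 0))]
  -- The sum is grouped by q = n - l, the index of d, written as q = N - m. The reindexing (n, l) ↦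
  -- (N - (n - l), l) is an involution of the triangle l ≤ n ≤ N.
  have hconv : ∀ N, ∑ n ∈ Finset.range (N + 1), conv a d n * ξ ^ n =
      ∑ m ∈ Finset.range (N + 1), (∑ l ∈ Finset.range (m + 1), a l * ξ ^ l) *
        (d (N - m) * ξ ^ (N - m)) := by
    intro N
    have h1 : ∀ n, conv a d n * ξ ^ n = ∑ l ∈ Finset.range (n + 1),
        (a l * ξ ^ l) * (d (n - l) * ξ ^ (n - l)) := by
      intro n
      rw [conv_eq_sum_range, Finset.sum_mul]
      refine Finset.sum_congr rfl fun l hl => ?_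
      have hl' : l ≤ n := Nat.le_of_lt_succ (Finset.mem_range.mp hl)
      rw [← pow_mul_pow_sub ξ hl']
      ring
    simp only [h1, Finset.sum_mul]
    rw [Finset.sum_sigma', Finset.sum_sigma']
    refine Finset.sum_bij' (fun x _ => ⟨N - (x.1 - x.2), x.2⟩) (fun x _ => ⟨N - (x.1 - x.2), x.2⟩)
      ?_ ?_ ?_ ?_ ?_
    · rintro ⟨n, l⟩ h
      simp only [Finset.mem_sigma, Finset.mem_range] at h ⊢
      omega
    · rintro ⟨n, l⟩ h
      simp only [Finset.mem_sigma, Finset.mem_range] at h ⊢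
      omega
    · rintro ⟨n, l⟩ h
      simp only [Finset.mem_sigma, Finset.mem_range] at h ⊢
      simp only [Sigma.mk.injEq, heq_eq_eq, and_true]
      omega
    · rintro ⟨n, l⟩ h
      simp only [Finset.mem_sigma, Finset.mem_range] at h ⊢
      simp only [Sigma.mk.injEq, heq_eq_eq, and_true]
      omega
    · rintro ⟨n, l⟩ h
      simp only [Finset.mem_sigma, Finset.mem_range] at h ⊢
      rw [show N - (N - (n - l)) = n - l by omega]
  simp only [hconv]
  refine tendsto_conv_zero (a := fun m => ∑ l ∈ Finset.range (m + 1), a l * ξ ^ l)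
    (r := fun m => d m * ξ ^ m) (Summable.of_nonneg_of_le (fun _ => norm_nonneg _) htail ht) ?_
  refine squeeze_zero_norm (fun m => ?_) (tendsto_zero_iff_norm_tendsto_zero.mp hd)
  rw [norm_mul, norm_pow]
  exact mul_le_of_le_one_right (norm_nonneg _) (pow_le_one₀ (norm_nonneg _) hξ)

theorem tsum_bdiff {a : ℕ → ℂ} (ha : Summable fun n => ‖a n‖) {ξ : ℂ} (hξ : ‖ξ‖ ≤ 1) :
    ∑' l, bdiff a l * ξ ^ l = (1 - ξ) * ∑' l, a l * ξ ^ l := by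
  have hs : Summable fun l => a l * ξ ^ l := Summable.of_norm_bounded ha fun l => by
    rw [norm_mul, norm_pow]
    exact mul_le_of_le_one_right (norm_nonneg _) (pow_le_one₀ (norm_nonneg _) hξ)
  have h1 : HasSum (fun l => a l * ξ ^ l) (∑' l, a l * ξ ^ l) := hs.hasSum
  have h2 : HasSum (fun l => if l = 0 then 0 else a (l - 1) * ξ ^ l) (ξ * ∑' l, a l * ξ ^ l) := by
    have h3 := h1.mul_left ξ
    refine (hasSum_nat_add_iff' 1).mp ?_
    have h4 : (fun l : ℕ => if l + 1 = 0 then 0 else a (l + 1 - 1) * ξ ^ (l + 1)) =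
        fun l => ξ * (a l * ξ ^ l) := by
      funext l
      simp only [Nat.add_eq_zero_iff, one_ne_zero, and_false, if_false, Nat.add_sub_cancel]
      ring
    rw [h4]
    simpa using h3
  have h3 := (h1.sub h2).tsum_eq
  rw [sub_mul, one_mul, ← h3]
  refine tsum_congr fun l => ?_
  by_cases hl : l = 0
  · simp [bdiff, hl]
  · simp [bdiff, hl, sub_mul]

/-- If the generating function of `a` vanishes in the closed disc, away from `1`, then not all
initial value problems for a recurrence that is inconsistent on constants have a solution which
tends to zero. -/
theorem not_stable_of_zero {a : ℕ → ℂ} (ha : Summable fun n => ‖a n‖)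
    (ha' : Summable fun n : ℕ => ((n : ℝ) + 1) * ‖bdiff a n‖) {M : ℕ} {R : ℕ → (ℕ → ℂ) → ℂ}
    (hR : DependsOnStart M R) {b : ℂ} (hb : b ≠ 0)
    (hconst : ∀ k, M ≤ k → R k (fun _ => 1) - conv a (fun _ => 1) (k + 1) = b)
    {ξ : ℂ} (hξ : ‖ξ‖ ≤ 1) (hξ1 : ξ ≠ 1) (h0 : ∑' l, a l * ξ ^ l = 0) {u : ℕ → ℂ}
    (hu1 : ∀ j ≤ M, u j = 1) (hu : IsConvSolution a M R u) : ¬ Tendsto u atTop (𝓝 0) := by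
  intro hlim
  -- Subtracting the constant 1 removes the starting values: v answers a step of height b switched
  -- on at index M + 1.
  let v : ℕ → ℂ := fun k => u k - 1
  have hv0 : ∀ n ≤ M, v n = 0 := fun n hn => by simp [v, hu1 n hn]
  have hv : ∀ n, conv a v n = if n ≤ M then 0 else b := by
    intro n
    split_ifs with hn
    · rw [conv_congr (v := fun _ => 0) fun j hj => hv0 j (hj.trans hn)]
      simp [conv]
    · obtain ⟨k, rfl⟩ : ∃ k, n = k + 1 := ⟨n - 1, by omega⟩
      rw [conv_sub a u (fun _ => 1), hu k (by omega), hR k u (fun _ => 1) hu1]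
      exact hconst k (by omega)
  -- The contradiction below is with b ξ^(M+1) (1 - ξ) ≠ 0, which says nothing at ξ = 0; there a 0 =
  -- 0 contradicts the equation at M + 1 directly.
  by_cases hz : ξ = 0
  · have ha0 : a 0 = 0 := by
      rw [hz, tsum_eq_single 0 (fun l hl => by simp [hl])] at h0
      simpa using h0
    have h1 := hv (M + 1)
    rw [if_neg (by omega), conv_eq_sum_range', Finset.sum_range_succ, Nat.sub_self, ha0, zero_mul,
      add_zero, Finset.sum_eq_zero fun j hj => by
        rw [hv0 j (Nat.le_of_lt_succ (Finset.mem_range.mp hj)), mul_zero]] at h1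
    exact hb h1.symm
  -- Here v tends to -1 and not to 0, so it is differenced; differencing a as well provides the
  -- summable first moment.
  have hd : Tendsto (bdiff v) atTop (𝓝 0) := by
    have h1 : Tendsto v atTop (𝓝 (0 - 1)) := hlim.sub_const 1
    have h2 := h1.sub (h1.comp (tendsto_sub_atTop_nat 1))
    rw [sub_self] at h2
    refine h2.congr' ?_
    filter_upwards [eventually_gt_atTop 0] with n hn
    simp [bdiff, hn.ne']
  have hzero : ∑' l, bdiff a l * ξ ^ l = 0 := by rw [tsum_bdiff ha hξ, h0, mul_zero]
  have hT := tendsto_partial_sums_conv ha' hd hξ hzero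
  -- Two differences turn the step input into b at M + 1 and -b at M + 2, so the partial sums at ξ
  -- are eventually constant.
  have hc : ∀ n, conv (bdiff a) (bdiff v) n = bdiff (bdiff fun n => if n ≤ M then 0 else b) n := by
    intro n
    have h1 : conv a v = fun n => if n ≤ M then 0 else b := funext hv
    have h2 : conv (bdiff a) v = bdiff (conv a v) := by
      funext m
      rw [conv_comm, conv_bdiff_right, show conv v a = conv a v from funext (conv_comm v a)]
    rw [conv_bdiff_right, h2, h1]
  have hval : ∀ n, bdiff (bdiff fun n => if n ≤ M then 0 else b) n =
      if n = M + 1 then b else if n = M + 2 then -b else 0 := by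
    intro n
    rcases lt_trichotomy n (M + 1) with h | h | h
    · rw [if_neg (by omega), if_neg (by omega)]
      rcases n with _ | _ | n
      · simp [bdiff]
      · simp [bdiff, show 1 ≤ M by omega]
      · simp [bdiff, show n + 1 + 1 ≤ M by omega, show n + 1 ≤ M by omega, show n ≤ M by omega]
    · subst h
      rcases M with _ | M <;> simp [bdiff]
    · obtain ⟨m, rfl⟩ : ∃ m, n = m + 2 := ⟨n - 2, by omega⟩
      rw [if_neg (by omega)]
      by_cases hm : m = M
      · subst hm
        simp [bdiff]
      · simp [bdiff, hm, show ¬ m + 1 + 1 ≤ M by omega, show ¬ m + 1 ≤ M by omega,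
          show ¬ m ≤ M by omega]
  have hev : ∀ N, M + 2 ≤ N → ∑ n ∈ Finset.range (N + 1), conv (bdiff a) (bdiff v) n * ξ ^ n =
      b * ξ ^ (M + 1) * (1 - ξ) := by
    intro N hN
    have hsplit : ∀ n, conv (bdiff a) (bdiff v) n * ξ ^ n =
        (if n = M + 1 then b * ξ ^ n else 0) + if n = M + 2 then -b * ξ ^ n else 0 := by
      intro n
      rw [hc, hval]
      by_cases h1 : n = M + 1
      · simp [h1]
      · simp [h1]
    simp only [hsplit, Finset.sum_add_distrib, Finset.sum_ite_eq', Finset.mem_range]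
    rw [if_pos (by omega), if_pos (by omega)]
    ring
  have hT' : Tendsto (fun N => ∑ n ∈ Finset.range (N + 1), conv (bdiff a) (bdiff v) n * ξ ^ n)
      atTop (𝓝 (b * ξ ^ (M + 1) * (1 - ξ))) := by
    refine tendsto_const_nhds.congr' ?_
    filter_upwards [eventually_ge_atTop (M + 2)] with N hN using (hev N hN).symm
  have := tendsto_nhds_unique hT hT'
  exact mul_ne_zero (mul_ne_zero hb (pow_ne_zero _ hz)) (sub_ne_zero.mpr (Ne.symm hξ1)) this.symm

end

/-! ### Beta integrals, the weighted integrals `wInt`, and the kernel of the history load. -/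

section

open MeasureTheory Set

theorem ofReal_beta_integrand {a b x : ℝ} (hx : x ∈ Icc (0 : ℝ) 1) :
    ((x : ℂ)) ^ ((a : ℂ) - 1) * (1 - (x : ℂ)) ^ ((b : ℂ) - 1) =
      ((x ^ (a - 1) * (1 - x) ^ (b - 1) : ℝ) : ℂ) := by
  rw [Complex.ofReal_mul, Complex.ofReal_cpow hx.1, Complex.ofReal_cpow (by linarith [hx.2])]
  push_cast
  rfl

theorem intervalIntegrable_beta {a b : ℝ} (ha : 0 < a) (hb : 0 < b) :
    IntervalIntegrable (fun x : ℝ => x ^ (a - 1) * (1 - x) ^ (b - 1)) volume 0 1 := by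
  have h := (Complex.betaIntegral_convergent (u := a) (v := b) (by simpa) (by simpa)).norm
  refine h.congr ?_
  intro x hx
  rw [uIoc_of_le zero_le_one] at hx
  have hx' : x ∈ Icc (0 : ℝ) 1 := ⟨hx.1.le, hx.2⟩
  simp only [ofReal_beta_integrand hx', Complex.norm_real]
  exact Real.norm_of_nonneg (mul_nonneg (Real.rpow_nonneg hx'.1 _)
    (Real.rpow_nonneg (by linarith [hx.2]) _))

theorem integral_beta {a b : ℝ} (ha : 0 < a) (hb : 0 < b) :
    ∫ x in (0 : ℝ)..1, x ^ (a - 1) * (1 - x) ^ (b - 1) =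
      Real.Gamma a * Real.Gamma b / Real.Gamma (a + b) := by
  have h := Complex.betaIntegral_eq_Gamma_mul_div a b (by simpa) (by simpa)
  rw [Complex.betaIntegral, intervalIntegral.integral_congr (g := fun x : ℝ =>
    ((x ^ (a - 1) * (1 - x) ^ (b - 1) : ℝ) : ℂ)) (fun x hx => by
      rw [uIcc_of_le zero_le_one] at hx
      exact ofReal_beta_integrand hx), intervalIntegral.integral_ofReal,
    ← Complex.ofReal_add, Complex.Gamma_ofReal, Complex.Gamma_ofReal, Complex.Gamma_ofReal] at h
  exact_mod_cast h

/-- One bound covers both signs of the exponent, as the power is monotone in one direction or the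
other. -/
theorem rpow_le_add_of_mem {m M t : ℝ} (hm : 0 < m) (hmt : m ≤ t) (htM : t ≤ M) (r : ℝ) :
    t ^ r ≤ m ^ r + M ^ r := by
  have ht := hm.trans_le hmt
  rcases le_total r 0 with hr | hr
  · linarith [Real.rpow_le_rpow_of_nonpos hm hmt hr, Real.rpow_nonneg (ht.le.trans htM) r]
  · linarith [Real.rpow_le_rpow ht.le htM hr, Real.rpow_nonneg hm.le r]

/-- The weighted integral `∫_0^1 (1-θ)^{α-1} (x+θ)^s dθ`. -/
def wInt (α s x : ℝ) : ℝ := ∫ θ in (0 : ℝ)..1, (1 - θ) ^ (α - 1) * (x + θ) ^ s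

theorem calA_eq_wInt (α : ℝ) (k j : ℕ) : calA α k j = wInt α (1 - α) ((k : ℝ) - j) := rfl

theorem calB_eq_wInt (α : ℝ) (k j : ℕ) : calB α k j = wInt α (2 - α) ((k : ℝ) - j) := rfl

theorem intervalIntegrable_weight {α : ℝ} (hα : 0 < α) :
    IntervalIntegrable (fun θ : ℝ => (1 - θ) ^ (α - 1)) volume 0 1 := by
  simpa using intervalIntegrable_beta one_pos hα

theorem integral_weight {α : ℝ} (hα : 0 < α) : ∫ θ in (0 : ℝ)..1, (1 - θ) ^ (α - 1) = 1 / α := by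
  have := integral_beta one_pos hα
  simp only [sub_self, Real.rpow_zero, one_mul, Real.Gamma_one] at this
  rw [this, add_comm, Real.Gamma_add_one hα.ne']
  field_simp [(Real.Gamma_pos_of_pos hα).ne']

theorem intervalIntegrable_wInt_bound {α s : ℝ} (hα : 0 < α) (hs : -1 < s) (C : ℝ) :
    IntervalIntegrable (fun θ : ℝ => (1 - θ) ^ (α - 1) * (θ ^ s + C)) volume 0 1 := by
  have h1 := intervalIntegrable_beta (a := s + 1) (by linarith) hα
  have h2 := (intervalIntegrable_weight hα).mul_const C
  refine (h1.add h2).congr fun θ _ => ?_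
  simp only [add_sub_cancel_right]
  ring

theorem measurable_wInt_integrand (α s x : ℝ) :
    Measurable fun θ : ℝ => (1 - θ) ^ (α - 1) * (x + θ) ^ s := by fun_prop

theorem norm_wInt_integrand_le {α s x R θ : ℝ} (hx : 0 ≤ x) (hR : x ≤ R) (hθ : θ ∈ Ioc (0 : ℝ) 1) :
    ‖(1 - θ) ^ (α - 1) * (x + θ) ^ s‖ ≤ (1 - θ) ^ (α - 1) * (θ ^ s + (R + 1) ^ s) := by
  have h1 : 0 ≤ (1 - θ) ^ (α - 1) := Real.rpow_nonneg (by linarith [hθ.2]) _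
  rw [Real.norm_of_nonneg (mul_nonneg h1 (Real.rpow_nonneg (by linarith [hθ.1]) _))]
  exact mul_le_mul_of_nonneg_left
    (rpow_le_add_of_mem hθ.1 (by linarith) (by linarith [hθ.2]) s) h1

theorem intervalIntegrable_wInt {α s x : ℝ} (hα : 0 < α) (hs : -1 < s) (hx : 0 ≤ x) :
    IntervalIntegrable (fun θ : ℝ => (1 - θ) ^ (α - 1) * (x + θ) ^ s) volume 0 1 := by
  refine (intervalIntegrable_wInt_bound hα hs ((x + 1) ^ s)).mono_fun
    (measurable_wInt_integrand α s x).aestronglyMeasurable ?_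
  rw [uIoc_of_le zero_le_one]
  refine (ae_restrict_mem measurableSet_Ioc).mono fun θ hθ => ?_
  exact (norm_wInt_integrand_le hx le_rfl hθ).trans (le_abs_self _)

theorem continuousOn_wInt {α s : ℝ} (hα : 0 < α) (hs : -1 < s) :
    ContinuousOn (wInt α s) (Ici 0) := by
  intro x hx
  refine intervalIntegral.continuousWithinAt_of_dominated_interval
    (bound := fun θ => (1 - θ) ^ (α - 1) * (θ ^ s + (x + 1 + 1) ^ s))
    (Eventually.of_forall fun y => (measurable_wInt_integrand α s y).aestronglyMeasurable) ?_
    (intervalIntegrable_wInt_bound hα hs _) ?_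
  · have h1 : ∀ᶠ y in 𝓝[Ici 0] x, y < x + 1 :=
      nhdsWithin_le_nhds (eventually_lt_nhds (by linarith))
    filter_upwards [h1, self_mem_nhdsWithin] with y hy1 hy2
    refine Eventually.of_forall fun θ hθ => ?_
    rw [uIoc_of_le zero_le_one] at hθ
    exact norm_wInt_integrand_le hy2 hy1.le hθ
  · refine Eventually.of_forall fun θ hθ => ?_
    rw [uIoc_of_le zero_le_one] at hθ
    have hx0 : (0 : ℝ) ≤ x := hx
    have : ContinuousAt (fun y : ℝ => (1 - θ) ^ (α - 1) * (y + θ) ^ s) x := by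
      refine continuousAt_const.mul (ContinuousAt.rpow_const (by fun_prop) (Or.inl ?_))
      linarith [hθ.1]
    exact this.continuousWithinAt

/-- Differentiation under the integral. No lower bound on s is needed: for x > 0 the factor (x +
θ)^s is bounded on [0, 1]. -/
theorem hasDerivAt_wInt {α : ℝ} (hα : 0 < α) (s : ℝ) {x : ℝ} (hx : 0 < x) :
    HasDerivAt (wInt α s) (s * wInt α (s - 1) x) x := by
  have hint : ∀ r : ℝ, IntervalIntegrable (fun θ : ℝ => (1 - θ) ^ (α - 1) * (x + θ) ^ r)
      volume 0 1 := by
    intro r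
    refine (intervalIntegrable_weight hα).mul_continuousOn ?_
    intro θ hθ
    rw [uIcc_of_le zero_le_one] at hθ
    refine (ContinuousAt.rpow_const (by fun_prop) (Or.inl ?_)).continuousWithinAt
    linarith [hθ.1]
  have h := (intervalIntegral.hasDerivAt_integral_of_dominated_loc_of_deriv_le
    (F := fun y θ => (1 - θ) ^ (α - 1) * (y + θ) ^ s)
    (F' := fun y θ => (1 - θ) ^ (α - 1) * (s * (y + θ) ^ (s - 1)))
    (bound := fun θ => (1 - θ) ^ (α - 1) * (|s| * ((x / 2) ^ (s - 1) + (x + 2) ^ (s - 1))))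
    (s := Ioo (x / 2) (x + 1)) (x₀ := x) (μ := volume) (a := 0) (b := 1)
    (Ioo_mem_nhds (by linarith) (by linarith))
    (Eventually.of_forall fun y => (measurable_wInt_integrand α s y).aestronglyMeasurable)
    (hint s) (by fun_prop) ?_ ((intervalIntegrable_weight hα).mul_const _) ?_).2
  · refine h.congr_deriv ?_
    rw [wInt, ← intervalIntegral.integral_const_mul]
    exact intervalIntegral.integral_congr fun θ _ => by ring
  · refine Eventually.of_forall fun θ hθ y hy => ?_
    rw [uIoc_of_le zero_le_one] at hθ
    have h1 : 0 ≤ (1 - θ) ^ (α - 1) := Real.rpow_nonneg (by linarith [hθ.2]) _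
    have h2 : 0 ≤ (y + θ) ^ (s - 1) := Real.rpow_nonneg (by linarith [hy.1, hθ.1]) _
    rw [norm_mul, norm_mul, Real.norm_of_nonneg h1, Real.norm_of_nonneg h2, Real.norm_eq_abs]
    refine mul_le_mul_of_nonneg_left (mul_le_mul_of_nonneg_left ?_ (abs_nonneg s)) h1
    exact rpow_le_add_of_mem (by linarith) (by linarith [hy.1, hθ.1])
      (by linarith [hy.2, hθ.2]) _
  · refine Eventually.of_forall fun θ hθ y hy => ?_
    rw [uIoc_of_le zero_le_one] at hθ
    have h1 : HasDerivAt (fun y : ℝ => (y + θ) ^ s) (1 * s * (y + θ) ^ (s - 1)) y :=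
      ((hasDerivAt_id y).add_const θ).rpow_const (Or.inl (by simp; linarith [hy.1, hθ.1]))
    rw [one_mul] at h1
    exact h1.const_mul _

/-- The exponents are such that the integrand is, up to the factor -α(1 + x), the exact derivative
of (1 - θ)^α (x + θ)^(-α). This is the source of the closed form of the derivative of `histKernel`.
-/
theorem wInt_neg_sub_one {α : ℝ} (hα : 0 < α) {x : ℝ} (hx : 0 < x) :
    wInt α (-α - 1) x = x ^ (-α) / (α * (1 + x)) := by
  have h := intervalIntegral.integral_eq_sub_of_hasDerivAt_of_le (zero_le_one' ℝ)
    (f := fun θ : ℝ => (1 - θ) ^ α * (x + θ) ^ (-α))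
    (f' := fun θ : ℝ => -(α * (1 + x)) * ((1 - θ) ^ (α - 1) * (x + θ) ^ (-α - 1))) ?_ ?_ ?_
  · rw [intervalIntegral.integral_const_mul] at h
    simp only [sub_self, Real.zero_rpow hα.ne', sub_zero, Real.one_rpow, add_zero] at h
    have hpos : 0 < α * (1 + x) := by positivity
    rw [wInt, eq_div_iff hpos.ne']
    linarith
  · refine ContinuousOn.mul (fun θ _ => (ContinuousAt.rpow_const (by fun_prop)
      (Or.inr hα.le)).continuousWithinAt) fun θ hθ => ?_
    refine (ContinuousAt.rpow_const (by fun_prop) (Or.inl ?_)).continuousWithinAt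
    linarith [hθ.1]
  · intro θ hθ
    have h1 : HasDerivAt (fun θ : ℝ => (1 - θ) ^ α) (-1 * α * (1 - θ) ^ (α - 1)) θ := by
      refine HasDerivAt.rpow_const ?_ (Or.inl (by linarith [hθ.2]))
      simpa using (hasDerivAt_id θ).const_sub 1
    have h2 : HasDerivAt (fun θ : ℝ => (x + θ) ^ (-α)) (1 * -α * (x + θ) ^ (-α - 1)) θ := by
      refine HasDerivAt.rpow_const ?_ (Or.inl (by linarith [hθ.1]))
      simpa using (hasDerivAt_id θ).const_add x
    have e1 : (1 - θ) ^ α = (1 - θ) ^ (α - 1) * (1 - θ) := by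
      rw [← Real.rpow_add_one (by linarith [hθ.2])]
      simp
    have e2 : (x + θ) ^ (-α) = (x + θ) ^ (-α - 1) * (x + θ) := by
      rw [← Real.rpow_add_one (by linarith [hθ.1])]
      simp
    refine (h1.mul h2).congr_deriv ?_
    rw [e1, e2]
    ring
  · refine ((intervalIntegrable_weight hα).mul_continuousOn ?_).const_mul _
    intro θ hθ
    rw [uIcc_of_le zero_le_one] at hθ
    refine (ContinuousAt.rpow_const (by fun_prop) (Or.inl ?_)).continuousWithinAt
    linarith [hθ.1]

theorem wInt_zero {α s : ℝ} (hα : 0 < α) (hs : -1 < s) :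
    wInt α s 0 = Real.Gamma (s + 1) * Real.Gamma α / Real.Gamma (s + 1 + α) := by
  rw [← integral_beta (by linarith) hα, wInt]
  refine intervalIntegral.integral_congr fun θ _ => ?_
  simp [mul_comm]

theorem wInt_nonneg (α s : ℝ) {x : ℝ} (hx : 0 ≤ x) : 0 ≤ wInt α s x := by
  refine intervalIntegral.integral_nonneg zero_le_one fun θ hθ => ?_
  exact mul_nonneg (Real.rpow_nonneg (by linarith [hθ.2]) _)
    (Real.rpow_nonneg (by linarith [hθ.1]) _)

theorem wInt_le {α s x : ℝ} (hα : 0 < α) (hs1 : -1 < s) (hs : s ≤ 0) (hx : 0 < x) :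
    wInt α s x ≤ x ^ s / α := by
  have h := intervalIntegral.integral_mono_on (zero_le_one' ℝ)
    (intervalIntegrable_wInt hα hs1 hx.le) ((intervalIntegrable_weight hα).mul_const (x ^ s))
    fun θ hθ => mul_le_mul_of_nonneg_left
      (Real.rpow_le_rpow_of_nonpos hx (by linarith [hθ.1] : x ≤ x + θ) hs)
      (Real.rpow_nonneg (by linarith [hθ.2]) _)
  rw [intervalIntegral.integral_mul_const, integral_weight hα] at h
  rw [wInt]
  exact h.trans (by rw [one_div_mul_eq_div])

/-- The constant `1 / (Γ(α) Γ(2-α))`. -/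
def histConst (α : ℝ) : ℝ := 1 / (Real.Gamma α * Real.Gamma (2 - α))

/-- The kernel of the history load: the history load of `u` in the step from `k` to `k + 1` is
`∫_0^k histKernel α (k - w) u'(w) dw`. -/
def histKernel (α x : ℝ) : ℝ := histConst α * (1 - α) * wInt α (-α) x

section kernel

variable {α : ℝ}

theorem histConst_pos (hα : 0 < α) (hα1 : α < 2) : 0 < histConst α :=
  one_div_pos.mpr (mul_pos (Real.Gamma_pos_of_pos hα) (Real.Gamma_pos_of_pos (by linarith)))

/-- The constant is the reciprocal of the beta integral Γ(1 - α) Γ(α). At α = 1 the factor 1 - α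
makes the kernel zero, hence the strict inequality. -/
theorem histKernel_zero (hα : 0 < α) (hα1 : α < 1) : histKernel α 0 = 1 := by
  rw [histKernel, wInt_zero hα (by linarith), histConst,
    show (2 : ℝ) - α = (1 - α) + 1 by ring, Real.Gamma_add_one (by linarith),
    show -α + 1 = 1 - α by ring, show 1 - α + α = 1 by ring, Real.Gamma_one]
  have h1 := (Real.Gamma_pos_of_pos hα).ne'
  have h2 := (Real.Gamma_pos_of_pos (show 0 < 1 - α by linarith)).ne'
  have h3 : 1 - α ≠ 0 := by linarith
  field_simp

theorem continuousOn_histKernel (hα : 0 < α) (hα1 : α < 1) :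
    ContinuousOn (histKernel α) (Ici 0) :=
  continuousOn_const.mul (continuousOn_wInt hα (by linarith))

theorem hasDerivAt_histKernel (hα : 0 < α) {x : ℝ} (hx : 0 < x) :
    HasDerivAt (histKernel α) (-(histConst α * (1 - α) * (x ^ (-α) / (1 + x)))) x := by
  have h := (hasDerivAt_wInt hα (-α) hx).const_mul (histConst α * (1 - α))
  refine h.congr_deriv ?_
  rw [wInt_neg_sub_one hα hx]
  field_simp

theorem histKernel_nonneg (hα : 0 < α) (hα1 : α < 1) {x : ℝ} (hx : 0 ≤ x) :
    0 ≤ histKernel α x :=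
  mul_nonneg (mul_nonneg (histConst_pos hα (by linarith)).le (by linarith)) (wInt_nonneg _ _ hx)

theorem strictAntiOn_histKernel (hα : 0 < α) (hα1 : α < 1) :
    StrictAntiOn (histKernel α) (Ici 0) := by
  refine strictAntiOn_of_deriv_neg (convex_Ici 0) (continuousOn_histKernel hα hα1) fun x hx => ?_
  rw [interior_Ici] at hx
  have hx : 0 < x := hx
  rw [(hasDerivAt_histKernel hα hx).deriv, neg_lt_zero]
  have := histConst_pos hα (by linarith)
  have : 0 < 1 - α := by linarith
  positivity

theorem tendsto_histKernel (hα : 0 < α) (hα1 : α < 1) :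
    Tendsto (histKernel α) atTop (𝓝 0) := by
  have h1 : Tendsto (fun x : ℝ => histConst α * (1 - α) * (x ^ (-α) / α)) atTop (𝓝 0) := by
    simpa using ((tendsto_rpow_neg_atTop hα).div_const α).const_mul (histConst α * (1 - α))
  refine squeeze_zero' ?_ ?_ h1
  · filter_upwards [eventually_ge_atTop 0] with x hx using histKernel_nonneg hα hα1 hx
  · filter_upwards [eventually_gt_atTop 0] with x hx
    exact mul_le_mul_of_nonneg_left (wInt_le hα (by linarith) (by linarith) hx)
      (mul_nonneg (histConst_pos hα (by linarith)).le (by linarith))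

end kernel

end

/-! ### History weights as first and second differences and as integrals of the kernel. -/

section

open MeasureTheory Set

/-- The weight of the first difference `m` steps back in the history load. -/
def histD (α : ℝ) (m : ℕ) : ℝ :=
  if m = 0 then 0 else wInt α (1 - α) m - wInt α (1 - α) ((m : ℝ) - 1)

/-- The weight of the second difference `m` steps back in the history load, for `p = 1`. -/
def histE (α : ℝ) (m : ℕ) : ℝ :=
  if m = 0 then 0 else -(wInt α (1 - α) m + wInt α (1 - α) ((m : ℝ) - 1)) / 2
    + (wInt α (2 - α) m - wInt α (2 - α) ((m : ℝ) - 1)) / (2 - α)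

/-- A node takes weight from the increment on its left and from the one on its right; node 0 has no
left increment. -/
theorem gamma0_add (α : ℝ) (m j : ℕ) :
    gamma0 α (j + m) j = (if j = 0 then 0 else histD α (m + 1)) - histD α m := by
  rcases j with _ | j <;> rcases m with _ | m <;>
    (simp only [gamma0, histD, calA_eq_wInt]; norm_num; try ring_nf)

/-- Second differences are centred at nodes 1, ..., k - 1, so nodes 0 and 1 miss some contributions.
The truncated `m - 1` at m = 0 is harmless because `histE α 0 = 0`. -/
theorem gamma1_add (α : ℝ) (m j : ℕ) :
    gamma1 α (j + m) j = gamma0 α (j + m) j + ((if j ≤ 1 then 0 else histE α (m + 1))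
      - 2 * (if j = 0 then 0 else histE α m) + histE α (m - 1)) := by
  rcases j with _ | _ | j <;> rcases m with _ | _ | _ | m <;>
    simp only [gamma1, gamma0, histE, calA_eq_wInt, calB_eq_wInt] <;> norm_num <;> ring_nf
  all_goals
    repeat rw [if_neg (by omega)]
    try rw [if_pos (by omega)]
    try ring

theorem gammaCoeff_add (α : ℝ) (p : Fin 2) (m j : ℕ) :
    gammaCoeff α p (j + m) j = (if j = 0 then 0 else histD α (m + 1)) - histD α m
      + if p = 0 then 0 else (if j ≤ 1 then 0 else histE α (m + 1))
        - 2 * (if j = 0 then 0 else histE α m) + histE α (m - 1) := by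
  by_cases hp : p = 0
  · simp [gammaCoeff, hp, gamma0_add]
  · simp only [gammaCoeff, hp, if_false, gamma1_add, gamma0_add]

theorem gammaConv_eq (α : ℝ) (p : Fin 2) (l : ℕ) :
    gammaConv α p l = histD α (l + 1) - histD α l
      + if p = 0 then 0 else histE α (l + 1) - 2 * histE α l + histE α (l - 1) := by
  rw [gammaConv, show l + 2 = 2 + l by ring, gammaCoeff_add]
  simp

theorem gammaCoeff_eq_gammaConv_of_lt (α : ℝ) (p : Fin 2) {k j : ℕ} (hj : (p : ℕ) < j)
    (hjk : j ≤ k) : gammaCoeff α p k j = gammaConv α p (k - j) := by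
  obtain ⟨m, rfl⟩ := Nat.exists_eq_add_of_le hjk
  rw [gammaCoeff_add, gammaConv_eq, Nat.add_sub_cancel_left]
  by_cases hp : p = 0
  · simp [hp, show j ≠ 0 by omega]
  · have : (p : ℕ) ≠ 0 := fun h => hp (Fin.ext h)
    simp [hp, show j ≠ 0 by omega, show ¬ j ≤ 1 by omega]

/-- Abel summation. The condition Y 0 = 0 neutralizes the truncated index j - 1 at j = 0; the
conditions at k and k + 1 remove the boundary terms. -/
theorem sum_by_parts {k : ℕ} {X Y u : ℕ → ℝ} (hX : X k = 0) (hY0 : Y 0 = 0) (hYk : Y k = 0)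
    (hYk' : Y (k + 1) = 0) :
    ∑ j ∈ Finset.range (k + 1), ((if j = 0 then 0 else X (j - 1)) - X j
      + ((if j = 0 then 0 else Y (j - 1)) - 2 * Y j + Y (j + 1))) * u j =
    ∑ j ∈ Finset.range k,
      (X j * (u (j + 1) - u j) + Y j * (u (j + 1) - 2 * u j + u (j - 1))) := by
  have e1 : ∀ Z : ℕ → ℝ, ∑ j ∈ Finset.range (k + 1), (if j = 0 then 0 else Z (j - 1)) * u j =
      ∑ j ∈ Finset.range k, Z j * u (j + 1) := by
    intro Z
    rw [Finset.sum_range_succ']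
    simp
  have e2 : ∀ Z : ℕ → ℝ, Z k = 0 → ∑ j ∈ Finset.range (k + 1), Z j * u j =
      ∑ j ∈ Finset.range k, Z j * u j := by
    intro Z hZ
    rw [Finset.sum_range_succ, hZ, zero_mul, add_zero]
  have e3 : ∑ j ∈ Finset.range (k + 1), Y (j + 1) * u j =
      ∑ j ∈ Finset.range k, Y j * u (j - 1) := by
    have h := Finset.sum_range_succ' (fun j => Y j * u (j - 1)) (k + 1)
    rw [Finset.sum_range_succ, Finset.sum_range_succ, hYk, hYk', hY0] at h
    simp only [Nat.add_sub_cancel] at h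
    linarith
  simp only [add_mul, sub_mul, Finset.sum_add_distrib, Finset.sum_sub_distrib, mul_assoc, e1,
    e3, ← Finset.mul_sum, e2 X hX, e2 Y hYk]
  rw [Finset.mul_sum]
  simp only [← Finset.sum_sub_distrib, ← Finset.sum_add_distrib]
  exact Finset.sum_congr rfl fun j _ => by ring

/-- The discrete history load in terms of first and second differences. -/
theorem sum_gammaCoeff (α : ℝ) (p : Fin 2) (k : ℕ) (u : ℕ → ℝ) :
    ∑ j ∈ Finset.range (k + 1), gammaCoeff α p k j * u j =
    ∑ j ∈ Finset.range k, (histD α (k - j) * (u (j + 1) - u j)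
      + (if p = 0 ∨ j = 0 then 0 else histE α (k - j)) * (u (j + 1) - 2 * u j + u (j - 1))) := by
  rw [← sum_by_parts (X := fun j => histD α (k - j))
    (Y := fun j => if p = 0 ∨ j = 0 then 0 else histE α (k - j)) (by simp [histD]) (by simp)
    (by simp [histE]) (by simp [histE])]
  refine Finset.sum_congr rfl fun j hj => ?_
  obtain ⟨m, rfl⟩ := Nat.exists_eq_add_of_le (Nat.le_of_lt_succ (Finset.mem_range.mp hj))
  rw [gammaCoeff_add]
  congr 1
  simp only [Nat.add_sub_cancel_left, show j + m - (j + 1) = m - 1 by omega]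
  rcases j with _ | _ | j
  · by_cases hp : p = 0 <;> simp [hp]
  · by_cases hp : p = 0 <;> simp [hp, show 1 + m - 0 = m + 1 by omega]
  · by_cases hp : p = 0 <;> simp [hp, show j + 1 + 1 + m - (j + 1) = m + 1 by omega]

theorem sum_gammaCoeff_eq_zero (α : ℝ) (p : Fin 2) (k : ℕ) :
    ∑ j ∈ Finset.range (k + 1), gammaCoeff α p k j = 0 := by
  have h := sum_gammaCoeff α p k fun _ => 1
  simp only [mul_one] at h
  rw [h]
  exact Finset.sum_eq_zero fun j _ => by ring

theorem sum_gammaConv (α : ℝ) (p : Fin 2) (n : ℕ) :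
    ∑ l ∈ Finset.range n, gammaConv α p l =
      histD α n + if p = 0 then 0 else histE α n - histE α (n - 1) := by
  induction n with
  | zero => simp [histD, histE]
  | succ n ih =>
    rw [Finset.sum_range_succ, ih, gammaConv_eq, Nat.add_sub_cancel]
    split_ifs <;> ring

theorem wInt_one {s : ℝ} (hs : 0 ≤ s) (x : ℝ) :
    wInt 1 s x = ((x + 1) ^ (s + 1) - x ^ (s + 1)) / (s + 1) := by
  have h : wInt 1 s x = ∫ θ in (0 : ℝ)..1, (x + θ) ^ s := by simp [wInt]
  rw [h, intervalIntegral.integral_comp_add_left (fun y => y ^ s), add_zero,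
    integral_rpow (Or.inl (by linarith))]

theorem histD_one (m : ℕ) : histD 1 m = 0 := by
  unfold histD
  split_ifs with h
  · rfl
  · simp [wInt]

/-- For α = 1 the function `wInt 1 1` is x + 1/2; its unit difference 1 cancels the mean of two
values of `wInt 1 0`. -/
theorem histE_one (m : ℕ) : histE 1 m = 0 := by
  unfold histE
  split_ifs with h
  · rfl
  · norm_num
    rw [wInt_one le_rfl, wInt_one le_rfl,
      wInt_one zero_le_one, wInt_one zero_le_one]
    norm_num
    ring

theorem gammaCoeff_one (p : Fin 2) {k j : ℕ} (h : j ≤ k) : gammaCoeff 1 p k j = 0 := by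
  obtain ⟨m, rfl⟩ := Nat.exists_eq_add_of_le h
  simp [gammaCoeff_add, histD_one, histE_one]

theorem gammaConv_one (p : Fin 2) (l : ℕ) : gammaConv 1 p l = 0 := by
  simp [gammaConv_eq, histD_one, histE_one]

section kernel

variable {α : ℝ}

theorem continuousOn_histKernel_sub (hα : 0 < α) (hα1 : α < 1) {m : ℝ} (hm : 1 ≤ m) :
    ContinuousOn (fun τ : ℝ => histKernel α (m - τ)) (Icc 0 1) :=
  (continuousOn_histKernel hα hα1).comp (by fun_prop) fun τ hτ => by
    simp only [mem_Ici]
    linarith [hτ.2]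

theorem intervalIntegrable_histKernel_mul (hα : 0 < α) (hα1 : α < 1) {m : ℝ} (hm : 1 ≤ m)
    {f : ℝ → ℝ} (hf : IntervalIntegrable f volume 0 1) :
    IntervalIntegrable (fun τ => histKernel α (m - τ) * f τ) volume 0 1 := by
  refine hf.continuousOn_mul ?_
  rw [uIcc_of_le zero_le_one]
  exact continuousOn_histKernel_sub hα hα1 hm

/-- Integration by parts: `histConst α * wInt α (1 - α)` is a primitive of the kernel, and `wInt α
(2 - α) / (2 - α)` one of `wInt α (1 - α)`. It gives the meaning of `histD` and `histE`: moments of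
the kernel on a cell against 1 and τ - 1/2. -/
theorem integral_histKernel_linear (hα : 0 < α) (hα1 : α < 1) {m : ℕ} (hm : m ≠ 0) (A B : ℝ) :
    ∫ τ in (0 : ℝ)..1, histKernel α (m - τ) * (A + B * (τ - 1 / 2)) =
      histConst α * (A * histD α m + B * histE α m) := by
  have hm1 : (1 : ℝ) ≤ m := by exact_mod_cast Nat.one_le_iff_ne_zero.mpr hm
  have hcont : ∀ s : ℝ, 0 ≤ s → ContinuousOn (fun τ : ℝ => wInt α s (m - τ)) (Icc 0 1) :=
    fun s hs => (continuousOn_wInt hα (by linarith)).comp (by fun_prop) fun τ hτ => by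
      simp only [mem_Ici]
      linarith [hτ.2]
  have h := intervalIntegral.integral_eq_sub_of_hasDerivAt_of_le (zero_le_one' ℝ)
    (f := fun τ : ℝ => -(histConst α) * (wInt α (1 - α) (m - τ) * (A + B * (τ - 1 / 2))
      + B * (wInt α (2 - α) (m - τ) / (2 - α))))
    (f' := fun τ : ℝ => histKernel α (m - τ) * (A + B * (τ - 1 / 2))) ?_ ?_ ?_
  · rw [h, histD, histE, if_neg hm, if_neg hm, sub_zero]
    ring
  · refine continuousOn_const.mul (((hcont _ (by linarith)).mul (by fun_prop)).add
      (continuousOn_const.mul ((hcont _ (by linarith)).div_const _)))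
  · intro τ hτ
    have hpos : 0 < (m : ℝ) - τ := by linarith [hτ.2]
    have hsub : HasDerivAt (fun τ : ℝ => (m : ℝ) - τ) (-1) τ := by
      simpa using (hasDerivAt_id τ).const_sub (m : ℝ)
    have h1 := (hasDerivAt_wInt hα (1 - α) hpos).comp τ hsub
    have h2 := (hasDerivAt_wInt hα (2 - α) hpos).comp τ hsub
    have h3 : HasDerivAt (fun τ : ℝ => A + B * (τ - 1 / 2)) (B * 1) τ :=
      (((hasDerivAt_id τ).sub_const (1 / 2)).const_mul B).const_add A
    refine (((h1.mul h3).add ((h2.div_const (2 - α)).const_mul B)).const_mul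
      (-(histConst α))).congr_deriv ?_
    have h4 : (2 : ℝ) - α ≠ 0 := by linarith
    rw [histKernel, show (1 : ℝ) - α - 1 = -α by ring, show (2 : ℝ) - α - 1 = 1 - α by ring]
    simp only [Function.comp_apply]
    field_simp
    ring
  · exact intervalIntegrable_histKernel_mul hα hα1 hm1
      (Continuous.intervalIntegrable (by fun_prop) _ _)

end kernel

end

/-! ### Positivity of the stencil functional by comparison with log((1 + x)/x). -/

section

open MeasureTheory Set

theorem intervalIntegrable_log_sub (m : ℝ) :
    IntervalIntegrable (fun τ : ℝ => Real.log (m - τ)) volume 0 1 := by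
  have h := (intervalIntegral.intervalIntegrable_log' (a := m - 0) (b := m - 1)).comp_sub_left m
  simpa using h

theorem integral_linear_mul_log {m : ℝ} (hm : 1 ≤ m) (A B : ℝ) :
    ∫ τ in (0 : ℝ)..1, (A + B * τ) * Real.log (m - τ) =
      ((A + B * m) * (m * Real.log m - m) - B * (m * (m * Real.log m) / 2 - m ^ 2 / 4))
      - ((A + B * m) * ((m - 1) * Real.log (m - 1) - (m - 1))
        - B * ((m - 1) * ((m - 1) * Real.log (m - 1)) / 2 - (m - 1) ^ 2 / 4)) := by
  -- With x = m - τ one has A + Bτ = (A + Bm) - Bx, and H is a primitive in x. Written through x log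
  -- x, it stays continuous at x = 0, as m = 1 requires.
  let H : ℝ → ℝ := fun x =>
    (A + B * m) * (x * Real.log x - x) - B * (x * (x * Real.log x) / 2 - x ^ 2 / 4)
  have hH : Continuous H := by
    have := Real.continuous_mul_log
    fun_prop
  have h := intervalIntegral.integral_eq_sub_of_hasDerivAt_of_le (zero_le_one' ℝ)
    (f := fun τ : ℝ => -H (m - τ)) (f' := fun τ : ℝ => (A + B * τ) * Real.log (m - τ)) ?_ ?_ ?_
  · rw [h, sub_zero]
    simp only [H]
    ring
  · exact (hH.comp (by fun_prop : Continuous fun τ : ℝ => m - τ)).neg.continuousOn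
  · intro τ hτ
    have hx : m - τ ≠ 0 := by linarith [hτ.2]
    have hsub : HasDerivAt (fun τ : ℝ => m - τ) (-1) τ := by
      simpa using (hasDerivAt_id τ).const_sub m
    have h1 := Real.hasDerivAt_mul_log hx
    have h2 : HasDerivAt H ((A + B * m) * ((Real.log (m - τ) + 1) - 1)
        - B * ((1 * ((m - τ) * Real.log (m - τ)) + (m - τ) * (Real.log (m - τ) + 1)) / 2
          - (2 : ℕ) * (m - τ) ^ (2 - 1) / 4)) (m - τ) :=
      ((h1.sub (hasDerivAt_id _)).const_mul _).sub
        (((((hasDerivAt_id _).mul h1).div_const 2).sub ((hasDerivAt_pow 2 _).div_const 4)).const_mul B)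
    refine (h2.comp τ hsub).neg.congr_deriv ?_
    norm_num
    ring
  · exact (intervalIntegrable_log_sub m).continuousOn_mul (by fun_prop)

/-- The functional giving the weights `-γ_l^{(1)}`, `l ≥ 2`, of the history load in terms of its
kernel on `[l - 2, l + 1]`. -/
def stencil (f : ℝ → ℝ) : ℝ :=
  ∫ τ in (0 : ℝ)..1, (2 * τ * f (2 - τ) - (τ + 1 / 2) * f (3 - τ) - (τ - 1 / 2) * f (1 - τ))

/-- `log ((1 + x) / x)`, the limiting shape of the kernel of the history load as `α → 1`. -/
def logKernel (x : ℝ) : ℝ := Real.log (1 + x) - Real.log x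

theorem stencil_logKernel : stencil logKernel = 24 * Real.log 3 - 38 * Real.log 2 := by
  have h : ∀ τ : ℝ, 2 * τ * logKernel (2 - τ) - (τ + 1 / 2) * logKernel (3 - τ)
      - (τ - 1 / 2) * logKernel (1 - τ) =
      (-1 / 2 + -1 * τ) * Real.log (4 - τ) + (1 / 2 + 3 * τ) * Real.log (3 - τ)
        + ((1 / 2 + -3 * τ) * Real.log (2 - τ) + (-1 / 2 + 1 * τ) * Real.log (1 - τ)) := by
    intro τ
    simp only [logKernel]
    rw [show 1 + (2 - τ) = 3 - τ by ring, show 1 + (3 - τ) = 4 - τ by ring,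
      show 1 + (1 - τ) = 2 - τ by ring]
    ring
  have hi : ∀ m A B : ℝ, IntervalIntegrable (fun τ => (A + B * τ) * Real.log (m - τ)) volume 0 1 :=
    fun m A B => (intervalIntegrable_log_sub m).continuousOn_mul (by fun_prop)
  simp only [stencil, h]
  rw [intervalIntegral.integral_add ((hi _ _ _).add (hi _ _ _)) ((hi _ _ _).add (hi _ _ _)),
    intervalIntegral.integral_add (hi _ _ _) (hi _ _ _),
    intervalIntegral.integral_add (hi _ _ _) (hi _ _ _),
    integral_linear_mul_log (by norm_num), integral_linear_mul_log (by norm_num),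
    integral_linear_mul_log (by norm_num), integral_linear_mul_log (by norm_num)]
  have h4 : Real.log 4 = 2 * Real.log 2 := by
    rw [show (4 : ℝ) = 2 ^ 2 by norm_num, Real.log_pow]
    norm_num
  norm_num
  rw [h4]
  ring

/-- This is 2^38 < 3^24, true with less than three percent to spare. -/
theorem stencil_logKernel_pos : 0 < stencil logKernel := by
  rw [stencil_logKernel]
  have h : (38 : ℝ) * Real.log 2 < 24 * Real.log 3 := by
    have := Real.log_lt_log (x := 2 ^ 38) (y := 3 ^ 24) (by norm_num) (by norm_num)
    rw [Real.log_pow, Real.log_pow] at this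
    exact_mod_cast this
  linarith

theorem integral_two_mul : ∫ τ in (0 : ℝ)..1, 2 * τ = 1 := by
  rw [intervalIntegral.integral_const_mul, integral_id]
  norm_num

theorem integral_add_half : ∫ τ in (0 : ℝ)..1, (τ + 1 / 2) = 1 := by
  rw [intervalIntegral.integral_add (by simp) (by simp), integral_id]
  norm_num

theorem integral_sub_half : ∫ τ in (0 : ℝ)..1, (τ - 1 / 2) = 0 := by
  rw [intervalIntegral.integral_sub (by simp) (by simp), integral_id]
  norm_num

/-- The stencil is nonnegative on functions which increase on `(0, 1]` and decrease on `[1, 3]`. -/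
theorem stencil_nonneg {D : ℝ → ℝ} (h1 : MonotoneOn D (Ioc 0 1)) (h2 : AntitoneOn D (Icc 1 3))
    (hi : ∀ m : ℝ, 1 ≤ m → m ≤ 3 → IntervalIntegrable (fun τ => D (m - τ)) volume 0 1) :
    0 ≤ stencil D := by
  have i1 : IntervalIntegrable (fun τ => 2 * τ * D (2 - τ)) volume 0 1 :=
    (hi 2 (by norm_num) (by norm_num)).continuousOn_mul (by fun_prop)
  have i2 : IntervalIntegrable (fun τ => (τ + 1 / 2) * D (3 - τ)) volume 0 1 :=
    (hi 3 (by norm_num) (by norm_num)).continuousOn_mul (by fun_prop)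
  have i3 : IntervalIntegrable (fun τ => (τ - 1 / 2) * D (1 - τ)) volume 0 1 :=
    (hi 1 (by norm_num) (by norm_num)).continuousOn_mul (by fun_prop)
  -- The densities 2τ and τ + 1/2 both have mass 1, while 2 - τ ≤ 2 ≤ 3 - τ; hence D 2 separates the
  -- first two integrals.
  have e1 : D 2 ≤ ∫ τ in (0 : ℝ)..1, 2 * τ * D (2 - τ) := by
    have := intervalIntegral.integral_mono_on zero_le_one
      (Continuous.intervalIntegrable (by fun_prop : Continuous fun τ : ℝ => 2 * τ * D 2) 0 1) i1
      fun τ hτ => mul_le_mul_of_nonneg_left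
        (h2 ⟨by linarith [hτ.2], by linarith [hτ.1]⟩ ⟨by norm_num, by norm_num⟩
          (by linarith [hτ.1] : 2 - τ ≤ 2)) (by linarith [hτ.1])
    rwa [intervalIntegral.integral_mul_const, integral_two_mul, one_mul] at this
  have e2 : ∫ τ in (0 : ℝ)..1, (τ + 1 / 2) * D (3 - τ) ≤ D 2 := by
    have := intervalIntegral.integral_mono_on zero_le_one i2
      (Continuous.intervalIntegrable (by fun_prop : Continuous fun τ : ℝ => (τ + 1 / 2) * D 2) 0 1)
      fun τ hτ => mul_le_mul_of_nonneg_left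
        (h2 ⟨by norm_num, by norm_num⟩ ⟨by linarith [hτ.2], by linarith [hτ.1]⟩
          (by linarith [hτ.2] : 2 ≤ 3 - τ)) (by linarith [hτ.1])
    rwa [intervalIntegral.integral_mul_const, integral_add_half, one_mul] at this
  -- The density τ - 1/2 has mean zero and D (1 - τ) decreases in τ, so comparison with D (1/2)
  -- works on both halves. Only the open interval is used, since D may be singular at 0.
  have e3 : ∫ τ in (0 : ℝ)..1, (τ - 1 / 2) * D (1 - τ) ≤ 0 := by
    have := intervalIntegral.integral_mono_on_of_le_Ioo zero_le_one i3
      (Continuous.intervalIntegrable (by fun_prop : Continuous fun τ : ℝ => (τ - 1 / 2) * D (1 / 2))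
        0 1) fun τ hτ => by
          rcases le_total τ (1 / 2) with h | h
          · exact mul_le_mul_of_nonpos_left (h1 ⟨by norm_num, by norm_num⟩
              ⟨by linarith [hτ.2], by linarith [hτ.1]⟩ (by linarith)) (by linarith)
          · exact mul_le_mul_of_nonneg_left (h1 ⟨by linarith [hτ.2], by linarith [hτ.1]⟩
              ⟨by norm_num, by norm_num⟩ (by linarith)) (by linarith)
    rwa [intervalIntegral.integral_mul_const, integral_sub_half, zero_mul] at this
  rw [stencil, intervalIntegral.integral_sub (i1.sub i2) i3, intervalIntegral.integral_sub i1 i2]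
  linarith

/-- Subtract ρ(1) times `logKernel`, whose derivative is -1/(x(1 + x)). The remainder D has
derivative (ρ(1) - ρ(x))/(x(1 + x)), so it rises up to 1 and falls after it, as `stencil_nonneg`
demands; the subtracted multiple contributes a strictly positive amount. -/
theorem stencil_pos {f ρ : ℝ → ℝ} (hf : ContinuousOn f (Icc 0 3))
    (hf' : ∀ x ∈ Ioo (0 : ℝ) 3, HasDerivAt f (-(ρ x / (x * (1 + x)))) x)
    (hρ : MonotoneOn ρ (Ioo 0 3)) (hρ1 : 0 < ρ 1) : 0 < stencil f := by
  let D : ℝ → ℝ := fun x => f x - ρ 1 * logKernel x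
  have hD' : ∀ x ∈ Ioo (0 : ℝ) 3, HasDerivAt D ((ρ 1 - ρ x) / (x * (1 + x))) x := by
    intro x hx
    have h1 : HasDerivAt (fun x : ℝ => 1 + x) 1 x := (hasDerivAt_id x).const_add 1
    have hx0 : x ≠ 0 := hx.1.ne'
    have hx1 : 1 + x ≠ 0 := by linarith [hx.1]
    refine ((hf' x hx).sub (((h1.log hx1).sub (Real.hasDerivAt_log hx0)).const_mul
      (ρ 1))).congr_deriv ?_
    field_simp
    ring
  have hlog : ContinuousOn logKernel (Ioc 0 3) := by
    refine ContinuousOn.sub (ContinuousOn.log (by fun_prop) fun x hx => ?_)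
      (ContinuousOn.log (by fun_prop) fun x hx => hx.1.ne')
    linarith [hx.1]
  have hD : ContinuousOn D (Ioc 0 3) := (hf.mono Ioc_subset_Icc_self).sub
    (continuousOn_const.mul hlog)
  have hmono : MonotoneOn D (Ioc 0 1) := by
    refine monotoneOn_of_deriv_nonneg (convex_Ioc 0 1)
      (hD.mono (Ioc_subset_Ioc_right (by norm_num))) ?_ ?_
    · intro x hx
      rw [interior_Ioc] at hx
      exact (hD' x ⟨hx.1, by linarith [hx.2]⟩).differentiableAt.differentiableWithinAt
    · intro x hx
      rw [interior_Ioc] at hx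
      have hx3 : x ∈ Ioo (0 : ℝ) 3 := ⟨hx.1, by linarith [hx.2]⟩
      rw [(hD' x hx3).deriv]
      have := hρ hx3 ⟨by norm_num, by norm_num⟩ hx.2.le
      exact div_nonneg (by linarith) (mul_nonneg hx.1.le (by linarith [hx.1]))
  have hanti : AntitoneOn D (Icc 1 3) := by
    refine antitoneOn_of_deriv_nonpos (convex_Icc 1 3)
      (hD.mono fun x hx => ⟨by linarith [hx.1], hx.2⟩) ?_ ?_
    · intro x hx
      rw [interior_Icc] at hx
      exact (hD' x ⟨by linarith [hx.1], hx.2⟩).differentiableAt.differentiableWithinAt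
    · intro x hx
      rw [interior_Icc] at hx
      have hx3 : x ∈ Ioo (0 : ℝ) 3 := ⟨by linarith [hx.1], hx.2⟩
      rw [(hD' x hx3).deriv]
      have := hρ ⟨by norm_num, by norm_num⟩ hx3 hx.1.le
      exact div_nonpos_of_nonpos_of_nonneg (by linarith) (mul_nonneg hx3.1.le (by linarith [hx3.1]))
  have hif : ∀ m : ℝ, 1 ≤ m → m ≤ 3 → IntervalIntegrable (fun τ => f (m - τ)) volume 0 1 := by
    intro m h1 h3
    refine ContinuousOn.intervalIntegrable (hf.comp (by fun_prop) fun τ hτ => ?_)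
    rw [uIcc_of_le zero_le_one] at hτ
    exact ⟨by linarith [hτ.2], by linarith [hτ.1]⟩
  have hil : ∀ m : ℝ, IntervalIntegrable (fun τ => logKernel (m - τ)) volume 0 1 := by
    intro m
    have := (intervalIntegrable_log_sub (1 + m)).sub (intervalIntegrable_log_sub m)
    refine this.congr fun τ _ => ?_
    simp only [logKernel]
    rw [show 1 + (m - τ) = 1 + m - τ by ring]
  have hiD : ∀ m : ℝ, 1 ≤ m → m ≤ 3 → IntervalIntegrable (fun τ => D (m - τ)) volume 0 1 :=
    fun m h1 h3 => (hif m h1 h3).sub ((hil m).const_mul (ρ 1))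
  have hst : ∀ g : ℝ → ℝ, (∀ m : ℝ, 1 ≤ m → m ≤ 3 →
      IntervalIntegrable (fun τ => g (m - τ)) volume 0 1) → IntervalIntegrable (fun τ =>
        2 * τ * g (2 - τ) - (τ + 1 / 2) * g (3 - τ) - (τ - 1 / 2) * g (1 - τ)) volume 0 1 := by
    intro g hg
    exact (((hg 2 (by norm_num) (by norm_num)).continuousOn_mul (by fun_prop)).sub
      ((hg 3 (by norm_num) (by norm_num)).continuousOn_mul (by fun_prop))).sub
      ((hg 1 (by norm_num) (by norm_num)).continuousOn_mul (by fun_prop))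
  have hsplit : stencil f = stencil D + ρ 1 * stencil logKernel := by
    rw [stencil, stencil, stencil, ← intervalIntegral.integral_const_mul,
      ← intervalIntegral.integral_add (hst D hiD)
        ((hst logKernel fun m _ _ => hil m).const_mul (ρ 1))]
    refine intervalIntegral.integral_congr fun τ _ => ?_
    simp only [D]
    ring
  rw [hsplit]
  have := stencil_nonneg hmono hanti hiD
  have := mul_pos hρ1 stencil_logKernel_pos
  linarith

end

/-! ### Signs and sum of the convolution weights; zeros of the symbol for λ = 0. -/

section

open MeasureTheory Set

section kernel

variable {α : ℝ}

theorem histConst_mul_histD (hα : 0 < α) (hα1 : α < 1) {m : ℕ} (hm : m ≠ 0) :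
    histConst α * histD α m = ∫ τ in (0 : ℝ)..1, histKernel α (m - τ) := by
  simpa using (integral_histKernel_linear hα hα1 hm 1 0).symm

theorem histConst_mul_histE (hα : 0 < α) (hα1 : α < 1) {m : ℕ} (hm : m ≠ 0) :
    histConst α * histE α m = ∫ τ in (0 : ℝ)..1, histKernel α (m - τ) * (τ - 1 / 2) := by
  simpa using (integral_histKernel_linear hα hα1 hm 0 1).symm

theorem histKernel_sub_le (hα : 0 < α) (hα1 : α < 1) {m τ : ℝ} (hm : 1 ≤ m) (hτ : τ ∈ Icc (0 : ℝ) 1) :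
    histKernel α (m - τ) ≤ histKernel α (m - 1) :=
  (strictAntiOn_histKernel hα hα1).antitoneOn (by simp; linarith)
    (by simp; linarith [hτ.2]) (by linarith [hτ.2])

theorem abs_integral_histKernel_mul_le (hα : 0 < α) (hα1 : α < 1) {m : ℝ} (hm : 1 ≤ m)
    {f : ℝ → ℝ} (hf : ∀ τ ∈ Icc (0 : ℝ) 1, |f τ| ≤ 1) :
    |∫ τ in (0 : ℝ)..1, histKernel α (m - τ) * f τ| ≤ histKernel α (m - 1) := by
  have h := intervalIntegral.norm_integral_le_of_norm_le_const (a := 0) (b := 1)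
    (f := fun τ => histKernel α (m - τ) * f τ) (C := histKernel α (m - 1)) fun τ hτ => ?_
  · simpa using h
  · rw [uIoc_of_le zero_le_one] at hτ
    have hτ' : τ ∈ Icc (0 : ℝ) 1 := Ioc_subset_Icc_self hτ
    have h0 := histKernel_nonneg hα hα1 (show 0 ≤ m - τ by linarith [hτ.2])
    rw [norm_mul, Real.norm_of_nonneg h0, Real.norm_eq_abs]
    exact (mul_le_of_le_one_right h0 (hf τ hτ')).trans (histKernel_sub_le hα hα1 hm hτ')

theorem tendsto_histKernel_nat (hα : 0 < α) (hα1 : α < 1) :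
    Tendsto (fun m : ℕ => histKernel α ((m : ℝ) - 1)) atTop (𝓝 0) :=
  (tendsto_histKernel hα hα1).comp
    (tendsto_atTop_add_const_right _ (-1) tendsto_natCast_atTop_atTop)

theorem tendsto_histD (hα : 0 < α) (hα1 : α ≤ 1) : Tendsto (histD α) atTop (𝓝 0) := by
  rcases hα1.lt_or_eq with h1 | rfl
  · have hc := histConst_pos hα (by linarith)
    have h : Tendsto (fun m => histConst α * histD α m) atTop (𝓝 0) := by
      refine squeeze_zero_norm' ?_ (tendsto_histKernel_nat hα h1)
      filter_upwards [eventually_ge_atTop 1] with m hm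
      rw [histConst_mul_histD hα h1 (by omega)]
      simpa using abs_integral_histKernel_mul_le hα h1 (f := fun _ => 1)
        (show (1 : ℝ) ≤ m by exact_mod_cast hm) (by simp)
    simpa [hc.ne'] using h.const_mul (histConst α)⁻¹
  · simp [funext histD_one]

theorem tendsto_histE (hα : 0 < α) (hα1 : α ≤ 1) : Tendsto (histE α) atTop (𝓝 0) := by
  rcases hα1.lt_or_eq with h1 | rfl
  · have hc := histConst_pos hα (by linarith)
    have h : Tendsto (fun m => histConst α * histE α m) atTop (𝓝 0) := by
      refine squeeze_zero_norm' ?_ (tendsto_histKernel_nat hα h1)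
      filter_upwards [eventually_ge_atTop 1] with m hm
      rw [histConst_mul_histE hα h1 (by omega)]
      refine abs_integral_histKernel_mul_le hα h1 (show (1 : ℝ) ≤ m by exact_mod_cast hm) ?_
      intro τ hτ
      rw [abs_le]
      constructor <;> linarith [hτ.1, hτ.2]
    simpa [hc.ne'] using h.const_mul (histConst α)⁻¹
  · simp [funext histE_one]

/-- This weight is the integral of a kernel bounded by K(0) = 1 against a nonnegative density of
mass 1, namely 1 for p = 0 and τ + 1/2 for p = 1. -/
theorem gammaConv_zero_le (hα : 0 < α) (hα1 : α < 1) (p : Fin 2) :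
    histConst α * gammaConv α p 0 ≤ 1 := by
  have hle : ∀ B : ℝ, (∀ τ ∈ Icc (0 : ℝ) 1, 0 ≤ 1 + B * (τ - 1 / 2)) →
      histConst α * (1 * histD α 1 + B * histE α 1) ≤ 1 := by
    intro B hB
    rw [← integral_histKernel_linear hα hα1 one_ne_zero]
    have hi : IntervalIntegrable (fun τ : ℝ => 1 + B * (τ - 1 / 2)) volume 0 1 :=
      Continuous.intervalIntegrable (by fun_prop) _ _
    refine (intervalIntegral.integral_mono_on zero_le_one
      (intervalIntegrable_histKernel_mul hα hα1 (by simp) hi) hi fun τ hτ =>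
        mul_le_of_le_one_left (hB τ hτ) ?_).trans_eq ?_
    · have := histKernel_sub_le hα hα1 (m := 1) le_rfl hτ
      rw [sub_self, histKernel_zero hα hα1] at this
      exact_mod_cast this
    · rw [intervalIntegral.integral_add (by simp) (Continuous.intervalIntegrable (by fun_prop) _ _),
        intervalIntegral.integral_const_mul, integral_sub_half]
      simp
  rw [gammaConv_eq]
  split_ifs with hp
  · have := hle 0 (by simp)
    simpa [histD] using this
  · have := hle 1 fun τ hτ => by linarith [hτ.1]
    simpa [histD, histE] using this

theorem gammaConv_zero_index_neg (hα : 0 < α) (hα1 : α < 1) {l : ℕ} (hl : l ≠ 0) :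
    gammaConv α 0 l < 0 := by
  have hc := histConst_pos hα (by linarith)
  have h1 : (1 : ℝ) ≤ l := by exact_mod_cast Nat.one_le_iff_ne_zero.mpr hl
  have hi : ∀ m : ℕ, m ≠ 0 → IntervalIntegrable (fun τ : ℝ => histKernel α (m - τ)) volume 0 1 :=
    fun m hm => by
      simpa using intervalIntegrable_histKernel_mul hα hα1 (m := m)
        (by exact_mod_cast Nat.one_le_iff_ne_zero.mpr hm) (f := fun _ => 1) (by simp)
  have h : 0 < histConst α * (histD α l - histD α (l + 1)) := by
    rw [mul_sub, histConst_mul_histD hα hα1 hl, histConst_mul_histD hα hα1 (Nat.succ_ne_zero l),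
      ← intervalIntegral.integral_sub (hi _ hl) (hi _ (Nat.succ_ne_zero l))]
    refine intervalIntegral.intervalIntegral_pos_of_pos_on
      ((hi _ hl).sub (hi _ (Nat.succ_ne_zero l))) (fun τ hτ => sub_pos.mpr ?_) zero_lt_one
    push_cast
    exact strictAntiOn_histKernel hα hα1 (by simp; linarith [hτ.2]) (by simp; linarith [hτ.2])
      (by linarith)
  have := (mul_pos_iff_of_pos_left hc).mp h
  rw [gammaConv_eq]
  simp only [if_true]
  linarith

/-- At l = 1 the stencil loses its third term. What remains compares the density 2τ on the cell [0,
1] of the kernel with τ + 1/2 on [1, 2]; both have mass 1 and K(1) separates them. -/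
theorem gammaConv_one_index_one_nonpos (hα : 0 < α) (hα1 : α < 1) : gammaConv α 1 1 ≤ 0 := by
  have hc := histConst_pos hα (by linarith)
  have e1 := integral_histKernel_linear hα hα1 (m := 1) one_ne_zero 1 2
  have e2 := integral_histKernel_linear hα hα1 (m := 2) two_ne_zero 1 1
  have hK : ContinuousOn (histKernel α) (Ici 0) := continuousOn_histKernel hα hα1
  have hanti := (strictAntiOn_histKernel hα hα1).antitoneOn
  have h1 : histKernel α 1 ≤ histConst α * (1 * histD α 1 + 2 * histE α 1) := by
    rw [← e1]
    have := intervalIntegral.integral_mono_on zero_le_one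
      (Continuous.intervalIntegrable (by fun_prop : Continuous fun τ : ℝ => histKernel α 1 * (2 * τ))
        0 1) (intervalIntegrable_histKernel_mul hα hα1 (m := (1 : ℕ)) (by simp)
        (f := fun τ => 1 + 2 * (τ - 1 / 2)) (Continuous.intervalIntegrable (by fun_prop) _ _))
      fun τ hτ => by
        rw [show 1 + 2 * (τ - 1 / 2) = 2 * τ by ring]
        refine mul_le_mul_of_nonneg_right (hanti ?_ ?_ ?_) (by linarith [hτ.1])
        · simpa using hτ.2
        · simp
        · simpa using hτ.1
    rwa [intervalIntegral.integral_const_mul, integral_two_mul, mul_one] at this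
  have h2 : histConst α * (1 * histD α 2 + 1 * histE α 2) ≤ histKernel α 1 := by
    rw [← e2]
    have := intervalIntegral.integral_mono_on zero_le_one
      (intervalIntegrable_histKernel_mul hα hα1 (m := (2 : ℕ)) (by simp)
        (f := fun τ => 1 + 1 * (τ - 1 / 2)) (Continuous.intervalIntegrable (by fun_prop) _ _))
      (Continuous.intervalIntegrable
        (by fun_prop : Continuous fun τ : ℝ => histKernel α 1 * (τ + 1 / 2)) 0 1)
      fun τ hτ => by
        rw [show 1 + 1 * (τ - 1 / 2) = τ + 1 / 2 by ring]
        refine mul_le_mul_of_nonneg_right (hanti ?_ ?_ ?_) (by linarith [hτ.1])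
        · simp
        · simp
          linarith [hτ.2]
        · push_cast
          linarith [hτ.2]
    rwa [intervalIntegral.integral_const_mul, integral_add_half, mul_one] at this
  have h3 : histConst α * gammaConv α 1 1 ≤ 0 := by
    rw [gammaConv_eq]
    simp only [one_ne_zero, if_false, Nat.sub_self]
    rw [show histE α 0 = 0 by simp [histE]]
    norm_num
    linarith
  exact nonpos_of_mul_nonpos_right h3 hc

theorem histConst_mul_gammaConv_one (hα : 0 < α) (hα1 : α < 1) (n : ℕ) :
    histConst α * gammaConv α 1 (n + 2) = -stencil fun x => histKernel α (x + n) := by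
  have e1 := integral_histKernel_linear hα hα1 (m := n + 1) (by simp) 0 1
  have e2 := integral_histKernel_linear hα hα1 (m := n + 2) (by simp) 1 2
  have e3 := integral_histKernel_linear hα hα1 (m := n + 3) (by simp) 1 1
  have hi : ∀ (m : ℕ) (A B : ℝ), m ≠ 0 → IntervalIntegrable
      (fun τ : ℝ => histKernel α (m - τ) * (A + B * (τ - 1 / 2))) volume 0 1 := fun m A B hm =>
    intervalIntegrable_histKernel_mul hα hα1 (by exact_mod_cast Nat.one_le_iff_ne_zero.mpr hm)
      (Continuous.intervalIntegrable (by fun_prop) _ _)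
  have h : stencil (fun x => histKernel α (x + n)) =
      ∫ τ in (0 : ℝ)..1, (histKernel α ((n + 2 : ℕ) - τ) * (1 + 2 * (τ - 1 / 2))
        - histKernel α ((n + 3 : ℕ) - τ) * (1 + 1 * (τ - 1 / 2))
        - histKernel α ((n + 1 : ℕ) - τ) * (0 + 1 * (τ - 1 / 2))) := by
    refine intervalIntegral.integral_congr fun τ _ => ?_
    push_cast
    rw [show 2 - τ + (n : ℝ) = n + 2 - τ by ring, show 3 - τ + (n : ℝ) = n + 3 - τ by ring,
      show 1 - τ + (n : ℝ) = n + 1 - τ by ring]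
    ring
  rw [h, intervalIntegral.integral_sub ((hi _ _ _ (by simp)).sub (hi _ _ _ (by simp)))
    (hi _ _ _ (by simp)), intervalIntegral.integral_sub (hi _ _ _ (by simp)) (hi _ _ _ (by simp)),
    e1, e2, e3, gammaConv_eq]
  simp only [one_ne_zero, if_false, show n + 2 - 1 = n + 1 by omega]
  ring

theorem gammaConv_one_neg (hα : 0 < α) (hα1 : α < 1) (n : ℕ) : gammaConv α 1 (n + 2) < 0 := by
  have hc := histConst_pos hα (by linarith)
  have hs : 0 < histConst α * (1 - α) := mul_pos hc (by linarith)
  -- This solves -ρ(x)/(x(1 + x)) = K'(x + n). It is factored so that x/(x + n), x^(1 - α) and (1 +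
  -- x)/(1 + x + n) are visibly increasing.
  let ρ : ℝ → ℝ := fun x => histConst α * (1 - α) *
    ((x / (x + n)) ^ α * x ^ (1 - α) * ((1 + x) / (1 + x + n)))
  have hn : (0 : ℝ) ≤ n := Nat.cast_nonneg n
  have hst : 0 < stencil fun x => histKernel α (x + n) := by
    refine stencil_pos (ρ := ρ) ?_ ?_ ?_ ?_
    · exact (continuousOn_histKernel hα hα1).comp (by fun_prop) fun x hx => by
        simp only [mem_Ici]
        linarith [hx.1]
    · intro x hx
      have hx0 := hx.1
      have hpos : 0 < x + n := by linarith
      have h := (hasDerivAt_histKernel hα hpos).comp x ((hasDerivAt_id x).add_const (n : ℝ))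
      refine h.congr_deriv ?_
      simp only [ρ]
      rw [Real.div_rpow hx0.le hpos.le, Real.rpow_sub hx0, Real.rpow_one, Real.rpow_neg hpos.le]
      have h1 := (Real.rpow_pos_of_pos hx0 α).ne'
      have h2 := (Real.rpow_pos_of_pos hpos α).ne'
      have h3 : 1 + x ≠ 0 := by linarith
      have h4 : 1 + x + n ≠ 0 := by linarith
      have h5 : 1 + (x + n) ≠ 0 := by linarith
      field_simp
      ring
    · intro x hx y hy hxy
      have hx0 := hx.1
      have hy0 := hy.1
      refine mul_le_mul_of_nonneg_left ?_ hs.le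
      have h1 : x / (x + n) ≤ y / (y + n) := by
        rw [div_le_div_iff₀ (by linarith) (by linarith)]
        nlinarith
      have h2 : (1 + x) / (1 + x + n) ≤ (1 + y) / (1 + y + n) := by
        rw [div_le_div_iff₀ (by linarith) (by linarith)]
        nlinarith
      have h3 := Real.rpow_le_rpow (by positivity) h1 hα.le
      have h4 := Real.rpow_le_rpow hx0.le hxy (show 0 ≤ 1 - α by linarith)
      exact mul_le_mul (mul_le_mul h3 h4 (by positivity) (by positivity)) h2 (by positivity)
        (by positivity)
    · simp only [ρ]
      positivity
  have h := histConst_mul_gammaConv_one hα hα1 n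
  by_contra hcon
  have := mul_nonneg hc.le (not_lt.mp hcon)
  linarith

theorem gammaConv_neg (hα : 0 < α) (hα1 : α < 1) (p : Fin 2) {l : ℕ} (hl : 2 ≤ l) :
    gammaConv α p l < 0 := by
  obtain ⟨n, rfl⟩ := Nat.exists_eq_add_of_le' hl
  fin_cases p
  · exact gammaConv_zero_index_neg hα hα1 (by omega)
  · exact gammaConv_one_neg hα hα1 n

theorem gammaConv_nonpos (hα : 0 < α) (hα1 : α < 1) (p : Fin 2) {l : ℕ} (hl : l ≠ 0) :
    gammaConv α p l ≤ 0 := by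
  by_cases h : l = 1
  · subst h
    fin_cases p
    · exact (gammaConv_zero_index_neg hα hα1 hl).le
    · exact gammaConv_one_index_one_nonpos hα hα1
  · exact (gammaConv_neg hα hα1 p (by omega)).le

theorem tendsto_sum_gammaConv (hα : 0 < α) (hα1 : α ≤ 1) (p : Fin 2) :
    Tendsto (fun n => ∑ l ∈ Finset.range n, gammaConv α p l) atTop (𝓝 0) := by
  simp only [sum_gammaConv]
  have hD := tendsto_histD hα hα1
  have hE := tendsto_histE hα hα1
  split_ifs with hp
  · simpa using hD
  · simpa using hD.add (hE.sub (hE.comp (tendsto_sub_atTop_nat 1)))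

/-- The partial sums telescope to kernel moments on cells moving to infinity. As all weights but the
first are nonpositive, this conditional limit is an absolute sum. -/
theorem hasSum_gammaConv (hα : 0 < α) (hα1 : α ≤ 1) (p : Fin 2) : HasSum (gammaConv α p) 0 := by
  rcases hα1.lt_or_eq with h1 | rfl
  · have h := (hasSum_iff_tendsto_nat_of_nonneg (f := fun l => -gammaConv α p (l + 1))
      (fun l => neg_nonneg.mpr (gammaConv_nonpos hα h1 p (Nat.succ_ne_zero l)))
      (gammaConv α p 0)).mpr ?_
    · have h2 := h.neg
      simp only [neg_neg] at h2
      have h3 := (hasSum_nat_add_iff 1).mp h2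
      simpa using h3
    · have h4 := (tendsto_sum_gammaConv hα hα1 p).comp (tendsto_add_atTop_nat 1)
      have h5 := h4.const_sub (gammaConv α p 0)
      rw [sub_zero] at h5
      refine h5.congr fun n => ?_
      simp only [Function.comp_apply]
      rw [Finset.sum_range_succ', Finset.sum_neg_distrib]
      ring
  · simp only [funext (gammaConv_one p)]
    exact hasSum_zero

theorem summable_abs_gammaConv (hα : 0 < α) (hα1 : α ≤ 1) (p : Fin 2) :
    Summable fun l => |gammaConv α p l| := (hasSum_gammaConv hα hα1 p).summable.abs

/-- The symbol of the method for `λ = 0`. -/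
def symbolZero (α : ℝ) (p : Fin 2) (ξ : ℂ) : ℂ :=
  1 - ξ + gammaGen α p ξ * ξ / ((Real.Gamma α : ℂ) * (Real.Gamma (2 - α) : ℂ))

theorem symbolZero_one (hα : 0 < α) (hα1 : α ≤ 1) (p : Fin 2) : symbolZero α p 1 = 0 := by
  have h : gammaGen α p 1 = 0 := by
    simp only [gammaGen, one_pow, mul_one]
    have := (Complex.hasSum_ofReal.mpr (hasSum_gammaConv hα hα1 p)).tsum_eq
    simpa using this
  simp [symbolZero, h]

/-- The equation says that an average of ξ^(n+1) with weights w n equals 1. Since |ξ| ≤ 1, every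
power carrying positive weight must equal 1. -/
theorem eq_one_of_symbolZero_eq_zero (hα : 0 < α) (hα1 : α ≤ 1) (p : Fin 2) {ξ : ℂ}
    (hξ : ‖ξ‖ ≤ 1) (h : symbolZero α p ξ = 0) : ξ = 1 := by
  rcases hα1.lt_or_eq with h1 | rfl
  swap
  · have : gammaGen 1 p ξ = 0 := by simp [gammaGen, gammaConv_one]
    rw [symbolZero, this] at h
    simpa using (sub_eq_zero.mp (by simpa using h) : (1 : ℂ) = ξ).symm
  have hc := histConst_pos hα (by linarith)
  let w : ℕ → ℝ := fun n => (if n = 0 then 1 else 0) - histConst α * gammaConv α p n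
  have hw : ∀ n, 0 ≤ w n := by
    intro n
    by_cases hn : n = 0
    · subst hn
      simpa [w] using gammaConv_zero_le hα h1 p
    · have := mul_nonpos_of_nonneg_of_nonpos hc.le (gammaConv_nonpos hα h1 p hn)
      simpa [w, hn] using this
  have hwpos : ∀ n, 2 ≤ n → 0 < w n := by
    intro n hn
    have := mul_neg_of_pos_of_neg hc (gammaConv_neg hα h1 p hn)
    simpa [w, show n ≠ 0 by omega] using this
  have hγ := hasSum_gammaConv hα hα1 p
  have hsum : HasSum w 1 := by
    simpa using (hasSum_ite_eq 0 (1 : ℝ)).sub (hγ.mul_left (histConst α))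
  have hpow : ∀ n : ℕ, ‖ξ ^ (n + 1)‖ ≤ 1 := fun n => by
    rw [norm_pow]
    exact pow_le_one₀ (norm_nonneg _) hξ
  have hgen : HasSum (fun l => (gammaConv α p l : ℂ) * ξ ^ l) (gammaGen α p ξ) := by
    refine (Summable.of_norm_bounded (summable_abs_gammaConv hα hα1 p) fun l => ?_).hasSum
    rw [norm_mul, Complex.norm_real, norm_pow, Real.norm_eq_abs]
    exact mul_le_of_le_one_right (abs_nonneg _) (pow_le_one₀ (norm_nonneg _) hξ)
  have hsumξ : HasSum (fun n => (w n : ℂ) * ξ ^ (n + 1)) 1 := by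
    have h2 := (hasSum_ite_eq 0 ξ).sub (hgen.mul_left ((histConst α : ℂ) * ξ))
    have h3 : ξ - (histConst α : ℂ) * ξ * gammaGen α p ξ = 1 := by
      have h4 : (histConst α : ℂ) = 1 / ((Real.Gamma α : ℂ) * (Real.Gamma (2 - α) : ℂ)) := by
        simp [histConst]
      rw [symbolZero] at h
      rw [h4]
      linear_combination -h
    rw [h3] at h2
    refine h2.congr_fun ?_
    intro n
    by_cases hn : n = 0
    · subst hn
      simp [w]
      ring
    · simp [w, hn]
      ring
  have hre : HasSum (fun n => w n * (1 - (ξ ^ (n + 1)).re)) 0 := by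
    have h2 := Complex.hasSum_re hsumξ
    have h3 := hsum.sub h2
    simp only [Complex.one_re, sub_self, Complex.re_ofReal_mul] at h3
    refine h3.congr_fun ?_
    intro n
    ring
  have hre1 : ∀ n, (ξ ^ (n + 1)).re ≤ 1 := fun n => (Complex.re_le_norm _).trans (hpow n)
  have hz := (hasSum_zero_iff_of_nonneg fun n => mul_nonneg (hw n)
    (by linarith [hre1 n])).mp hre
  have hone : ∀ n, 2 ≤ n → ξ ^ (n + 1) = 1 := by
    intro n hn
    have h2 : w n * (1 - (ξ ^ (n + 1)).re) = 0 := congrFun hz n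
    have h3 : (ξ ^ (n + 1)).re = 1 := by
      have := (mul_eq_zero.mp h2).resolve_left (hwpos n hn).ne'
      linarith
    have h4 := Complex.sq_norm_sub_sq_re (ξ ^ (n + 1))
    have h5 : (ξ ^ (n + 1)).im = 0 := by
      have := hpow n
      have h6 : ‖ξ ^ (n + 1)‖ ^ 2 ≤ 1 := pow_le_one₀ (norm_nonneg _) this
      rw [h3] at h4
      nlinarith [sq_nonneg (ξ ^ (n + 1)).im]
    exact Complex.ext h3 h5
  -- The exponents 3 and 4 are coprime, so only ξ = 1 is left.
  have h3 := hone 2 le_rfl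
  have h4 := hone 3 (by norm_num)
  calc ξ = ξ ^ (2 + 1) * ξ := by rw [h3, one_mul]
    _ = ξ ^ (3 + 1) := by ring
    _ = 1 := h4

end kernel

end

/-! ### Decay of the differences γ_{l+1} - γ_l. -/

section

open MeasureTheory Set

theorem stencil_const (C : ℝ) : stencil (fun _ => C) = 0 := by
  have h : ∀ τ : ℝ, 2 * τ * C - (τ + 1 / 2) * C - (τ - 1 / 2) * C = 0 := fun τ => by ring
  simp only [stencil, h, intervalIntegral.integral_zero]

theorem intervalIntegrable_stencil {f : ℝ → ℝ} (hf : ContinuousOn f (Icc 0 3)) :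
    IntervalIntegrable (fun τ : ℝ =>
      2 * τ * f (2 - τ) - (τ + 1 / 2) * f (3 - τ) - (τ - 1 / 2) * f (1 - τ)) volume 0 1 := by
  have h : ∀ m : ℝ, 1 ≤ m → m ≤ 3 → ContinuousOn (fun τ : ℝ => f (m - τ)) (uIcc 0 1) := by
    intro m h1 h3
    refine hf.comp (by fun_prop) fun τ hτ => ?_
    rw [uIcc_of_le zero_le_one] at hτ
    exact ⟨by linarith [hτ.2], by linarith [hτ.1]⟩
  have h1 := h 1 (by norm_num) (by norm_num)
  have h2 := h 2 (by norm_num) (by norm_num)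
  have h3 := h 3 (by norm_num) (by norm_num)
  refine ContinuousOn.intervalIntegrable ?_
  exact ((ContinuousOn.mul (by fun_prop) h2).sub (ContinuousOn.mul (by fun_prop) h3)).sub
    (ContinuousOn.mul (by fun_prop) h1)

theorem stencil_sub {f g : ℝ → ℝ} (hf : ContinuousOn f (Icc 0 3)) (hg : ContinuousOn g (Icc 0 3)) :
    stencil (fun x => f x - g x) = stencil f - stencil g := by
  rw [stencil, stencil, stencil, ← intervalIntegral.integral_sub (intervalIntegrable_stencil hf)
    (intervalIntegrable_stencil hg)]
  exact intervalIntegral.integral_congr fun τ _ => by ring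

/-- The stencil annihilates constants, so f may be replaced by f - f 0; the densities are bounded by
2, 3/2 and 1/2, with sum 4. -/
theorem abs_stencil_le {f : ℝ → ℝ} (hf : ContinuousOn f (Icc 0 3)) {ω : ℝ}
    (hω : ∀ x ∈ Icc (0 : ℝ) 3, |f x - f 0| ≤ ω) : |stencil f| ≤ 4 * ω := by
  have h0 : stencil f = stencil fun x => f x - f 0 := by
    rw [stencil_sub hf continuousOn_const, stencil_const, sub_zero]
  have h := intervalIntegral.norm_integral_le_of_norm_le_const (a := 0) (b := 1)
    (f := fun τ : ℝ => 2 * τ * (f (2 - τ) - f 0) - (τ + 1 / 2) * (f (3 - τ) - f 0)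
      - (τ - 1 / 2) * (f (1 - τ) - f 0)) (C := 4 * ω) fun τ hτ => ?_
  · rw [h0, stencil]
    simpa using h
  · rw [uIoc_of_le zero_le_one] at hτ
    have a1 := abs_le.mp (hω (1 - τ) ⟨by linarith [hτ.2], by linarith [hτ.1]⟩)
    have a2 := abs_le.mp (hω (2 - τ) ⟨by linarith [hτ.2], by linarith [hτ.1]⟩)
    have a3 := abs_le.mp (hω (3 - τ) ⟨by linarith [hτ.2], by linarith [hτ.1]⟩)
    have hω0 : 0 ≤ ω := by linarith
    rw [Real.norm_eq_abs]
    have b1 : |2 * τ * (f (2 - τ) - f 0)| ≤ 2 * ω := by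
      rw [abs_mul, abs_of_nonneg (by linarith [hτ.1])]
      exact mul_le_mul (by linarith [hτ.2]) (abs_le.mpr a2) (abs_nonneg _) (by norm_num)
    have b2 : |(τ + 1 / 2) * (f (3 - τ) - f 0)| ≤ 3 / 2 * ω := by
      rw [abs_mul, abs_of_nonneg (by linarith [hτ.1])]
      exact mul_le_mul (by linarith [hτ.2]) (abs_le.mpr a3) (abs_nonneg _) (by norm_num)
    have b3 : |(τ - 1 / 2) * (f (1 - τ) - f 0)| ≤ 1 / 2 * ω := by
      rw [abs_mul]
      refine mul_le_mul ?_ (abs_le.mpr a1) (abs_nonneg _) (by norm_num)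
      rw [abs_le]
      constructor <;> linarith [hτ.1, hτ.2]
    have b4 := abs_sub (2 * τ * (f (2 - τ) - f 0) - (τ + 1 / 2) * (f (3 - τ) - f 0))
      ((τ - 1 / 2) * (f (1 - τ) - f 0))
    have b5 := abs_sub (2 * τ * (f (2 - τ) - f 0)) ((τ + 1 / 2) * (f (3 - τ) - f 0))
    linarith

section kernel

variable {α : ℝ}

/-- Estimate for the unit difference of `x ↦ x ^ (-α) / (1 + x)`. -/
theorem abs_sub_rpow_div_le (hα : 0 < α) (hα1 : α < 1) {x : ℝ} (hx : 0 < x) :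
    |x ^ (-α) / (1 + x) - (x + 1) ^ (-α) / (1 + (x + 1))| ≤ 2 * x ^ (-α - 2) := by
  have hx1 : 0 < x + 1 := by linarith
  have hA : (x + 1) ^ (-α) ≤ x ^ (-α) :=
    Real.rpow_le_rpow_of_nonpos hx (by linarith) (by linarith)
  -- As α < 1 and x/(x + 1) ≤ 1, the power satisfies (x/(x + 1))^α ≥ x/(x + 1), which gains the
  -- factor 1/x.
  have hB : x ^ (-α) - (x + 1) ^ (-α) ≤ x ^ (-α) / x := by
    have h1 : x / (x + 1) ≤ (x / (x + 1)) ^ α := by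
      have h2 : x / (x + 1) ≤ 1 := (div_le_one hx1).mpr (by linarith)
      simpa using Real.rpow_le_rpow_of_exponent_ge (by positivity) h2 hα1.le
    rw [Real.div_rpow hx.le hx1.le] at h1
    rw [Real.rpow_neg hx.le, Real.rpow_neg hx1.le]
    have p1 := Real.rpow_pos_of_pos hx α
    have p2 := Real.rpow_pos_of_pos hx1 α
    have h3 : ((x + 1) ^ α)⁻¹ = (x ^ α)⁻¹ * (x ^ α / (x + 1) ^ α) := by field_simp
    have h4 : (x ^ α)⁻¹ * (x / (x + 1)) ≤ ((x + 1) ^ α)⁻¹ := by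
      rw [h3]
      exact mul_le_mul_of_nonneg_left h1 (by positivity)
    have h5 : (x ^ α)⁻¹ - (x ^ α)⁻¹ * (x / (x + 1)) = (x ^ α)⁻¹ / (x + 1) := by
      field_simp
      ring
    have h6 : (x ^ α)⁻¹ / (x + 1) ≤ (x ^ α)⁻¹ / x :=
      div_le_div_of_nonneg_left (by positivity) hx (by linarith)
    linarith
  have hpos : 0 ≤ (x + 1) ^ (-α) := Real.rpow_nonneg hx1.le _
  have hpow : x ^ (-α - 2) = x ^ (-α) / x ^ 2 := by
    rw [Real.rpow_sub hx]
    norm_num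
  -- Product rule for differences; each of the two summands is at most x^(-α-2).
  have hdec : x ^ (-α) / (1 + x) - (x + 1) ^ (-α) / (1 + (x + 1)) =
      (x ^ (-α) - (x + 1) ^ (-α)) / (1 + x)
        + (x + 1) ^ (-α) * (1 / ((1 + x) * (1 + (x + 1)))) := by
    field_simp
    ring
  have hpx : 0 ≤ x ^ (-α) := Real.rpow_nonneg hx.le _
  have t1 : (x ^ (-α) - (x + 1) ^ (-α)) / (1 + x) ≤ x ^ (-α) / x ^ 2 := by
    calc (x ^ (-α) - (x + 1) ^ (-α)) / (1 + x) ≤ x ^ (-α) / x / x :=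
          div_le_div₀ (by positivity) hB hx (by linarith)
      _ = x ^ (-α) / x ^ 2 := by
          field_simp
  have t2 : (x + 1) ^ (-α) * (1 / ((1 + x) * (1 + (x + 1)))) ≤ x ^ (-α) / x ^ 2 := by
    rw [div_eq_mul_one_div (x ^ (-α))]
    refine mul_le_mul hA (one_div_le_one_div_of_le (by positivity) (by nlinarith))
      (by positivity) hpx
  rw [hdec, hpow, abs_of_nonneg (add_nonneg (div_nonneg (by linarith) (by linarith))
    (mul_nonneg hpos (by positivity)))]
  linarith

/-- Oscillation of the unit difference of the kernel of the history load. -/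
theorem abs_histKernel_diff_sub_le (hα : 0 < α) (hα1 : α < 1) {x y : ℝ} (hx : 0 < x)
    (hxy : x ≤ y) :
    |(histKernel α y - histKernel α (y + 1)) - (histKernel α x - histKernel α (x + 1))| ≤
      histConst α * (1 - α) * (2 * x ^ (-α - 2)) * (y - x) := by
  have hs : 0 < histConst α * (1 - α) := mul_pos (histConst_pos hα (by linarith)) (by linarith)
  have hd : ∀ t ∈ Ici x, HasDerivWithinAt (fun t => histKernel α t - histKernel α (t + 1))
      (-(histConst α * (1 - α)) *
        (t ^ (-α) / (1 + t) - (t + 1) ^ (-α) / (1 + (t + 1)))) (Ici x) t := by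
    intro t ht
    have ht0 : 0 < t := hx.trans_le ht
    have h1 := hasDerivAt_histKernel hα ht0
    have h2 := (hasDerivAt_histKernel hα (show 0 < t + 1 by linarith)).comp t
      ((hasDerivAt_id t).add_const 1)
    refine ((h1.sub h2).congr_deriv ?_).hasDerivWithinAt
    ring
  have h := (convex_Ici x).norm_image_sub_le_of_norm_hasDerivWithin_le hd
    (C := histConst α * (1 - α) * (2 * x ^ (-α - 2))) (fun t ht => ?_) (self_mem_Ici (a := x)) hxy
  · simpa [Real.norm_eq_abs, abs_of_nonneg (sub_nonneg.mpr hxy)] using h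
  · have ht0 : 0 < t := hx.trans_le ht
    rw [norm_mul, norm_neg, Real.norm_of_nonneg hs.le, Real.norm_eq_abs]
    refine mul_le_mul_of_nonneg_left ((abs_sub_rpow_div_le hα hα1 ht0).trans ?_) hs.le
    exact mul_le_mul_of_nonneg_left
      (Real.rpow_le_rpow_of_nonpos hx ht (by linarith)) (by norm_num)

/-- The difference is a functional annihilating constants, applied to x ↦ K(x + n) - K(x + n + 1),
and so is controlled by the oscillation of that function on [0, 3]. The constant is 24 = 4 · 2 · 3:
the stencil bound, the bound on the derivative of the unit difference, and the interval length. -/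
theorem abs_gammaConv_diff_le (hα : 0 < α) (hα1 : α < 1) (p : Fin 2) {n : ℕ} (hn : n ≠ 0) :
    |gammaConv α p (n + 3) - gammaConv α p (n + 2)| ≤ 24 * (1 - α) * (n : ℝ) ^ (-α - 2) := by
  have hc := histConst_pos hα (by linarith)
  have hn1 : (1 : ℝ) ≤ n := by exact_mod_cast Nat.one_le_iff_ne_zero.mpr hn
  set ω := histConst α * (1 - α) * (2 * (n : ℝ) ^ (-α - 2)) * 3 with hω
  have hω0 : 0 ≤ ω := by
    have : 0 ≤ 1 - α := by linarith
    positivity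
  have hcont : ∀ c : ℝ, 0 ≤ c → ContinuousOn (fun x => histKernel α (x + c)) (Icc 0 3) :=
    fun c hc => (continuousOn_histKernel hα hα1).comp (by fun_prop) fun x hx => by
      simp only [mem_Ici]
      linarith [hx.1]
  have hosc : ∀ x ∈ Icc (0 : ℝ) 3, |(histKernel α (x + n) - histKernel α (x + (n + 1)))
      - (histKernel α (0 + n) - histKernel α (0 + (n + 1)))| ≤ ω := by
    intro x hx
    have h := abs_histKernel_diff_sub_le hα hα1 (x := n) (y := x + n) (by linarith)
      (by linarith [hx.1])
    rw [show x + ((n : ℝ) + 1) = x + n + 1 by ring, zero_add, zero_add]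
    refine h.trans ?_
    rw [hω]
    refine mul_le_mul_of_nonneg_left (by linarith [hx.2]) ?_
    have : 0 ≤ 1 - α := by linarith
    positivity
  have key : |histConst α * (gammaConv α p (n + 3) - gammaConv α p (n + 2))| ≤ 4 * ω := by
    fin_cases p
    · have hi : ∀ m : ℕ, m ≠ 0 →
          IntervalIntegrable (fun τ : ℝ => histKernel α (m - τ)) volume 0 1 := fun m hm => by
        simpa using intervalIntegrable_histKernel_mul hα hα1 (m := m)
          (by exact_mod_cast Nat.one_le_iff_ne_zero.mpr hm) (f := fun _ => 1) (by simp)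
      have e : histConst α * (gammaConv α 0 (n + 3) - gammaConv α 0 (n + 2)) =
          ∫ τ in (0 : ℝ)..1, ((histKernel α ((n + 2 : ℕ) - τ) - histKernel α ((n + 3 : ℕ) - τ))
            - (histKernel α ((n + 3 : ℕ) - τ) - histKernel α ((n + 4 : ℕ) - τ))) := by
        rw [intervalIntegral.integral_sub ((hi _ (by simp)).sub (hi _ (by simp)))
          ((hi _ (by simp)).sub (hi _ (by simp))), intervalIntegral.integral_sub (hi _ (by simp))
          (hi _ (by simp)), intervalIntegral.integral_sub (hi _ (by simp)) (hi _ (by simp)),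
          ← histConst_mul_histD hα hα1 (by simp), ← histConst_mul_histD hα hα1 (by simp),
          ← histConst_mul_histD hα hα1 (by simp), gammaConv_eq, gammaConv_eq]
        simp only [if_true]
        ring
      change |histConst α * (gammaConv α 0 (n + 3) - gammaConv α 0 (n + 2))| ≤ 4 * ω
      rw [e]
      have h := intervalIntegral.norm_integral_le_of_norm_le_const (a := 0) (b := 1)
        (f := fun τ : ℝ =>
          ((histKernel α ((n + 2 : ℕ) - τ) - histKernel α ((n + 3 : ℕ) - τ))
            - (histKernel α ((n + 3 : ℕ) - τ) - histKernel α ((n + 4 : ℕ) - τ))))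
        (C := 4 * ω) fun τ hτ => ?_
      · simpa using h
      · rw [uIoc_of_le zero_le_one] at hτ
        have h2 := hosc (2 - τ) ⟨by linarith [hτ.2], by linarith [hτ.1]⟩
        have h3 := hosc (3 - τ) ⟨by linarith [hτ.2], by linarith [hτ.1]⟩
        rw [abs_le] at h2 h3
        rw [Real.norm_eq_abs, abs_le]
        push_cast
        rw [show 2 - τ + (n : ℝ) = n + 2 - τ by ring,
          show 2 - τ + ((n : ℝ) + 1) = n + 3 - τ by ring] at h2
        rw [show 3 - τ + (n : ℝ) = n + 3 - τ by ring,
          show 3 - τ + ((n : ℝ) + 1) = n + 4 - τ by ring] at h3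
        constructor <;> linarith [h2.1, h2.2, h3.1, h3.2]
    · change |histConst α * (gammaConv α 1 (n + 3) - gammaConv α 1 (n + 2))| ≤ 4 * ω
      rw [mul_sub, show n + 3 = (n + 1) + 2 by ring, histConst_mul_gammaConv_one hα hα1,
        histConst_mul_gammaConv_one hα hα1]
      push_cast
      rw [show ∀ a b : ℝ, -a - -b = b - a by intros; ring,
        ← stencil_sub (hcont _ (by linarith)) (hcont _ (by linarith))]
      exact abs_stencil_le ((hcont _ (by linarith)).sub (hcont _ (by linarith))) hosc
  rw [abs_mul, abs_of_pos hc] at key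
  refine le_of_mul_le_mul_left (key.trans_eq ?_) hc
  rw [hω]
  ring

theorem summable_gammaConv_diff (hα : 0 < α) (hα1 : α ≤ 1) (p : Fin 2) :
    Summable fun l : ℕ => ((l : ℝ) + 1) * |gammaConv α p (l + 1) - gammaConv α p l| := by
  rcases hα1.lt_or_eq with h1 | rfl
  swap
  · simp [gammaConv_one]
  rw [← summable_nat_add_iff 3]
  have hs : Summable fun l : ℕ => 96 * (1 - α) * (((l + 1 : ℕ) : ℝ) ^ (-α - 1)) :=
    ((summable_nat_add_iff 1).mpr (Real.summable_nat_rpow.mpr (by linarith))).mul_left _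
  refine Summable.of_nonneg_of_le (fun l => by positivity) (fun l => ?_) hs
  have h := abs_gammaConv_diff_le hα h1 p (Nat.succ_ne_zero l)
  rw [show l + 3 + 1 = l + 1 + 3 by ring, show l + 3 = l + 1 + 2 by ring]
  have hpos : (0 : ℝ) < (l + 1 : ℕ) := by positivity
  have hp : ((l + 1 : ℕ) : ℝ) ^ (-α - 1) = ((l + 1 : ℕ) : ℝ) ^ (-α - 2) * ((l + 1 : ℕ) : ℝ) := by
    rw [← Real.rpow_add_one hpos.ne']
    congr 1
    ring
  have h2 : 0 ≤ (1 - α) * ((l + 1 : ℕ) : ℝ) ^ (-α - 2) :=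
    mul_nonneg (by linarith) (Real.rpow_nonneg hpos.le _)
  calc ((l + 1 + 2 : ℕ) + 1 : ℝ) * |gammaConv α p (l + 1 + 3) - gammaConv α p (l + 1 + 2)|
      ≤ (4 * ((l + 1 : ℕ) : ℝ)) * (24 * (1 - α) * ((l + 1 : ℕ) : ℝ) ^ (-α - 2)) := by
        refine mul_le_mul ?_ h (abs_nonneg _) (by positivity)
        push_cast
        linarith [(Nat.cast_nonneg l : (0 : ℝ) ≤ l)]
    _ = 96 * (1 - α) * ((l + 1 : ℕ) : ℝ) ^ (-α - 1) := by
        rw [hp]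
        ring

end kernel

end

/-! ### Interpolation errors of powers; defects of the Adams-Moulton rule and of the extrapolation.
-/

section

open MeasureTheory Set

theorem hasDerivAt_mul_rpow (C s : ℝ) {x : ℝ} (hx : 0 < x) :
    HasDerivAt (fun x : ℝ => C * x ^ s) (C * s * x ^ (s - 1)) x :=
  ((Real.hasDerivAt_rpow_const (Or.inl hx.ne')).const_mul C).congr_deriv (by ring)

theorem abs_mul_rpow_le {a b x : ℝ} (C r : ℝ) (ha : 0 < a) (hx : x ∈ Icc a b) :
    |C * x ^ r| ≤ |C| * (a ^ r + b ^ r) := by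
  have hx0 : 0 < x := ha.trans_le hx.1
  rw [abs_mul, abs_of_nonneg (Real.rpow_nonneg hx0.le r)]
  exact mul_le_mul_of_nonneg_left (rpow_le_add_of_mem ha hx.1 hx.2 r) (abs_nonneg C)

/-- A function vanishing somewhere on an interval is bounded by the length times a bound of its
derivative. -/
theorem abs_le_of_hasDerivAt_of_zero {g g' : ℝ → ℝ} {a b B : ℝ}
    (hg : ∀ x ∈ Icc a b, HasDerivAt g (g' x) x) (hB : ∀ x ∈ Icc a b, |g' x| ≤ B) {y : ℝ}
    (hy : y ∈ Icc a b) (hy0 : g y = 0) {x : ℝ} (hx : x ∈ Icc a b) : |g x| ≤ B * (b - a) := by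
  have h := (convex_Icc a b).norm_image_sub_le_of_norm_hasDerivWithin_le
    (fun x hx => (hg x hx).hasDerivWithinAt) hB hy hx
  rw [hy0, sub_zero, Real.norm_eq_abs, Real.norm_eq_abs] at h
  refine h.trans (mul_le_mul_of_nonneg_left ?_ ((abs_nonneg _).trans (hB x hx)))
  rw [abs_le]
  constructor <;> linarith [hx.1, hx.2, hy.1, hy.2]

theorem exists_rpow_sub_eq (s : ℝ) {a : ℝ} (ha : 0 < a) :
    ∃ y ∈ Ioo a (a + 1), s * y ^ (s - 1) = (a + 1) ^ s - a ^ s := by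
  obtain ⟨y, hy, h⟩ := exists_hasDerivAt_eq_slope (fun x : ℝ => x ^ s) (fun x => s * x ^ (s - 1))
    (by linarith : a < a + 1)
    (fun x hx => (Real.continuousAt_rpow_const x s
      (Or.inl (ha.trans_le hx.1).ne')).continuousWithinAt)
    (fun x hx => Real.hasDerivAt_rpow_const (Or.inl (ha.trans hx.1).ne'))
  exact ⟨y, hy, by simpa using h⟩

theorem abs_rpow_diff_le (s : ℝ) {a : ℝ} (ha : 0 < a) :
    |(a + 1) ^ s - a ^ s| ≤ |s| * (a ^ (s - 1) + (a + 1) ^ (s - 1)) := by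
  obtain ⟨y, hy, h⟩ := exists_rpow_sub_eq s ha
  rw [← h]
  exact abs_mul_rpow_le s (s - 1) ha (Ioo_subset_Icc_self hy)

/-- Error of the derivative of the linear interpolant of a power. -/
theorem abs_rpow_deriv_sub_le (s : ℝ) {a w : ℝ} (ha : 0 < a) (hw : w ∈ Icc a (a + 1)) :
    |s * w ^ (s - 1) - ((a + 1) ^ s - a ^ s)| ≤
      |s * (s - 1)| * (a ^ (s - 2) + (a + 1) ^ (s - 2)) := by
  obtain ⟨y, hy, h⟩ := exists_rpow_sub_eq s ha
  have h2 := abs_le_of_hasDerivAt_of_zero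
    (g := fun w => s * w ^ (s - 1) - ((a + 1) ^ s - a ^ s))
    (g' := fun w => s * (s - 1) * w ^ (s - 1 - 1))
    (B := |s * (s - 1)| * (a ^ (s - 2) + (a + 1) ^ (s - 2)))
    (fun x hx => (hasDerivAt_mul_rpow s (s - 1) (ha.trans_le hx.1)).sub_const _)
    (fun x hx => by
      rw [show s - 1 - 1 = s - 2 by ring]
      exact abs_mul_rpow_le _ _ ha hx)
    (Ioo_subset_Icc_self hy) (by simp only [h, sub_self]) hw
  simpa using h2

/-- Error of the derivative of the quadratic interpolant of a power. -/
theorem abs_rpow_deriv_sub_quadratic_le (s : ℝ) {a w : ℝ} (ha : 0 < a)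
    (hw : w ∈ Icc a (a + 2)) :
    |s * w ^ (s - 1) - (((a + 2) ^ s - (a + 1) ^ s)
      + ((a + 2) ^ s - 2 * (a + 1) ^ s + a ^ s) * (w - (a + 1) - 1 / 2))| ≤
      4 * (|s * (s - 1) * (s - 2)| * (a ^ (s - 3) + (a + 2) ^ (s - 3))) := by
  set Δ := (a + 2) ^ s - (a + 1) ^ s
  set δ := (a + 2) ^ s - 2 * (a + 1) ^ s + a ^ s
  set B := |s * (s - 1) * (s - 2)| * (a ^ (s - 3) + (a + 2) ^ (s - 3))
  -- The interpolation error at the nodes a, a + 1, a + 2, with its first two derivatives g and g'.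
  let e : ℝ → ℝ := fun w => w ^ s - ((a + 1) ^ s + Δ * (w - (a + 1))
    + δ / 2 * ((w - (a + 1)) * (w - (a + 2))))
  let g : ℝ → ℝ := fun w => s * w ^ (s - 1) - (Δ + δ * (w - (a + 1) - 1 / 2))
  let g' : ℝ → ℝ := fun w => s * (s - 1) * w ^ (s - 2) - δ
  have he : ∀ x, 0 < x → HasDerivAt e (g x) x := by
    intro x hx
    have h1 : ∀ c : ℝ, HasDerivAt (fun w : ℝ => w - c) 1 x := fun c =>
      (hasDerivAt_id x).sub_const c
    refine ((Real.hasDerivAt_rpow_const (Or.inl hx.ne')).sub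
      ((((h1 (a + 1)).const_mul Δ).const_add _).add
        (((h1 (a + 1)).mul (h1 (a + 2))).const_mul (δ / 2)))).congr_deriv ?_
    simp only [g]
    ring
  have hg : ∀ x, 0 < x → HasDerivAt g (g' x) x := by
    intro x hx
    have h1 : HasDerivAt (fun w : ℝ => w - (a + 1) - 1 / 2) 1 x :=
      ((hasDerivAt_id x).sub_const _).sub_const _
    refine ((hasDerivAt_mul_rpow s (s - 1) hx).sub ((h1.const_mul δ).const_add Δ)).congr_deriv ?_
    simp only [g']
    rw [show s - 1 - 1 = s - 2 by ring]
    ring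
  have hg' : ∀ x, 0 < x → HasDerivAt g' (s * (s - 1) * (s - 2) * x ^ (s - 3)) x := by
    intro x hx
    have h1 := (hasDerivAt_mul_rpow (s * (s - 1)) (s - 2) hx).sub_const δ
    rwa [show s - 2 - 1 = s - 3 by ring] at h1
  have e0 : e a = 0 := by
    simp only [e, Δ, δ]
    ring
  have e1 : e (a + 1) = 0 := by
    simp only [e]
    ring
  have e2 : e (a + 2) = 0 := by
    simp only [e, Δ]
    ring
  -- Rolle: three zeros of e give two of g and one of g'. Integrating the third derivative back from
  -- these zeros costs the interval length 2 twice, hence the factor 4.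
  obtain ⟨y1, hy1, hz1⟩ := exists_hasDerivAt_eq_zero (by linarith : a < a + 1)
    (fun x hx => (he x (ha.trans_le hx.1)).continuousAt.continuousWithinAt) (e0.trans e1.symm)
    (fun x hx => he x (ha.trans hx.1))
  obtain ⟨y2, hy2, hz2⟩ := exists_hasDerivAt_eq_zero (by linarith : a + 1 < a + 2)
    (fun x hx => (he x (by linarith [hx.1])).continuousAt.continuousWithinAt) (e1.trans e2.symm)
    (fun x hx => he x (by linarith [hx.1]))
  obtain ⟨y3, hy3, hz3⟩ := exists_hasDerivAt_eq_zero (hy1.2.trans hy2.1)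
    (fun x hx => (hg x (by linarith [hx.1, hy1.1])).continuousAt.continuousWithinAt)
    (hz1.trans hz2.symm) (fun x hx => hg x (by linarith [hx.1, hy1.1]))
  have hb1 : ∀ x ∈ Icc a (a + 2), |g' x| ≤ B * (a + 2 - a) := fun x hx =>
    abs_le_of_hasDerivAt_of_zero (fun x hx => hg' x (ha.trans_le hx.1))
      (fun x hx => abs_mul_rpow_le _ _ ha hx)
      ⟨by linarith [hy1.1, hy3.1], by linarith [hy2.2, hy3.2]⟩ hz3 hx
  have hb2 := abs_le_of_hasDerivAt_of_zero (fun x hx => hg x (ha.trans_le hx.1)) hb1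
    ⟨by linarith [hy1.1], by linarith [hy1.2]⟩ hz1 hw
  refine hb2.trans_eq ?_
  ring

theorem tendsto_natCast_add_rpow {t : ℝ} (ht : t < 0) (c : ℝ) :
    Tendsto (fun n : ℕ => ((n : ℝ) + c) ^ t) atTop (𝓝 0) := by
  have h := (tendsto_rpow_neg_atTop (y := -t) (by linarith)).comp
    (tendsto_atTop_add_const_right _ c tendsto_natCast_atTop_atTop)
  simp only [neg_neg] at h
  exact h

theorem tendsto_const_mul_rpow_add_rpow {t : ℝ} (ht : t < 0) (C c d : ℝ) :
    Tendsto (fun n : ℕ => C * (((n : ℝ) + c) ^ t + ((n : ℝ) + d) ^ t)) atTop (𝓝 0) := by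
  simpa using ((tendsto_natCast_add_rpow ht c).add (tendsto_natCast_add_rpow ht d)).const_mul C

theorem tendsto_rpow_diff {s : ℝ} (hs : s < 1) :
    Tendsto (fun n : ℕ => ((n : ℝ) + 1) ^ s - (n : ℝ) ^ s) atTop (𝓝 0) := by
  refine squeeze_zero_norm' ?_ (tendsto_const_mul_rpow_add_rpow
    (t := s - 1) (by linarith) |s| 0 1)
  filter_upwards [eventually_gt_atTop 0] with n hn
  rw [add_zero]
  exact abs_rpow_diff_le s (by exact_mod_cast hn)

theorem tendsto_defectExtra (p : Fin 2) {s : ℝ} (hs : s < (p : ℕ) + 1) :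
    Tendsto (fun k => defectExtra p k s) atTop (𝓝 0) := by
  by_cases hp : p = 0
  · subst hp
    simp only [defectExtra, if_true]
    exact tendsto_rpow_diff (by simpa using hs)
  · have hp1 : p = 1 := by omega
    subst hp1
    have hs2 : s < 2 := by
      norm_num at hs
      linarith
    simp only [defectExtra, one_ne_zero, if_false]
    have h1 := tendsto_const_mul_rpow_add_rpow (t := s - 2) (by linarith) |s * (s - 1)| 0 1
    have h2 := tendsto_const_mul_rpow_add_rpow (t := s - 2) (by linarith) |s * (s - 1)| (-1) 0
    have h3 := h1.add h2
    rw [add_zero] at h3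
    refine squeeze_zero_norm' ?_ h3
    filter_upwards [eventually_gt_atTop 1] with n hn
    have hn' : (1 : ℝ) < n := by exact_mod_cast hn
    -- Both increments adjacent to n are compared with the same derivative s n^(s-1), which cancels
    -- in the second difference.
    have a1 := abs_rpow_deriv_sub_le s (a := n) (w := n) (by linarith) ⟨le_rfl, by linarith⟩
    have a2 := abs_rpow_deriv_sub_le s (a := n - 1) (w := n) (by linarith)
      ⟨by linarith, by linarith⟩
    rw [sub_add_cancel] at a2
    rw [abs_le] at a1 a2
    simp only [add_zero]
    rw [Real.norm_eq_abs, abs_le, ← sub_eq_add_neg]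
    constructor <;> linarith [a1.1, a1.2, a2.1, a2.2]

/-- Divided by Γ(α), these two moments yield the coefficients `beta`: the rule is exact on constants
for p = 0 and on linear functions for p = 1. -/
theorem integral_weight_mul_linear {α : ℝ} (hα : 0 < α) (A B : ℝ) :
    ∫ θ in (0 : ℝ)..1, (1 - θ) ^ (α - 1) * (A + B * θ) = A / α + B / (α * (α + 1)) := by
  have h1 := integral_beta (a := 2) (b := α) (by norm_num) hα
  have i1 := intervalIntegrable_beta (a := 2) (b := α) (by norm_num) hα
  rw [Real.Gamma_two, one_mul, show 2 + α = (α + 1) + 1 by ring, Real.Gamma_add_one (by linarith),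
    Real.Gamma_add_one hα.ne'] at h1
  have e : ∀ θ : ℝ, (1 - θ) ^ (α - 1) * (A + B * θ) =
      (1 - θ) ^ (α - 1) * A + B * (θ ^ ((2 : ℝ) - 1) * (1 - θ) ^ (α - 1)) := by
    intro θ
    rw [show (2 : ℝ) - 1 = 1 by norm_num, Real.rpow_one]
    ring
  simp only [e]
  rw [intervalIntegral.integral_add ((intervalIntegrable_weight hα).mul_const A)
    (i1.const_mul B), intervalIntegral.integral_mul_const, integral_weight hα,
    intervalIntegral.integral_const_mul, h1]
  have := (Real.Gamma_pos_of_pos hα).ne'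
  have : α + 1 ≠ 0 := by linarith
  field_simp

theorem rlIntegral_rpow (α : ℝ) (k : ℕ) (s : ℝ) :
    rlIntegral α k (fun v => v ^ s) (k + 1) = 1 / Real.Gamma α * wInt α s k := by
  have h := intervalIntegral.integral_comp_add_left (a := 0) (b := 1)
    (fun v : ℝ => ((k : ℝ) + 1 - v) ^ (α - 1) * v ^ s) (k : ℝ)
  rw [add_zero] at h
  rw [rlIntegral, ← h, wInt]
  congr 1
  refine intervalIntegral.integral_congr fun θ _ => ?_
  rw [show (k : ℝ) + 1 - (k + θ) = 1 - θ by ring]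

theorem abs_wInt_sub_linear_le {α s : ℝ} (hα : 0 < α) (hs : 0 < s) (k : ℕ) {A B C : ℝ}
    (hC : ∀ θ ∈ Icc (0 : ℝ) 1, |((k : ℝ) + θ) ^ s - (A + B * θ)| ≤ C) :
    |wInt α s k - (A / α + B / (α * (α + 1)))| ≤ C / α := by
  have hi := intervalIntegrable_wInt hα (s := s) (by linarith) (Nat.cast_nonneg k)
  have hl : IntervalIntegrable (fun θ : ℝ => (1 - θ) ^ (α - 1) * (A + B * θ)) volume 0 1 :=
    (intervalIntegrable_weight hα).mul_continuousOn (by fun_prop)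
  rw [← integral_weight_mul_linear hα, wInt, ← intervalIntegral.integral_sub hi hl]
  have h := intervalIntegral.norm_integral_le_of_norm_le (μ := volume) zero_le_one
    (f := fun θ : ℝ => (1 - θ) ^ (α - 1) * ((k : ℝ) + θ) ^ s - (1 - θ) ^ (α - 1) * (A + B * θ))
    (g := fun θ => (1 - θ) ^ (α - 1) * C) (Eventually.of_forall fun θ hθ => ?_)
    ((intervalIntegrable_weight hα).mul_const C)
  · rw [intervalIntegral.integral_mul_const, integral_weight hα, one_div_mul_eq_div] at h
    exact h
  · have h0 : 0 ≤ (1 - θ) ^ (α - 1) := Real.rpow_nonneg (by linarith [hθ.2]) _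
    rw [← mul_sub, norm_mul, Real.norm_of_nonneg h0]
    exact mul_le_mul_of_nonneg_left (hC θ (Ioc_subset_Icc_self hθ)) h0

/-- Exactness reduces the defect to the interpolation error of t^s on [k, k + 1]. It is at most (k +
1)^s - k^s for p = 0 and of order k^(s-2) for p = 1. -/
theorem tendsto_defectAM {α : ℝ} (hα : 0 < α) (p : Fin 2) {s : ℝ} (hs0 : 0 < s)
    (hs : s < (p : ℕ) + 1) : Tendsto (fun k => defectAM α p k s) atTop (𝓝 0) := by
  have hΓ := Real.Gamma_pos_of_pos hα
  by_cases hp : p = 0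
  · subst hp
    have h1 : Tendsto (fun n : ℕ => 1 / Real.Gamma α * (|((n : ℝ) + 1) ^ s - (n : ℝ) ^ s| / α))
        atTop (𝓝 0) := by
      have h2 : s < 1 := by simpa using hs
      simpa using ((tendsto_rpow_diff h2).abs.div_const α).const_mul (1 / Real.Gamma α)
    refine squeeze_zero_norm (fun k => ?_) h1
    have h2 := abs_wInt_sub_linear_le hα hs0 k (A := ((k : ℝ) + 1) ^ s) (B := 0)
      (C := |((k : ℝ) + 1) ^ s - (k : ℝ) ^ s|) fun θ hθ => by
        have hk : (0 : ℝ) ≤ k := Nat.cast_nonneg k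
        have m1 : (k : ℝ) ^ s ≤ (k + θ) ^ s := Real.rpow_le_rpow hk (by linarith [hθ.1]) hs0.le
        have m2 : ((k : ℝ) + θ) ^ s ≤ (k + 1) ^ s :=
          Real.rpow_le_rpow (by linarith [hθ.1]) (by linarith [hθ.2]) hs0.le
        rw [zero_mul, add_zero, abs_of_nonpos (by linarith), abs_of_nonneg (by linarith)]
        linarith
    have h3 : defectAM α 0 k s = 1 / Real.Gamma α *
        (wInt α s k - (((k : ℝ) + 1) ^ s / α + 0 / (α * (α + 1)))) := by
      rw [defectAM, rlIntegral_rpow]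
      simp only [beta, Fin.val_zero, zero_add, Finset.range_one, Finset.sum_singleton, if_true,
        Nat.cast_zero, sub_zero, Real.Gamma_add_one hα.ne']
      field_simp
      ring
    rw [h3, norm_mul, Real.norm_of_nonneg (by positivity)]
    exact mul_le_mul_of_nonneg_left h2 (by positivity)
  · have hp1 : p = 1 := by omega
    subst hp1
    have hs2 : s < 2 := by
      norm_num at hs
      linarith
    have h1 : Tendsto (fun n : ℕ => 1 / Real.Gamma α *
        (|s * (s - 1)| * (((n : ℝ) + 0) ^ (s - 2) + ((n : ℝ) + 1) ^ (s - 2)) / α))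
        atTop (𝓝 0) := by
      simpa using ((tendsto_const_mul_rpow_add_rpow (t := s - 2) (by linarith)
        |s * (s - 1)| 0 1).div_const α).const_mul (1 / Real.Gamma α)
    refine squeeze_zero_norm' ?_ h1
    filter_upwards [eventually_gt_atTop 0] with k hk
    have hk0 : (0 : ℝ) < k := by exact_mod_cast hk
    rw [add_zero]
    set C := |s * (s - 1)| * ((k : ℝ) ^ (s - 2) + ((k : ℝ) + 1) ^ (s - 2)) with hC
    have h2 := abs_wInt_sub_linear_le hα hs0 k (A := (k : ℝ) ^ s)
      (B := ((k : ℝ) + 1) ^ s - (k : ℝ) ^ s) (C := C) fun θ hθ => by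
        have := abs_le_of_hasDerivAt_of_zero (a := 0) (b := 1) (B := C) (y := 0) (x := θ)
          (g := fun θ => ((k : ℝ) + θ) ^ s - ((k : ℝ) ^ s
            + (((k : ℝ) + 1) ^ s - (k : ℝ) ^ s) * θ))
          (g' := fun θ => s * ((k : ℝ) + θ) ^ (s - 1) - (((k : ℝ) + 1) ^ s - (k : ℝ) ^ s))
          (fun x hx => by
            have d1 : HasDerivAt (fun θ : ℝ => (k : ℝ) + θ) 1 x := (hasDerivAt_id x).const_add _
            have d2 := d1.rpow_const (p := s) (Or.inl (by linarith [hx.1]))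
            refine (d2.sub (((hasDerivAt_id x).const_mul _).const_add _)).congr_deriv ?_
            ring)
          (fun x hx => abs_rpow_deriv_sub_le s hk0 ⟨by linarith [hx.1], by linarith [hx.2]⟩)
          ⟨le_rfl, zero_le_one⟩ (by simp) hθ
        simpa using this
    have h3 : defectAM α 1 k s = 1 / Real.Gamma α *
        (wInt α s k - ((k : ℝ) ^ s / α
          + (((k : ℝ) + 1) ^ s - (k : ℝ) ^ s) / (α * (α + 1)))) := by
      have hα1 : α + 1 ≠ 0 := by linarith
      rw [defectAM, rlIntegral_rpow]
      simp only [beta, Fin.val_one, Finset.sum_range_succ, Finset.range_zero, Finset.sum_empty,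
        one_ne_zero, if_false, if_true, Nat.cast_zero, sub_zero, Nat.cast_one, zero_add,
        add_sub_cancel_right, show α + 2 = α + 1 + 1 by ring, Real.Gamma_add_one hα1,
        Real.Gamma_add_one hα.ne']
      field_simp
      ring
    rw [h3, norm_mul, Real.norm_of_nonneg (by positivity)]
    exact mul_le_mul_of_nonneg_left h2 (by positivity)

end

/-! ### The continuous history load of a power. -/

section

open MeasureTheory Set

section kernel

variable {α : ℝ}

theorem histConst_mul_one_sub (hα1 : α < 1) :
    histConst α * (1 - α) = 1 / (Real.Gamma α * Real.Gamma (1 - α)) := by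
  rw [histConst, show (2 : ℝ) - α = (1 - α) + 1 by ring, Real.Gamma_add_one (by linarith)]
  have : 1 - α ≠ 0 := by linarith
  field_simp

/-- A rescaled beta integral. -/
theorem intervalIntegrable_beta_scaled {a b T : ℝ} (ha : 0 < a) (hb : 0 < b) (hT : 0 < T) :
    IntervalIntegrable (fun t : ℝ => t ^ (a - 1) * (T - t) ^ (b - 1)) volume 0 T := by
  have h := ((intervalIntegrable_beta ha hb).comp_mul_left (c := T⁻¹)).const_mul
    (T ^ (a - 1) * T ^ (b - 1))
  simp only [zero_div, one_div, inv_inv] at h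
  refine h.congr fun t ht => ?_
  rw [uIoc_of_le hT.le] at ht
  have h1 : T⁻¹ * t = t / T := by rw [inv_mul_eq_div]
  have h2 : 1 - t / T = (T - t) / T := by field_simp
  rw [h1, h2, Real.div_rpow ht.1.le hT.le, Real.div_rpow (by linarith [ht.2]) hT.le]
  have h3 := (Real.rpow_pos_of_pos hT (a - 1)).ne'
  have h4 := (Real.rpow_pos_of_pos hT (b - 1)).ne'
  field_simp

theorem integral_beta_scaled {a b T S : ℝ} (hT : 0 < T) (hS : 0 ≤ S) (hST : S ≤ T) :
    ∫ t in (0 : ℝ)..S, t ^ (a - 1) * (T - t) ^ (b - 1) =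
      T ^ (a + b - 1) * ∫ y in (0 : ℝ)..(S / T), y ^ (a - 1) * (1 - y) ^ (b - 1) := by
  have h := intervalIntegral.integral_comp_div (a := 0) (b := S)
    (fun y : ℝ => y ^ (a - 1) * (1 - y) ^ (b - 1)) hT.ne'
  rw [zero_div, smul_eq_mul] at h
  have h2 : T ^ (a + b - 1) = T ^ (a - 1) * T ^ (b - 1) * T := by
    rw [← Real.rpow_add hT, ← Real.rpow_add_one hT.ne']
    congr 1
    ring
  rw [h2, mul_assoc, ← h, ← intervalIntegral.integral_const_mul]
  refine intervalIntegral.integral_congr fun t ht => ?_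
  rw [uIcc_of_le hS] at ht
  have h3 : 1 - t / T = (T - t) / T := by field_simp
  rw [h3, Real.div_rpow ht.1 hT.le, Real.div_rpow (by linarith [ht.2]) hT.le]
  have h3 := (Real.rpow_pos_of_pos hT (a - 1)).ne'
  have h4 := (Real.rpow_pos_of_pos hT (b - 1)).ne'
  field_simp

/-- The integral over [0, x + 1] is a complete beta integral, which the constant normalizes to 1;
the piece over [x, x + 1] is the kernel. -/
theorem integral_eq_one_sub_histKernel (hα : 0 < α) (hα1 : α < 1) {x : ℝ} (hx : 0 ≤ x) :
    histConst α * (1 - α) * ∫ t in (0 : ℝ)..x, t ^ (-α) * (x + 1 - t) ^ (α - 1) =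
      1 - histKernel α x := by
  have hT : 0 < x + 1 := by linarith
  have hi := intervalIntegrable_beta_scaled (a := 1 - α) (b := α) (by linarith) hα hT
  have hfull := integral_beta_scaled (a := 1 - α) (b := α) hT hT.le le_rfl
  rw [div_self hT.ne', integral_beta (by linarith) hα, show (1 : ℝ) - α + α = 1 by ring,
    Real.Gamma_one, sub_self, Real.rpow_zero, one_mul, div_one] at hfull
  simp only [show (1 : ℝ) - α - 1 = -α by ring] at hi hfull
  have hsplit := intervalIntegral.integral_add_adjacent_intervals
    (hi.mono_set (by
      rw [uIcc_of_le hx, uIcc_of_le hT.le]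
      exact Icc_subset_Icc_right (by linarith)) : IntervalIntegrable _ volume 0 x)
    (hi.mono_set (by
      rw [uIcc_of_le (by linarith), uIcc_of_le hT.le]
      exact Icc_subset_Icc_left hx) : IntervalIntegrable _ volume x (x + 1))
  have htail : ∫ t in x..(x + 1), t ^ (-α) * (x + 1 - t) ^ (α - 1) = wInt α (-α) x := by
    have h := intervalIntegral.integral_comp_add_left (a := 0) (b := 1)
      (fun t : ℝ => t ^ (-α) * (x + 1 - t) ^ (α - 1)) x
    rw [add_zero] at h
    rw [← h, wInt]
    refine intervalIntegral.integral_congr fun θ _ => ?_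
    rw [show x + 1 - (x + θ) = 1 - θ by ring, mul_comm]
  rw [htail, hfull] at hsplit
  rw [histKernel, eq_sub_iff_add_eq, ← mul_add, hsplit, histConst_mul_one_sub hα1]
  have h1 := (Real.Gamma_pos_of_pos hα).ne'
  have h2 := (Real.Gamma_pos_of_pos (show 0 < 1 - α by linarith)).ne'
  field_simp

/-- The history load of a power in terms of the kernel. -/
theorem integral_histKernel_rpow (hα : 0 < α) (hα1 : α < 1) {s : ℝ} (hs : 0 < s) {T : ℝ}
    (hT : 0 < T) :
    ∫ w in (0 : ℝ)..T, histKernel α (T - w) * (s * w ^ (s - 1)) =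
      T ^ s - Real.Gamma (s + 1) / (Real.Gamma α * Real.Gamma (s - α + 1)) * (T + 1) ^ s
        * incompleteBeta (T / (T + 1)) (s - α + 1) α := by
  let μ : Measure ℝ := volume.restrict (Ioc 0 T)
  -- Integrating f in v produces 1 - K(T - w); integrating it in w produces a complete beta
  -- integral. Fubini on the triangle w < v equates the two.
  let f : ℝ → ℝ → ℝ := fun w v => if w < v then
    (s * w ^ (s - 1)) * ((v - w) ^ (-α) * (T + 1 - v) ^ (α - 1)) else 0
  have hf0 : ∀ w ∈ Ioc 0 T, ∀ v ∈ Ioc 0 T, 0 ≤ f w v := by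
    intro w hw v hv
    simp only [f]
    split_ifs with h
    · have h1 := Real.rpow_nonneg hw.1.le (s - 1)
      have h2 := Real.rpow_nonneg (show 0 ≤ v - w by linarith) (-α)
      have h3 := Real.rpow_nonneg (show 0 ≤ T + 1 - v by linarith [hv.2]) (α - 1)
      positivity
    · exact le_rfl
  have hmeas : Measurable (Function.uncurry f) := by
    refine Measurable.ite (measurableSet_lt measurable_fst measurable_snd) ?_ measurable_const
    fun_prop
  have hshift : ∀ w ∈ Ioc 0 T, IntervalIntegrable
      (fun v : ℝ => (v - w) ^ (-α) * (T + 1 - v) ^ (α - 1)) volume w T := by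
    intro w hw
    have h := intervalIntegrable_beta_scaled (a := 1 - α) (b := α) (T := T - w + 1) (by linarith) hα
      (by linarith [hw.2])
    have h2 := (h.mono_set (c := 0) (d := T - w) (by
      rw [uIcc_of_le (by linarith [hw.2]), uIcc_of_le (by linarith [hw.2])]
      exact Icc_subset_Icc_right (by linarith))).comp_sub_right w
    simp only [zero_add, sub_add_cancel] at h2
    refine h2.congr fun v _ => ?_
    rw [show (1 : ℝ) - α - 1 = -α by ring, show T - w + 1 - (v - w) = T + 1 - v by ring]
  have hset1 : ∀ w ∈ Ioc 0 T, Ioc 0 T ∩ Ioi w = Ioc w T := by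
    intro w hw
    ext v
    simp only [mem_inter_iff, mem_Ioc, mem_Ioi]
    exact ⟨fun h => ⟨h.2, h.1.2⟩, fun h => ⟨⟨hw.1.trans h.1, h.2⟩, h.1⟩⟩
  have hind1 : ∀ w, (fun v => f w v) = (Ioi w).indicator fun v =>
      (s * w ^ (s - 1)) * ((v - w) ^ (-α) * (T + 1 - v) ^ (α - 1)) := by
    intro w
    funext v
    simp [f, indicator, mem_Ioi]
  have hint1 : ∀ w ∈ Ioc 0 T, Integrable (fun v => f w v) μ := by
    intro w hw
    rw [hind1, integrable_indicator_iff measurableSet_Ioi]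
    simp only [μ, IntegrableOn]
    rw [Measure.restrict_restrict measurableSet_Ioi, inter_comm, hset1 w hw]
    exact ((hshift w hw).const_mul _).1
  have hval1 : ∀ w ∈ Ioc 0 T, histConst α * (1 - α) * ∫ v, f w v ∂μ =
      (s * w ^ (s - 1)) * (1 - histKernel α (T - w)) := by
    intro w hw
    rw [hind1, integral_indicator measurableSet_Ioi]
    simp only [μ]
    rw [Measure.restrict_restrict measurableSet_Ioi, inter_comm, hset1 w hw,
      ← intervalIntegral.integral_of_le hw.2, intervalIntegral.integral_const_mul,
      ← integral_eq_one_sub_histKernel hα hα1 (show 0 ≤ T - w by linarith [hw.2])]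
    have h := intervalIntegral.integral_comp_sub_right (a := w) (b := T)
      (fun t : ℝ => t ^ (-α) * (T - w + 1 - t) ^ (α - 1)) w
    rw [sub_self] at h
    rw [← h]
    simp only [show ∀ v : ℝ, T - w + 1 - (v - w) = T + 1 - v from fun v => by ring]
    ring
  have hcontK : ContinuousOn (fun w : ℝ => histKernel α (T - w)) (uIcc 0 T) := by
    rw [uIcc_of_le hT.le]
    exact (continuousOn_histKernel hα hα1).comp (by fun_prop) fun w hw => by
      simp only [mem_Ici]
      linarith [hw.2]
  have hpow : IntervalIntegrable (fun w : ℝ => s * w ^ (s - 1)) volume 0 T :=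
    (intervalIntegral.intervalIntegrable_rpow' (by linarith)).const_mul s
  have hs0 : 0 < histConst α * (1 - α) := mul_pos (histConst_pos hα (by linarith)) (by linarith)
  have hcK := hpow.continuousOn_mul hcontK
  have hone : IntervalIntegrable (fun w : ℝ => (s * w ^ (s - 1)) * (1 - histKernel α (T - w)))
      volume 0 T := hpow.mul_continuousOn (by fun_prop)
  -- On the square f is nonnegative, so integrability follows from the inner integral in v already
  -- computed in `hval1`.
  have hint : Integrable (Function.uncurry f) (μ.prod μ) := by
    rw [integrable_prod_iff hmeas.aestronglyMeasurable]
    refine ⟨(ae_restrict_mem measurableSet_Ioc).mono hint1, ?_⟩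
    have h2 : Integrable (fun w => (histConst α * (1 - α))⁻¹ *
        ((s * w ^ (s - 1)) * (1 - histKernel α (T - w)))) μ := hone.1.const_mul _
    refine h2.congr ?_
    filter_upwards [ae_restrict_mem measurableSet_Ioc] with w hw
    rw [← hval1 w hw, inv_mul_cancel_left₀ hs0.ne']
    refine integral_congr_ae ?_
    filter_upwards [ae_restrict_mem measurableSet_Ioc] with v hv
    exact (Real.norm_of_nonneg (hf0 w hw v hv)).symm
  have hswap := integral_integral_swap hint
  have hset2 : ∀ v ∈ Ioc 0 T, Ioc 0 T ∩ Iio v = Ioo 0 v := by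
    intro v hv
    ext w
    simp only [mem_inter_iff, mem_Ioc, mem_Iio, mem_Ioo]
    exact ⟨fun h => ⟨h.1.1, h.2⟩, fun h => ⟨⟨h.1, h.2.le.trans hv.2⟩, h.2⟩⟩
  have hval2 : ∀ v ∈ Ioc 0 T, ∫ w, f w v ∂μ =
      (s * (Real.Gamma s * Real.Gamma (1 - α) / Real.Gamma (s + (1 - α)))) *
        (v ^ (s - α) * (T + 1 - v) ^ (α - 1)) := by
    intro v hv
    have hind2 : (fun w => f w v) = (Iio v).indicator fun w =>
        (s * w ^ (s - 1)) * ((v - w) ^ (-α) * (T + 1 - v) ^ (α - 1)) := by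
      funext w
      simp [f, indicator, mem_Iio]
    rw [hind2, integral_indicator measurableSet_Iio]
    simp only [μ]
    rw [Measure.restrict_restrict measurableSet_Iio, inter_comm, hset2 v hv,
      ← integral_Ioc_eq_integral_Ioo, ← intervalIntegral.integral_of_le hv.1.le]
    have h := integral_beta_scaled (a := s) (b := 1 - α) hv.1 hv.1.le le_rfl
    rw [div_self hv.1.ne', integral_beta hs (by linarith), show s + (1 - α) - 1 = s - α by ring,
      show (1 : ℝ) - α - 1 = -α by ring] at h
    have h3 : ∀ w : ℝ, (s * w ^ (s - 1)) * ((v - w) ^ (-α) * (T + 1 - v) ^ (α - 1)) =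
        (s * (T + 1 - v) ^ (α - 1)) * (w ^ (s - 1) * (v - w) ^ (-α)) := fun w => by ring
    simp only [h3]
    rw [intervalIntegral.integral_const_mul, h]
    ring
  have hL : histConst α * (1 - α) * ∫ w, ∫ v, f w v ∂μ ∂μ =
      T ^ s - ∫ w in (0 : ℝ)..T, histKernel α (T - w) * (s * w ^ (s - 1)) := by
    have h1 : ∫ w in (0 : ℝ)..T, s * w ^ (s - 1) = T ^ s := by
      rw [intervalIntegral.integral_const_mul, integral_rpow (Or.inl (by linarith))]
      simp only [sub_add_cancel, Real.zero_rpow hs.ne', sub_zero]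
      field_simp
    rw [← h1, ← intervalIntegral.integral_sub hpow hcK, ← integral_const_mul,
      intervalIntegral.integral_of_le hT.le]
    refine setIntegral_congr_fun measurableSet_Ioc fun w hw => ?_
    rw [hval1 w hw]
    ring
  have hR : ∫ v, ∫ w, f w v ∂μ ∂μ =
      (s * (Real.Gamma s * Real.Gamma (1 - α) / Real.Gamma (s + (1 - α)))) *
        ((T + 1) ^ s * incompleteBeta (T / (T + 1)) (s - α + 1) α) := by
    have h1 := integral_beta_scaled (a := s - α + 1) (b := α) (T := T + 1) (S := T) (by linarith)
      hT.le (by linarith)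
    rw [show s - α + 1 + α - 1 = s by ring] at h1
    rw [incompleteBeta, ← h1, ← intervalIntegral.integral_const_mul,
      intervalIntegral.integral_of_le hT.le]
    refine setIntegral_congr_fun measurableSet_Ioc fun v hv => ?_
    rw [hval2 v hv, add_sub_cancel_right]
  rw [hswap, hR, histConst_mul_one_sub hα1, show s + (1 - α) = s - α + 1 by ring] at hL
  rw [Real.Gamma_add_one hs.ne', eq_sub_iff_add_eq, ← eq_sub_iff_add_eq', ← hL]
  have h1 := (Real.Gamma_pos_of_pos hα).ne'
  have h2 := (Real.Gamma_pos_of_pos (show 0 < 1 - α by linarith)).ne'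
  have h3 := (Real.Gamma_pos_of_pos (show 0 < s - α + 1 by linarith)).ne'
  field_simp

end kernel

end

/-! ### Decay of the defect of the discretized history load. -/

section

open MeasureTheory Set

/-- The derivative on `[j, j + 1]` of the piecewise polynomial interpolant of `t ^ s`. -/
def slope (p : Fin 2) (s : ℝ) (j : ℕ) (τ : ℝ) : ℝ :=
  (((j + 1 : ℕ) : ℝ) ^ s - (j : ℝ) ^ s) + (if p = 0 ∨ j = 0 then 0 else
    ((j + 1 : ℕ) : ℝ) ^ s - 2 * (j : ℝ) ^ s + ((j - 1 : ℕ) : ℝ) ^ s) * (τ - 1 / 2)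

/-- The error on `[j, j + 1]` of the derivative of the interpolant of `t ^ s`. -/
def slopeError (p : Fin 2) (s : ℝ) (j : ℕ) (τ : ℝ) : ℝ := s * ((j : ℝ) + τ) ^ (s - 1) - slope p s j τ

theorem intervalIntegrable_shift_rpow {s : ℝ} (hs : 0 < s) (j : ℕ) :
    IntervalIntegrable (fun τ : ℝ => s * ((j : ℝ) + τ) ^ (s - 1)) volume 0 1 := by
  have h := (intervalIntegral.intervalIntegrable_rpow' (a := (j : ℝ) + 0) (b := (j : ℝ) + 1)
    (r := s - 1) (by linarith)).comp_add_left (j : ℝ)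
  simp only [add_sub_cancel_left] at h
  exact h.const_mul s

theorem continuous_slope (p : Fin 2) (s : ℝ) (j : ℕ) : Continuous (slope p s j) := by
  unfold slope
  fun_prop

theorem intervalIntegrable_slopeError (p : Fin 2) {s : ℝ} (hs : 0 < s) (j : ℕ) :
    IntervalIntegrable (slopeError p s j) volume 0 1 :=
  (intervalIntegrable_shift_rpow hs j).sub ((continuous_slope p s j).intervalIntegrable _ _)

/-- The interpolant agrees with the power at both ends of the cell, and its quadratic part enters
with the mean-zero factor τ - 1/2. -/
theorem integral_slopeError (p : Fin 2) {s : ℝ} (hs : 0 < s) (j : ℕ) :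
    ∫ τ in (0 : ℝ)..1, slopeError p s j τ = 0 := by
  have h1 : ∫ τ in (0 : ℝ)..1, s * ((j : ℝ) + τ) ^ (s - 1) = ((j + 1 : ℕ) : ℝ) ^ s - (j : ℝ) ^ s := by
    rw [intervalIntegral.integral_const_mul, intervalIntegral.integral_comp_add_left
      (fun t : ℝ => t ^ (s - 1)), integral_rpow (Or.inl (by linarith)), add_zero, sub_add_cancel]
    push_cast
    field_simp
  have h2 : ∫ τ in (0 : ℝ)..1, slope p s j τ = ((j + 1 : ℕ) : ℝ) ^ s - (j : ℝ) ^ s := by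
    unfold slope
    rw [intervalIntegral.integral_add (by simp) (Continuous.intervalIntegrable (by fun_prop) _ _),
      intervalIntegral.integral_const_mul, integral_sub_half]
    simp
  simp only [slopeError]
  rw [intervalIntegral.integral_sub (intervalIntegrable_shift_rpow hs j)
    ((continuous_slope p s j).intervalIntegrable _ _), h1, h2, sub_self]

/-- The derivative of an interpolant of degree p + 1 errs by a quantity of order j^(s-p-2). The
linear first cell for p = 1 does not affect the limit. -/
theorem tendsto_integral_abs_slopeError (p : Fin 2) {s : ℝ} (hs : s < (p : ℕ) + 2) :
    Tendsto (fun j => ∫ τ in (0 : ℝ)..1, |slopeError p s j τ|) atTop (𝓝 0) := by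
  have hbound : ∀ (j : ℕ) (C : ℝ), (∀ τ ∈ Icc (0 : ℝ) 1, |slopeError p s j τ| ≤ C) →
      ‖∫ τ in (0 : ℝ)..1, |slopeError p s j τ|‖ ≤ C := by
    intro j C hC
    have h := intervalIntegral.norm_integral_le_of_norm_le_const (a := 0) (b := 1)
      (f := fun τ => |slopeError p s j τ|) (C := C) fun τ hτ => by
        rw [uIoc_of_le zero_le_one] at hτ
        rw [Real.norm_eq_abs, abs_abs]
        exact hC τ (Ioc_subset_Icc_self hτ)
    simpa using h
  by_cases hp : p = 0
  · subst hp
    have hs2 : s < 2 := by simpa using hs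
    refine squeeze_zero_norm' ?_ (tendsto_const_mul_rpow_add_rpow
      (t := s - 2) (by linarith) |s * (s - 1)| 0 1)
    filter_upwards [eventually_gt_atTop 0] with j hj
    refine hbound j _ fun τ hτ => ?_
    have h := abs_rpow_deriv_sub_le s (a := j) (w := j + τ) (by exact_mod_cast hj)
      ⟨by linarith [hτ.1], by linarith [hτ.2]⟩
    simpa [slopeError, slope] using h
  · have hp1 : p = 1 := by omega
    subst hp1
    have hs3 : s < 3 := by
      norm_num at hs
      linarith
    have h1 := (tendsto_const_mul_rpow_add_rpow
      (t := s - 3) (by linarith) |s * (s - 1) * (s - 2)| (-1) 1).const_mul 4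
    rw [mul_zero] at h1
    refine squeeze_zero_norm' ?_ h1
    filter_upwards [eventually_gt_atTop 1] with j hj
    refine hbound j _ fun τ hτ => ?_
    have hj1 : (1 : ℝ) < j := by exact_mod_cast hj
    have h := abs_rpow_deriv_sub_quadratic_le s (a := j - 1) (w := j + τ) (by linarith)
      ⟨by linarith [hτ.1], by linarith [hτ.2]⟩
    rw [show (j : ℝ) - 1 + 2 = j + 1 by ring, show (j : ℝ) - 1 + 1 = j by ring,
      add_sub_cancel_left] at h
    have hcast : ((j - 1 : ℕ) : ℝ) = j - 1 := by
      rw [Nat.cast_sub hj.le, Nat.cast_one]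
    rw [slopeError, slope, hcast, if_neg (by simp; omega), Nat.cast_add, Nat.cast_one,
      ← sub_eq_add_neg]
    exact h

/-- At α = 1 the discrete load vanishes and the incomplete beta function is elementary; what remains
cancels k^s. -/
theorem defectHist_one (p : Fin 2) {k : ℕ} (hk : k ≠ 0) {s : ℝ} (hs : 0 < s) :
    defectHist 1 p k s = 0 := by
  have h1 : ∑ j ∈ Finset.range (k + 1), gammaCoeff 1 p k j * (j : ℝ) ^ s = 0 :=
    Finset.sum_eq_zero fun j hj => by
      rw [gammaCoeff_one p (Nat.le_of_lt_succ (Finset.mem_range.mp hj)), zero_mul]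
  have h2 : incompleteBeta ((k : ℝ) / (k + 1)) (s - 1 + 1) 1 = ((k : ℝ) / (k + 1)) ^ s / s := by
    simp only [incompleteBeta, sub_add_cancel, sub_self, Real.rpow_zero, mul_one]
    rw [integral_rpow (Or.inl (by linarith)), sub_add_cancel, Real.zero_rpow hs.ne', sub_zero]
  have hk0 : (0 : ℝ) ≤ k := Nat.cast_nonneg k
  have hk1 : (0 : ℝ) < (k : ℝ) + 1 := by positivity
  rw [defectHist, h1, h2, Real.Gamma_one, sub_add_cancel, Real.Gamma_add_one hs.ne',
    Real.div_rpow hk0 hk1.le]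
  have h3 := (Real.Gamma_pos_of_pos hs).ne'
  have h4 := (Real.rpow_pos_of_pos hk1 s).ne'
  field_simp
  ring

section kernel

variable {α : ℝ}

/-- The exact load integrates the kernel against the derivative of t^s, the discrete one against the
derivative of the interpolant. The defect is the difference, cell by cell. -/
theorem defectHist_eq_sum (hα : 0 < α) (hα1 : α < 1) (p : Fin 2) {k : ℕ} (hk : k ≠ 0) {s : ℝ}
    (hs : 0 < s) : defectHist α p k s = ∑ j ∈ Finset.range k,
      ∫ τ in (0 : ℝ)..1, histKernel α ((k - j : ℕ) - τ) * slopeError p s j τ := by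
  have hk0 : (0 : ℝ) < k := by exact_mod_cast Nat.pos_of_ne_zero hk
  have hone : ∀ j < k, (1 : ℝ) ≤ (k - j : ℕ) := fun j hj => by
    exact_mod_cast (by omega : 1 ≤ k - j)
  have hD1 : ∫ w in (0 : ℝ)..k, histKernel α (k - w) * (s * w ^ (s - 1)) =
      ∑ j ∈ Finset.range k, ∫ τ in (0 : ℝ)..1,
        histKernel α ((k - j : ℕ) - τ) * (s * ((j : ℝ) + τ) ^ (s - 1)) := by
    have hint : IntervalIntegrable (fun w : ℝ => histKernel α (k - w) * (s * w ^ (s - 1)))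
        volume 0 k := by
      refine ((intervalIntegral.intervalIntegrable_rpow' (by linarith)).const_mul s).continuousOn_mul
        ((continuousOn_histKernel hα hα1).comp (by fun_prop) fun w hw => ?_)
      rw [uIcc_of_le hk0.le] at hw
      simpa using hw.2
    have h := intervalIntegral.sum_integral_adjacent_intervals (a := fun j : ℕ => (j : ℝ)) (n := k)
      (f := fun w : ℝ => histKernel α (k - w) * (s * w ^ (s - 1))) (μ := volume) fun j hj =>
        hint.mono_set (by
          have h1 : ((j + 1 : ℕ) : ℝ) ≤ k := by exact_mod_cast hj
          have h2 : (j : ℝ) ≤ (j + 1 : ℕ) := by exact_mod_cast Nat.le_succ j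
          rw [uIcc_of_le h2, uIcc_of_le hk0.le]
          exact Icc_subset_Icc (Nat.cast_nonneg j) h1)
    rw [Nat.cast_zero] at h
    rw [← h]
    refine Finset.sum_congr rfl fun j hj => ?_
    have h2 := intervalIntegral.integral_comp_add_left (a := 0) (b := 1)
      (fun w : ℝ => histKernel α (k - w) * (s * w ^ (s - 1))) (j : ℝ)
    rw [add_zero] at h2
    rw [Nat.cast_add, Nat.cast_one, ← h2]
    refine intervalIntegral.integral_congr fun τ _ => ?_
    rw [Nat.cast_sub (Finset.mem_range.mp hj).le, ← sub_sub]
  have hD2 : histConst α * ∑ j ∈ Finset.range (k + 1), gammaCoeff α p k j * (j : ℝ) ^ s =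
      ∑ j ∈ Finset.range k, ∫ τ in (0 : ℝ)..1, histKernel α ((k - j : ℕ) - τ) * slope p s j τ := by
    rw [sum_gammaCoeff α p k fun j => (j : ℝ) ^ s, Finset.mul_sum]
    refine Finset.sum_congr rfl fun j hj => ?_
    have hj' := Finset.mem_range.mp hj
    simp only [slope]
    rw [integral_histKernel_linear hα hα1 (by omega)]
    split_ifs <;> ring
  have hsplit : ∀ j ∈ Finset.range k, ∫ τ in (0 : ℝ)..1,
      histKernel α ((k - j : ℕ) - τ) * slopeError p s j τ =
      (∫ τ in (0 : ℝ)..1, histKernel α ((k - j : ℕ) - τ) * (s * ((j : ℝ) + τ) ^ (s - 1))) -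
        ∫ τ in (0 : ℝ)..1, histKernel α ((k - j : ℕ) - τ) * slope p s j τ := by
    intro j hj
    have hj' := Finset.mem_range.mp hj
    rw [← intervalIntegral.integral_sub
      (intervalIntegrable_histKernel_mul hα hα1 (hone j hj') (intervalIntegrable_shift_rpow hs j))
      (intervalIntegrable_histKernel_mul hα hα1 (hone j hj')
        ((continuous_slope p s j).intervalIntegrable _ _))]
    refine intervalIntegral.integral_congr fun τ _ => ?_
    simp only [slopeError]
    ring
  rw [Finset.sum_congr rfl hsplit, Finset.sum_sub_distrib, ← hD1, ← hD2,
    integral_histKernel_rpow hα hα1 hs hk0]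
  rfl

/-- The slope error has mean zero, so a constant may be subtracted from the kernel. Only the drop of
the kernel over the cell remains, which is summable over the cells although the kernel itself decays
slowly. -/
theorem abs_integral_histKernel_mul_slopeError_le (hα : 0 < α) (hα1 : α < 1) (p : Fin 2) {m : ℝ}
    (hm : 1 ≤ m) {s : ℝ} (hs : 0 < s) (j : ℕ) :
    |∫ τ in (0 : ℝ)..1, histKernel α (m - τ) * slopeError p s j τ| ≤
      (histKernel α (m - 1) - histKernel α m) * ∫ τ in (0 : ℝ)..1, |slopeError p s j τ| := by
  have hi := intervalIntegrable_slopeError p hs j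
  have h0 : ∫ τ in (0 : ℝ)..1, histKernel α (m - τ) * slopeError p s j τ =
      ∫ τ in (0 : ℝ)..1, (histKernel α (m - τ) - histKernel α m) * slopeError p s j τ := by
    have h1 : ∫ τ in (0 : ℝ)..1, histKernel α m * slopeError p s j τ = 0 := by
      rw [intervalIntegral.integral_const_mul, integral_slopeError p hs, mul_zero]
    have h2 := intervalIntegral.integral_sub (intervalIntegrable_histKernel_mul hα hα1 hm hi)
      (hi.const_mul (histKernel α m))
    rw [h1, sub_zero] at h2
    rw [← h2]
    exact intervalIntegral.integral_congr fun τ _ => by ring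
  rw [h0, ← intervalIntegral.integral_const_mul, ← Real.norm_eq_abs]
  refine intervalIntegral.norm_integral_le_of_norm_le zero_le_one
    (f := fun τ => (histKernel α (m - τ) - histKernel α m) * slopeError p s j τ)
    (g := fun τ => (histKernel α (m - 1) - histKernel α m) * |slopeError p s j τ|)
    (Eventually.of_forall fun τ hτ => ?_) (hi.abs.const_mul _)
  have h1 := histKernel_sub_le hα hα1 hm (Ioc_subset_Icc_self hτ)
  have h2 : histKernel α m ≤ histKernel α (m - τ) :=
    (strictAntiOn_histKernel hα hα1).antitoneOn (by simp; linarith [hτ.2]) (by simp; linarith)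
      (by linarith [hτ.1])
  rw [norm_mul, Real.norm_eq_abs, Real.norm_eq_abs, abs_of_nonneg (by linarith)]
  exact mul_le_mul_of_nonneg_right (by linarith) (abs_nonneg _)

theorem summable_histKernel_diff (hα : 0 < α) (hα1 : α < 1) :
    Summable fun m : ℕ => ‖histKernel α m - histKernel α (m + 1)‖ := by
  have hnn : ∀ m : ℕ, 0 ≤ histKernel α m - histKernel α (m + 1) := fun m =>
    sub_nonneg.mpr ((strictAntiOn_histKernel hα hα1).antitoneOn (by simp) (by simp; positivity)
      (by linarith))
  refine summable_of_sum_range_le (c := 1) (fun _ => norm_nonneg _) fun n => ?_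
  simp only [Real.norm_of_nonneg (hnn _)]
  have h : ∑ i ∈ Finset.range n, (histKernel α i - histKernel α (i + 1)) =
      histKernel α 0 - histKernel α n := by
    have := Finset.sum_range_sub' (fun i : ℕ => histKernel α i) n
    simpa using this
  rw [h, histKernel_zero hα hα1]
  linarith [histKernel_nonneg hα hα1 (Nat.cast_nonneg (α := ℝ) n)]

/-- The cell bounds form a convolution of the summable kernel drops with the null sequence of slope
errors. -/
theorem tendsto_defectHist (hα : 0 < α) (hα1 : α ≤ 1) (p : Fin 2) {s : ℝ} (hs0 : 0 < s)
    (hs : s < α + (p : ℕ) + 1) : Tendsto (fun k => defectHist α p k s) atTop (𝓝 0) := by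
  rcases hα1.lt_or_eq with h1 | rfl
  swap
  · refine tendsto_const_nhds.congr' ?_
    filter_upwards [eventually_ne_atTop 0] with k hk
    exact (defectHist_one p hk hs0).symm
  rw [← tendsto_add_atTop_iff_nat 1]
  refine squeeze_zero_norm (fun n => ?_) (tendsto_conv_zero (summable_histKernel_diff hα h1)
    (tendsto_integral_abs_slopeError p (s := s) (by linarith)))
  rw [defectHist_eq_sum hα h1 p (Nat.succ_ne_zero n) hs0]
  refine (norm_sum_le _ _).trans ?_
  rw [← Finset.sum_range_reflect]
  refine Finset.sum_le_sum fun l hl => ?_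
  have hl' := Finset.mem_range.mp hl
  have e1 : n + 1 - (n + 1 - 1 - l) = l + 1 := by omega
  have e2 : n + 1 - 1 - l = n - l := by omega
  rw [e1, e2]
  have h2 := abs_integral_histKernel_mul_slopeError_le hα h1 p (m := ((l + 1 : ℕ) : ℝ)) (by simp)
    hs0 (n - l)
  rw [show ((l + 1 : ℕ) : ℝ) - 1 = l by simp] at h2
  refine h2.trans_eq ?_
  push_cast
  rfl

end kernel

end

/-! ### The recurrence of the method and its stability region. -/

section

theorem corr_const_mul {m : ℕ} (w : Fin m → ℝ) (c : ℂ) (v : ℕ → ℂ) :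
    corr w (fun k => c * v k) = c * corr w v := by
  simp only [corr, Finset.mul_sum]
  exact Finset.sum_congr rfl fun j _ => by ring

theorem corr_const {m : ℕ} (w : Fin m → ℝ) (c : ℂ) : corr w (fun _ => c) = 0 := by
  simp [corr]

theorem corr_congr {m M : ℕ} (hm : m ≤ M) (w : Fin m → ℝ) {u v : ℕ → ℂ}
    (h : ∀ j ≤ M, u j = v j) : corr w u = corr w v := by
  refine Finset.sum_congr rfl fun j _ => ?_
  have := j.2
  rw [h (j + 1) (by omega), h 0 (Nat.zero_le _)]

/-- The matrix of the linear system does not depend on k, so the weights inherit the decay of the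
defects. -/
theorem tendsto_corr_weights {s : ℕ → ℝ} {m : ℕ} {defect : ℕ → ℝ → ℝ}
    (h : ∀ r < m, Tendsto (fun k => defect k (s r)) atTop (𝓝 0)) (v : ℕ → ℂ) :
    Tendsto (fun k => corr (weights s m (defect k)) v) atTop (𝓝 0) := by
  have hw : ∀ j : Fin m, Tendsto (fun k => weights s m (defect k) j) atTop (𝓝 0) := by
    intro j
    simp only [weights, Matrix.mulVec, dotProduct]
    simpa using tendsto_finsetSum Finset.univ fun (r : Fin m) _ =>
      (h r r.2).const_mul ((powMatrix s m)⁻¹ j r)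
  have h1 : ∀ j : Fin m, Tendsto (fun k => ((weights s m (defect k) j : ℝ) : ℂ)
      * (v (j + 1) - v 0)) atTop (𝓝 0) := fun j => by
    simpa using ((Complex.continuous_ofReal.tendsto 0).comp (hw j)).mul_const (v (j + 1) - v 0)
  simpa [corr] using tendsto_finsetSum Finset.univ fun j _ => h1 j

theorem tendsto_gammaCoeff {α : ℝ} (hα : 0 < α) (hα1 : α ≤ 1) (p : Fin 2) (j : ℕ) :
    Tendsto (fun k => gammaCoeff α p k j) atTop (𝓝 0) := by
  refine (tendsto_add_atTop_iff_nat j).mp ?_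
  have hD := tendsto_histD hα hα1
  have hE := tendsto_histE hα hα1
  have e : ∀ {f : ℕ → ℝ} (P : Prop) [Decidable P], Tendsto f atTop (𝓝 0) →
      Tendsto (fun n => if P then 0 else f n) atTop (𝓝 0) := fun P _ hf => by
    by_cases hP : P
    · simp [hP]
    · simpa [hP] using hf
  have h := ((e (j = 0) ((tendsto_add_atTop_iff_nat 1).mpr hD)).sub hD).add
    (e (p = 0) (f := fun m => (if j ≤ 1 then 0 else histE α (m + 1))
        - 2 * (if j = 0 then 0 else histE α m) + histE α (m - 1)) (by
      simpa using ((e (j ≤ 1) ((tendsto_add_atTop_iff_nat 1).mpr hE)).sub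
        ((e (j = 0) hE).const_mul 2)).add (hE.comp (tendsto_sub_atTop_nat 1))))
  simp only [sub_zero, add_zero] at h
  refine h.congr fun m => ?_
  rw [add_comm m j, gammaCoeff_add]

/-- The coefficients of the implicit-explicit rule: `λ ∑ B_l u_{k+1-l}` is the uncorrected
discretization of `λ u + κ λ u`. -/
def imexCoeff (α : ℝ) (p : Fin 2) (κ : ℂ) (l : ℕ) : ℂ :=
  if p = 0 then if l = 0 then beta α p 0 else if l = 1 then κ * beta α p 0 else 0
  else if l = 0 then beta α p 0 else if l = 1 then (1 + κ) * beta α p 1 + 2 * κ * beta α p 0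
    else if l = 2 then -κ * beta α p 0 else 0

theorem sum_imexCoeff (α : ℝ) (p : Fin 2) (κ : ℂ) (k : ℕ) (u : ℕ → ℂ) :
    ∑ l ∈ Finset.range 3, imexCoeff α p κ l * u (k + 1 - l) =
      (1 + κ) * ∑ j ∈ Finset.range ((p : ℕ) + 1), (beta α p j : ℂ) * u (k + 1 - j)
        + κ * (beta α p 0 * (-u (k + 1) + extrapolate p k u)) := by
  have h10 : (1 : Fin 2) ≠ 0 := by decide
  obtain rfl | rfl : p = 0 ∨ p = 1 := by omega
  · simp only [imexCoeff, Finset.sum_range_succ, extrapolate, if_true]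
    norm_num
    ring
  · simp only [imexCoeff, Finset.sum_range_succ, extrapolate, h10, if_false]
    norm_num [Finset.sum_range_succ, show k + 1 - 2 = k - 1 by omega]
    ring

/-- The coefficients of the recurrence satisfied by the sequences of the method. -/
def recCoeff (α : ℝ) (p : Fin 2) (κ z : ℂ) (l : ℕ) : ℂ :=
  ((if l = 0 then 1 else if l = 1 then -1 else 0) - z * imexCoeff α p κ l)
    + if l = 0 then 0 else (histConst α : ℂ) * gammaConv α p (l - 1)

theorem conv_recCoeff (α : ℝ) (p : Fin 2) (κ z : ℂ) {k : ℕ} (hk : (p : ℕ) ≤ k) (u : ℕ → ℂ) :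
    conv (recCoeff α p κ z) u (k + 1) = u (k + 1) - u k
      - z * ((1 + κ) * ∑ j ∈ Finset.range ((p : ℕ) + 1), (beta α p j : ℂ) * u (k + 1 - j)
        + κ * (beta α p 0 * (-u (k + 1) + extrapolate p k u)))
      + histConst α * ∑ j ∈ Finset.range (k + 1), (gammaConv α p (k - j) : ℂ) * u j := by
  have hfin : ∑ l ∈ Finset.range (k + 2), ((if l = 0 then 1 else if l = 1 then -1 else 0)
      - z * imexCoeff α p κ l) * u (k + 1 - l) =
      ∑ l ∈ Finset.range 3, ((if l = 0 then 1 else if l = 1 then -1 else 0)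
      - z * imexCoeff α p κ l) * u (k + 1 - l) := by
    -- For k = 0 the term l = 2 lies outside the convolution range, but then p = 0 and its
    -- coefficient is zero.
    rcases Nat.eq_zero_or_pos k with rfl | hk0
    · have hp : p = 0 := Fin.ext (by simpa using hk)
      simp [Finset.sum_range_succ, imexCoeff, hp]
    · refine (Finset.sum_subset (Finset.range_subset_range.mpr (by omega)) fun l _ hl => ?_).symm
      have hl3 : 3 ≤ l := by simpa using hl
      simp [imexCoeff, show l ≠ 0 by omega, show l ≠ 1 by omega, show l ≠ 2 by omega]
  have hhist : ∑ l ∈ Finset.range (k + 2), (if l = 0 then 0 else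
      (histConst α : ℂ) * gammaConv α p (l - 1)) * u (k + 1 - l) =
      histConst α * ∑ j ∈ Finset.range (k + 1), (gammaConv α p (k - j) : ℂ) * u j := by
    rw [Finset.sum_range_succ', Finset.mul_sum, ← Finset.sum_range_reflect, if_pos rfl, zero_mul,
      add_zero]
    refine Finset.sum_congr rfl fun j hj => ?_
    have := Finset.mem_range.mp hj
    rw [if_neg (by omega), show k + 1 - 1 - j + 1 - 1 = k - j by omega,
      show k + 1 - (k + 1 - 1 - j + 1) = j by omega, mul_assoc]
  rw [conv_eq_sum_range]
  simp only [recCoeff, add_mul (_ - _), Finset.sum_add_distrib]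
  rw [hfin, hhist, ← sum_imexCoeff]
  simp only [Finset.sum_range_succ, Finset.sum_range_zero]
  norm_num
  ring

/-- The contribution of the starting values to the recurrence. -/
def recStart (α : ℝ) (p : Fin 2) (D : Corrections) (κ z : ℂ) (k : ℕ) (u : ℕ → ℂ) : ℂ :=
  z * corr (weights D.σ D.mU (defectAM α p k)) u
    + κ * z * corr (weights D.δ D.mF (defectAM α p k)) u
    - corr (weights D.σ D.mU' (defectHist α p k)) u
    + beta α p 0 * (κ * z * corr (weights D.δ D.mF' (defectExtra p k)) u)
    - histConst α * ∑ j ∈ Finset.range ((p : ℕ) + 1),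
        ((gammaCoeff α p k j - gammaConv α p (k - j) : ℝ) : ℂ) * u j

theorem dependsOnStart_recStart (α : ℝ) (p : Fin 2) (D : Corrections) (κ z : ℂ) :
    DependsOnStart (lastStart D p) (recStart α p D κ z) := by
  intro k u v h
  have h1 : D.mU ≤ lastStart D p := by simp [lastStart]
  have h2 : D.mU' ≤ lastStart D p := by simp [lastStart]
  have h3 : D.mF ≤ lastStart D p := by simp [lastStart]
  have h4 : D.mF' ≤ lastStart D p := by simp [lastStart]
  have h5 : (p : ℕ) ≤ lastStart D p := by simp [lastStart]
  simp only [recStart, corr_congr h1 _ h, corr_congr h2 _ h, corr_congr h3 _ h, corr_congr h4 _ h]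
  congr 2
  refine Finset.sum_congr rfl fun j hj => ?_
  rw [h j (by have := Finset.mem_range.mp hj; omega)]

theorem tendsto_recStart {α : ℝ} (hα : 0 < α) (hα1 : α ≤ 1) {p : Fin 2} {D : Corrections}
    (hD : PowersBounded α p D) (κ z : ℂ) (u : ℕ → ℂ) :
    Tendsto (fun k => recStart α p D κ z k u) atTop (𝓝 0) := by
  obtain ⟨h1, h2, h3, h4⟩ := hD
  have t1 := tendsto_corr_weights (s := D.σ) (m := D.mU) (defect := defectAM α p)
    (fun r hr => tendsto_defectAM hα p (D.σ_pos r) (h1 r hr)) u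
  have t2 := tendsto_corr_weights (s := D.δ) (m := D.mF) (defect := defectAM α p)
    (fun r hr => tendsto_defectAM hα p (D.δ_pos r) (h2 r hr)) u
  have t3 := tendsto_corr_weights (s := D.δ) (m := D.mF') (defect := defectExtra p)
    (fun r hr => tendsto_defectExtra p (h3 r hr)) u
  have t4 := tendsto_corr_weights (s := D.σ) (m := D.mU') (defect := defectHist α p)
    (fun r hr => tendsto_defectHist hα hα1 p (D.σ_pos r) (h4 r hr)) u
  have hγ := (hasSum_gammaConv hα hα1 p).summable.tendsto_atTop_zero
  have t5 : Tendsto (fun k => ∑ j ∈ Finset.range ((p : ℕ) + 1),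
      ((gammaCoeff α p k j - gammaConv α p (k - j) : ℝ) : ℂ) * u j) atTop (𝓝 0) := by
    have h : ∀ j, Tendsto (fun k => ((gammaCoeff α p k j - gammaConv α p (k - j) : ℝ) : ℂ) * u j)
        atTop (𝓝 0) := fun j => by
      have h0 := (tendsto_gammaCoeff hα hα1 p j).sub (hγ.comp (tendsto_sub_atTop_nat j))
      rw [sub_zero] at h0
      simpa using ((Complex.continuous_ofReal.tendsto 0).comp h0).mul_const (u j)
    simpa using tendsto_finsetSum (Finset.range ((p : ℕ) + 1)) fun j _ => h j
  simpa [recStart] using ((((t1.const_mul z).add (t2.const_mul (κ * z))).sub t4).add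
    ((t3.const_mul (κ * z)).const_mul ((beta α p 0 : ℝ) : ℂ))).sub (t5.const_mul (histConst α : ℂ))

/-- Only the columns j ≤ p deviate from convolution form; they multiply starting values, so the
deviation can go to the right-hand side. -/
theorem sum_gammaCoeff_split (α : ℝ) (p : Fin 2) {k : ℕ} (hk : (p : ℕ) ≤ k) (u : ℕ → ℂ) :
    ∑ j ∈ Finset.range (k + 1), (gammaCoeff α p k j : ℂ) * u j =
      ∑ j ∈ Finset.range (k + 1), (gammaConv α p (k - j) : ℂ) * u j
        + ∑ j ∈ Finset.range ((p : ℕ) + 1),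
          ((gammaCoeff α p k j - gammaConv α p (k - j) : ℝ) : ℂ) * u j := by
  rw [← sub_eq_iff_eq_add', ← Finset.sum_sub_distrib]
  refine ((Finset.sum_subset (Finset.range_subset_range.mpr (by omega)) fun j hj hj' => ?_).trans
    (Finset.sum_congr rfl fun j _ => ?_)).symm
  · simp only [Finset.mem_range] at hj hj'
    simp [gammaCoeff_eq_gammaConv_of_lt α p (show (p : ℕ) < j by omega)
      (show j ≤ k by omega)]
  · push_cast
    ring

theorem isIMEXSequence_iff {α : ℝ} (p : Fin 2) (D : Corrections) {h : ℝ} (hh : 0 < h)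
    {lam κ z : ℂ} (hz : lam * ((h ^ α : ℝ) : ℂ) = z) (u : ℕ → ℂ) :
    IsIMEXSequence α p D h lam (fun _ v => κ * lam * v) u ↔
      IsConvSolution (recCoeff α p κ z) (lastStart D p) (recStart α p D κ z) u := by
  have hH : ((h ^ α : ℝ) : ℂ) ≠ 0 := by exact_mod_cast (Real.rpow_pos_of_pos hh α).ne'
  refine forall_congr' fun k => forall_congr' fun hk => ?_
  have hpk : (p : ℕ) ≤ k := le_trans (by simp [lastStart]) hk
  have hc : (histConst α : ℂ) = 1 / ((Real.Gamma α * Real.Gamma (2 - α) : ℝ) : ℂ) := by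
    simp [histConst]
  have hS : ∑ j ∈ Finset.range ((p : ℕ) + 1), (beta α p j : ℂ) * (κ * lam * u (k + 1 - j)) =
      κ * lam * ∑ j ∈ Finset.range ((p : ℕ) + 1), (beta α p j : ℂ) * u (k + 1 - j) := by
    rw [Finset.mul_sum]
    exact Finset.sum_congr rfl fun j _ => by ring
  have hE : extrapolate p k (fun j => κ * lam * u j) = κ * lam * extrapolate p k u := by
    unfold extrapolate
    split_ifs <;> ring
  rw [conv_recCoeff α p κ z hpk, recStart, div_eq_iff hH]
  simp only [corrAM, corrHist, corr_const_mul, hS, hE, ← hc]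
  rw [sum_gammaCoeff_split α p hpk]
  have hi : 1 / ((h ^ α : ℝ) : ℂ) * ((h ^ α : ℝ) : ℂ) = 1 := one_div_mul_cancel hH
  set H : ℂ := ((h ^ α : ℝ) : ℂ)
  -- Only the relation H' * H = 1 is needed from here on, which makes the equivalence a polynomial
  -- identity.
  generalize 1 / H = H' at hi ⊢
  subst hz
  set S := ∑ j ∈ Finset.range ((p : ℕ) + 1), (beta α p j : ℂ) * u (k + 1 - j)
  set G := ∑ j ∈ Finset.range (k + 1), (gammaConv α p (k - j) : ℂ) * u j
  set T := ∑ j ∈ Finset.range ((p : ℕ) + 1),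
    ((gammaCoeff α p k j - gammaConv α p (k - j) : ℝ) : ℂ) * u j
  set C := corr (weights D.σ D.mU' (defectHist α p k)) u
  constructor
  · intro he
    linear_combination he - (histConst α * (G + T) + C) * hi
  · intro he
    linear_combination he + (histConst α * (G + T) + C) * hi

theorem sum_beta {α : ℝ} (hα : 0 < α) (p : Fin 2) :
    ∑ j ∈ Finset.range ((p : ℕ) + 1), beta α p j = 1 / Real.Gamma (α + 1) := by
  have h10 : (1 : Fin 2) ≠ 0 := by decide
  have hΓ := Real.Gamma_pos_of_pos (show 0 < α + 1 by linarith)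
  obtain rfl | rfl : p = 0 ∨ p = 1 := by omega
  · simp [beta]
  · simp only [beta, h10, if_false, Finset.sum_range_succ]
    norm_num
    rw [show α + 2 = α + 1 + 1 by ring, Real.Gamma_add_one (by linarith)]
    field_simp
    ring

/-- Constants are invisible to the corrections and to the history load; only the source survives,
with β_0 + ... + β_p = 1/Γ(α + 1). Its being nonzero drives the instability argument. -/
theorem recStart_one_sub_conv_one {α : ℝ} (hα : 0 < α) (p : Fin 2) (D : Corrections) (κ z : ℂ)
    {k : ℕ} (hk : (p : ℕ) ≤ k) :
    recStart α p D κ z k (fun _ => 1) - conv (recCoeff α p κ z) (fun _ => 1) (k + 1) =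
      z * ((1 + κ) * ((1 / Real.Gamma (α + 1) : ℝ) : ℂ)) := by
  have hE : extrapolate p k (fun _ => 1) = 1 := by
    unfold extrapolate
    split_ifs
    · rfl
    · norm_num
  have h0 := sum_gammaCoeff_split α p hk fun _ => 1
  have h1 : ∑ j ∈ Finset.range (k + 1), (gammaCoeff α p k j : ℂ) * 1 = 0 := by
    simp only [mul_one]
    exact_mod_cast sum_gammaCoeff_eq_zero α p k
  rw [conv_recCoeff α p κ z hk, recStart, hE, ← sum_beta hα p]
  simp only [corr_const, mul_one, Complex.ofReal_sum] at h0 h1 ⊢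
  linear_combination -(histConst α : ℂ) * h1 + (histConst α : ℂ) * h0

theorem hasSum_imexCoeff (α : ℝ) (p : Fin 2) (κ ξ : ℂ) :
    HasSum (fun l => imexCoeff α p κ l * ξ ^ l)
      (∑ l ∈ Finset.range 3, imexCoeff α p κ l * ξ ^ l) := by
  refine hasSum_sum_of_ne_finset_zero fun l hl => ?_
  have hl3 : 3 ≤ l := by simpa using hl
  simp [imexCoeff, show l ≠ 0 by omega, show l ≠ 1 by omega, show l ≠ 2 by omega]

theorem recCoeff_add_three (α : ℝ) (p : Fin 2) (κ z : ℂ) (n : ℕ) :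
    recCoeff α p κ z (n + 3) = (histConst α : ℂ) * gammaConv α p (n + 2) := by
  simp [recCoeff, imexCoeff]

theorem summable_recCoeff {α : ℝ} (hα : 0 < α) (hα1 : α ≤ 1) (p : Fin 2) (κ z : ℂ) :
    Summable fun n => ‖recCoeff α p κ z n‖ := by
  refine (summable_nat_add_iff 3).mp ?_
  simp only [recCoeff_add_three, norm_mul, Complex.norm_real, Real.norm_eq_abs]
  exact ((summable_nat_add_iff 2).mpr (summable_abs_gammaConv hα hα1 p)).mul_left _

theorem summable_bdiff_recCoeff {α : ℝ} (hα : 0 < α) (hα1 : α ≤ 1) (p : Fin 2) (κ z : ℂ) :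
    Summable fun n : ℕ => ((n : ℝ) + 1) * ‖bdiff (recCoeff α p κ z) n‖ := by
  refine (summable_nat_add_iff 4).mp ?_
  -- After a shift by 4 only history weights occur in the difference; the factor 2 comes from n + 5
  -- ≤ 2(n + 3).
  refine Summable.of_nonneg_of_le (fun _ => by positivity) (fun n => ?_)
    (((summable_nat_add_iff 2).mpr (summable_gammaConv_diff hα hα1 p)).mul_left
      (2 * |histConst α|))
  have h : bdiff (recCoeff α p κ z) (n + 4) =
      ((histConst α * (gammaConv α p (n + 2 + 1) - gammaConv α p (n + 2)) : ℝ) : ℂ) := by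
    rw [bdiff, if_neg (by omega), show n + 4 = n + 1 + 3 by ring, recCoeff_add_three,
      show n + 1 + 3 - 1 = n + 3 by omega, recCoeff_add_three, show n + 1 + 2 = n + 2 + 1 by ring]
    push_cast
    ring
  rw [h, Complex.norm_real, Real.norm_eq_abs, abs_mul]
  have h2 : 0 ≤ |histConst α| * |gammaConv α p (n + 2 + 1) - gammaConv α p (n + 2)| := by positivity
  push_cast
  nlinarith [mul_nonneg (show (0 : ℝ) ≤ n + 1 by positivity) h2]

theorem tsum_recCoeff {α : ℝ} (hα : 0 < α) (hα1 : α ≤ 1) (p : Fin 2) (κ z : ℂ) {ξ : ℂ}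
    (hξ : ‖ξ‖ ≤ 1) : ∑' l, recCoeff α p κ z l * ξ ^ l =
      symbolZero α p ξ - z * ∑ l ∈ Finset.range 3, imexCoeff α p κ l * ξ ^ l := by
  have hgen : HasSum (fun l => (gammaConv α p l : ℂ) * ξ ^ l) (gammaGen α p ξ) := by
    refine (Summable.of_norm_bounded (summable_abs_gammaConv hα hα1 p) fun l => ?_).hasSum
    rw [norm_mul, Complex.norm_real, norm_pow, Real.norm_eq_abs]
    exact mul_le_of_le_one_right (abs_nonneg _) (pow_le_one₀ (norm_nonneg _) hξ)
  have h1 : HasSum (fun l : ℕ => (if l = 0 then (1 : ℂ) else if l = 1 then -1 else 0) * ξ ^ l)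
      (1 - ξ) := by
    have := hasSum_sum_of_ne_finset_zero (L := SummationFilter.unconditional ℕ) (s := Finset.range 2)
      (f := fun l : ℕ => (if l = 0 then (1 : ℂ) else if l = 1 then -1 else 0) * ξ ^ l)
      fun l hl => by
        have hl2 : 2 ≤ l := by simpa [Nat.succ_le_iff] using hl
        simp [show l ≠ 0 by omega, show l ≠ 1 by omega]
    simpa [Finset.sum_range_succ, sub_eq_add_neg] using this
  have h2 : HasSum (fun l : ℕ => (if l = 0 then 0 else
      (histConst α : ℂ) * gammaConv α p (l - 1)) * ξ ^ l)
      (histConst α * ξ * gammaGen α p ξ) := by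
    refine (hasSum_nat_add_iff' 1).mp ?_
    simp only [Finset.sum_range_one, if_true, zero_mul, sub_zero]
    refine (hgen.mul_left (histConst α * ξ)).congr_fun fun l => ?_
    simp only [Nat.add_eq_zero_iff, one_ne_zero, and_false, if_false, Nat.add_sub_cancel]
    ring
  have h3 := ((h1.sub ((hasSum_imexCoeff α p κ ξ).mul_left z)).add h2).tsum_eq
  have h4 : (histConst α : ℂ) = 1 / ((Real.Gamma α : ℂ) * (Real.Gamma (2 - α) : ℂ)) := by
    simp [histConst]
  rw [symbolZero]
  rw [h4] at h3
  calc _ = _ := tsum_congr fun l => ?_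
    _ = _ := h3.trans (by ring)
  simp only [recCoeff, h4]
  ring

/-- The stability region consists of the points `z` for which the symbol `symbolZero - z Q` has
no zero in the closed unit disc. -/
theorem mem_stabilityRegion_iff {α : ℝ} (hα : 0 < α) (hα1 : α ≤ 1) {p : Fin 2} {D : Corrections}
    {κ : ℂ} (hκ : κ ≠ -1) (hD : PowersBounded α p D) (z : ℂ) :
    z ∈ stabilityRegion α p D κ ↔ ∀ ξ : ℂ, ‖ξ‖ ≤ 1 →
      symbolZero α p ξ ≠ z * ∑ l ∈ Finset.range 3, imexCoeff α p κ l * ξ ^ l := by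
  have ha := summable_recCoeff hα hα1 p κ z
  have hpM : (p : ℕ) ≤ lastStart D p := by simp [lastStart]
  have hstart := dependsOnStart_recStart α p D κ z
  constructor
  · intro hz ξ hξ hzero
    -- A single realization of z suffices for necessity: step size 1 and λ = z.
    have hstab := hz 1 z one_pos (by simp)
    have hiff := isIMEXSequence_iff (α := α) p D one_pos (lam := z) (κ := κ) (z := z) (by simp)
    obtain ⟨u, ⟨hu1, hu⟩, -⟩ := hstab.1 fun _ => 1
    have hu1' : ∀ j ≤ lastStart D p, u j = 1 := fun j hj => hu1 ⟨j, Nat.lt_succ_of_le hj⟩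
    by_cases hz0 : z = 0
    · have hone : IsIMEXSequence α p D 1 z (fun _ v => κ * z * v) fun _ => 1 := by
        refine (hiff _).mpr fun k hk => ?_
        have := recStart_one_sub_conv_one hα p D κ z (hpM.trans hk)
        rw [hz0, zero_mul, sub_eq_zero] at this
        rw [hz0, this]
      exact one_ne_zero (tendsto_nhds_unique tendsto_const_nhds (hstab.2 _ hone))
    · have hb : z * ((1 + κ) * ((1 / Real.Gamma (α + 1) : ℝ) : ℂ)) ≠ 0 := by
        refine mul_ne_zero hz0 (mul_ne_zero (fun h => hκ ?_) ?_)
        · linear_combination h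
        · exact_mod_cast (one_div_pos.mpr (Real.Gamma_pos_of_pos (by linarith))).ne'
      have hξ1 : ξ ≠ 1 := by
        rintro rfl
        -- Applied to the constant sequence 1 at k = 0, this evaluates Q(1), which is (1 + κ)/Γ(α +
        -- 1).
        have hs := sum_imexCoeff α p κ 0 fun _ => 1
        rw [symbolZero_one hα hα1] at hzero
        refine hb ?_
        have hE : extrapolate p 0 (fun _ => 1) = 1 := by
          unfold extrapolate
          split_ifs
          · rfl
          · norm_num
        rw [hE] at hs
        simp only [one_pow, mul_one] at hzero hs
        rw [← sum_beta hα p, Complex.ofReal_sum]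
        linear_combination -hzero - z * hs
      refine not_stable_of_zero ha (summable_bdiff_recCoeff hα hα1 p κ z) hstart hb
        (fun k hk => recStart_one_sub_conv_one hα p D κ z (hpM.trans hk)) hξ hξ1 ?_ hu1'
        ((hiff u).mp hu) (hstab.2 u hu)
      rw [tsum_recCoeff hα hα1 p κ z hξ, hzero, sub_self]
  · intro hne h lam hh hz
    have h0 : ∀ ξ : ℂ, ‖ξ‖ ≤ 1 → ∑' l, recCoeff α p κ z l * ξ ^ l ≠ 0 := fun ξ hξ => by
      rw [tsum_recCoeff hα hα1 p κ z hξ]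
      exact sub_ne_zero.mpr (hne ξ hξ)
    have ha0 : recCoeff α p κ z 0 ≠ 0 := by
      have := h0 0 (by simp)
      rwa [tsum_eq_single 0 (fun l hl => by simp [hl]), pow_zero, mul_one] at this
    constructor
    · intro s
      simp only [isIMEXSequence_iff p D hh hz]
      exact existsUnique_convSolution ha0 hstart s
    · intro u hu
      exact tendsto_zero_of_isConvSolution ha h0 (tendsto_recStart hα hα1 hD κ z)
        ((isIMEXSequence_iff p D hh hz u).mp hu)

/-- The complement form of the stability region, for a normalized denominator `Q = c q`. -/
theorem stabilityRegion_eq {α : ℝ} (hα : 0 < α) (hα1 : α ≤ 1) {p : Fin 2} {D : Corrections}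
    {κ : ℂ} (hκ : κ ≠ -1) (hD : PowersBounded α p D) {c : ℂ} (hc : c ≠ 0) {q : ℂ → ℂ}
    (hq1 : q 1 ≠ 0)
    (hq : ∀ ξ, q ξ = c * ∑ l ∈ Finset.range 3, imexCoeff α p κ l * ξ ^ l) :
    stabilityRegion α p D κ =
      Set.univ \ {z : ℂ | ∃ ξ : ℂ, ‖ξ‖ ≤ 1 ∧ q ξ ≠ 0 ∧ z = c / q ξ * symbolZero α p ξ} := by
  ext z
  rw [mem_stabilityRegion_iff hα hα1 hκ hD]
  simp only [Set.mem_sdiff, Set.mem_univ, true_and, Set.mem_ofPred_eq, not_exists, not_and]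
  refine forall_congr' fun ξ => forall_congr' fun hξ => ?_
  constructor
  · intro hne hqξ hz
    refine hne ?_
    rw [hz]
    have h2 := hq ξ
    field_simp
    rw [h2]
    ring
  · intro hne hsym
    -- At a zero of q the equation reduces to `symbolZero α p ξ = 0`, so ξ = 1, where q does not
    -- vanish. Hence the points left out of the quotient form exclude no further z.
    by_cases hqξ : q ξ = 0
    · have h0 : ∑ l ∈ Finset.range 3, imexCoeff α p κ l * ξ ^ l = 0 :=
        (mul_eq_zero.mp ((hq ξ).symm.trans hqξ)).resolve_left hc
      rw [h0, mul_zero] at hsym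
      exact hq1 (eq_one_of_symbolZero_eq_zero hα hα1 p hξ hsym ▸ hqξ)
    · refine hne hqξ ?_
      rw [hsym]
      have h2 := hq ξ
      field_simp
      rw [h2]
      ring

end

end IMEX

end

theorem mainTheorem2 (α : ℝ) (hα0 : 0 < α) (hα1 : α ≤ 1) (κ : ℂ) (hκ : κ ≠ -1)
    (D : IMEX.Corrections) :
    (∀ p : Fin 2, Summable fun l : ℕ => |IMEX.gammaConv α p l|) ∧
    (IMEX.PowersBounded α 0 D →
      IMEX.stabilityRegion α 0 D κ =
        Set.univ \ {z : ℂ | ∃ ξ : ℂ, ‖ξ‖ ≤ 1 ∧ 1 + κ * ξ ≠ 0 ∧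
          z = (Real.Gamma (α + 1) : ℂ) / (1 + κ * ξ) *
            (1 - ξ + IMEX.gammaGen α 0 ξ * ξ /
              ((Real.Gamma α : ℂ) * (Real.Gamma (2 - α) : ℂ)))}) ∧
    (IMEX.PowersBounded α 1 D →
      IMEX.stabilityRegion α 1 D κ =
        Set.univ \ {z : ℂ | ∃ ξ : ℂ, ‖ξ‖ ≤ 1 ∧
          (1 + κ) * (α * ξ + 1) - κ * (ξ - 1) ^ 2 ≠ 0 ∧
          z = (Real.Gamma (α + 2) : ℂ) / ((1 + κ) * (α * ξ + 1) - κ * (ξ - 1) ^ 2) *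
            (1 - ξ + IMEX.gammaGen α 1 ξ * ξ /
              ((Real.Gamma α : ℂ) * (Real.Gamma (2 - α) : ℂ)))}) := by
  have hκ' : 1 + κ ≠ 0 := fun h => hκ (by linear_combination h)
  refine ⟨IMEX.summable_abs_gammaConv hα0 hα1, fun hD => ?_, fun hD => ?_⟩
  · have hΓ : (Real.Gamma (α + 1) : ℂ) ≠ 0 := by
      exact_mod_cast (Real.Gamma_pos_of_pos (by linarith)).ne'
    refine IMEX.stabilityRegion_eq hα0 hα1 hκ hD hΓ (q := fun ξ => 1 + κ * ξ) (by simpa using hκ')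
      fun ξ => ?_
    simp only [IMEX.imexCoeff, IMEX.beta, Finset.sum_range_succ, Finset.sum_range_zero]
    norm_num
    field_simp
  · have hΓ : (Real.Gamma (α + 2) : ℂ) ≠ 0 := by
      exact_mod_cast (Real.Gamma_pos_of_pos (by linarith)).ne'
    have h10 : (1 : Fin 2) ≠ 0 := by decide
    refine IMEX.stabilityRegion_eq hα0 hα1 hκ hD hΓ
      (q := fun ξ => (1 + κ) * (α * ξ + 1) - κ * (ξ - 1) ^ 2) ?_ fun ξ => ?_
    -- Here q 1 = (1 + κ)(α + 1).
    · have hα2 : (α : ℂ) + 1 ≠ 0 := by exact_mod_cast (by linarith : α + 1 ≠ 0)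
      simpa using ⟨hκ', hα2⟩
    · simp only [IMEX.imexCoeff, IMEX.beta, Finset.sum_range_succ, Finset.sum_range_zero, h10,
        if_false]
      norm_num
      field_simp
      ring
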